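/- **Setting.** Let $M$ be a connected $C^\infty$-manifold of dimension $n\ge 2$ without boundary. Let $L:TM\to[0,\infty)$ be a Lagrangian: $L\in C^1(TM)\cap C^\infty(TM\setminus 0_{TM})$, $L=0$ on the zero section $0_{TM}$, $L(v)\ge |v|_g-C$ for some complete Riemannian metric $g$ and some $C>0$, and for every $x$ the Hessian of $L|_{T_xM}$ is positive definite at every $v\in T_xM\setminus\{0\}$. Assume that the Hamiltonian $H(\alpha)=\sup_{v\in T_xM}\{\alpha(v)-L(v)\}$, $\alpha\in T_x^*M$, is finite on all of $T^*M$. Let $\mathfrak m$ be a positive $C^\infty$-measure on $M$, written $\mathfrak m=e^{-\varsigma}dx^1\cdots dx^n$ in local coordinates. On $T^*M$ use the coordinates $(x^i;\alpha_j)$, $\alpha=\sum_j\alpha_j dx^j$, the symplectic form $\omega=\sum_i d\alpha_i\wedge dx^i$, and the (local) flow $\Phi_t$ of $\sum_i\{H_{\alpha_i}\partial_{x^i}-H_{x^i}\partial_{\alpha_i}\}$. **Curvature.** For $\alpha\in T_x^*M\setminus\{0\}$ put $\mathcal V_\alpha=\mathrm{span}\{\partial_{\alpha_i}\}\subset T_\alpha(T^*M)$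 with the inner product $\langle\xi,\zeta\rangle_\alpha=\sum_{i,j}H_{\alpha_i\alpha_j}(\alpha)\xi^i\zeta^j$, and $\mathcal J^t_\alpha=(d\Phi_t)^{-1}(\mathcal V_{\Phi_t(\alpha)})\subset T_\alpha(T^*M)$. A canonical frame consists of smooth curves $e_i^t\in\mathcal J^t_\alpha$ ($i=1,\dots,n$, $|t|<\varepsilon$) with $\omega(\dot e_i^t,e_j^t)=\delta_{ij}$ and $\ddot e_i^t\in\mathcal J_\alpha^t$; it is unique up to a constant orthogonal matrix. The Agrachev–Gamkrelidze curvature operator is the linear map $R^t_\alpha:\mathcal J^t_\alpha\to\mathcal J^t_\alpha$ with $R^t_\alpha(e_i^t)=-\ddot e_i^t$, and $\mathrm{Ric}^H(\alpha)$ is the trace of $R^0_\alpha:\mathcal V_\alpha\to\mathcal V_\alpha$. Let $\eta(t)$ be the projection of $\Phi_t(\alpha)$ to $M$ and write $\mathfrak m=e^{-\psi}\sqrt{\det[L_{v^iv^j}(\dot\eta)]}\,dx^1\cdots dx^n$ along $\eta$. Set $$\mathrm{Ric}^H_\infty(\alpha)=\mathrm{Ric}^H(\alpha)+(\psi\circ\eta)''(0),\qquad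 \mathrm{Ric}^H_N(\alpha)=\mathrm{Ric}^H_\infty(\alpha)-\frac{(\psi\circ\eta)'(0)^2}{N-n}\quad(n<N<\infty),$$ and $\mathrm{Ric}^H_n(\alpha)=\mathrm{Ric}^H_\infty(\alpha)$ if $(\psi\circ\eta)'(0)=0$, $\mathrm{Ric}^H_n(\alpha)=-\infty$ otherwise. **Hessian and Laplacians.** For $u\in C^\infty(M)$ and $x$ with $du_x\neq0$, let $(e_i^t)$ be a canonical frame along $\Phi_t(du_x)$ and $\mathcal H_{du_x}=\mathrm{span}\{\dot e_i^0\}$. The image of $d(du)_x$, spanned by $\partial_{x^i}+\sum_j\frac{\partial^2u}{\partial x^i\partial x^j}(x)\partial_{\alpha_j}$, is the graph of a linear map $\mathcal H_{du_x}\to\mathcal V_{du_x}$; its negative is $\mathrm{Hess}^Hu(x)$, and $\|\mathrm{Hess}^Hu\|_{HS(du)}$ is its Hilbert–Schmidt norm when $(\dot e^0_i)$ and $(e^0_i)$ are taken as orthonormal bases of $\mathcal H_{du_x}$ and $\mathcal V_{du_x}$. On the open set $\{du\ne0\}$ put $\operatorname{div}_{\mathfrak m}V=\sum_i\{\partial_{x^i}V^i-V^i\partial_{x^i}\varsigma\}$,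 $\nabla u=\sum_iH_{\alpha_i}(du)\partial_{x^i}$, $\Delta^H_{\mathfrak m}u=\operatorname{div}_{\mathfrak m}(\nabla u)$ and $$\Delta^{du}_{\mathfrak m}f=\operatorname{div}_{\mathfrak m}\Big(\sum_{i,j}H_{\alpha_i\alpha_j}(du)\frac{\partial f}{\partial x^j}\partial_{x^i}\Big).$$ **Theorem (Bochner–Weitzenböck formula).** Let $u\in C^\infty(M)$. At every $x\in M$ with $du_x\ne0$, $$\Delta^{du}_{\mathfrak m}\big(H(du)\big)-d(\Delta^H_{\mathfrak m}u)(\nabla u)=\mathrm{Ric}^H_\infty(du)+\big\|\mathrm{Hess}^Hu\big\|^2_{HS(du)},$$ and, for every $N\in[n,\infty)$, $$\Delta^{du}_{\mathfrak m}\big(H(du)\big)-d(\Delta^H_{\mathfrak m}u)(\nabla u)\ \ge\ \mathrm{Ric}^H_N(du)+\frac{(\Delta^H_{\mathfrak m}u)^2}{N}.$$ -/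

import Mathlib

open Set Filter MeasureTheory Function
open scoped Manifold ContDiff Topology Bundle

namespace HamiltonianBW

/-! ### Lagrangians and Hamiltonians on a manifold -/

/-- The coordinate space `ℝⁿ`. -/
abbrev Coord (n : ℕ) : Type := EuclideanSpace ℝ (Fin n)

/-- The coordinates `(x¹, …, xⁿ; α₁, …, αₙ)` of the cotangent bundle over a chart domain. -/
abbrev Phase (n : ℕ) : Type := Coord n × Coord n

section Manifold

variable {n : ℕ} {M : Type*} [TopologicalSpace M] [ChartedSpace (Coord n) M]
  [IsManifold (𝓡 n) ∞ M]

/-- A smooth Riemannian metric is complete: sequences that are Cauchy for its distance converge. -/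
def IsCompleteMetric
    (g : Bundle.ContMDiffRiemannianMetric (𝓡 n) ∞ (Coord n)
      (fun x : M => TangentSpace (𝓡 n) x)) : Prop :=
  letI : Bundle.RiemannianBundle (fun x : M => TangentSpace (𝓡 n) x) := ⟨g.toRiemannianMetric⟩
  ∀ s : ℕ → M,
    (∀ ε : ENNReal, 0 < ε → ∃ N : ℕ, ∀ i ≥ N, ∀ j ≥ N,
      Manifold.riemannianEDist (𝓡 n) (s i) (s j) < ε) →
    ∃ y : M, Tendsto s atTop (𝓝 y)

/-- Lagrangians: non-negative functions on `TM`, `C¹`, smooth off the zero section, vanishing on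
the zero section, bounded below by `|v|_g - C` for some complete Riemannian metric `g`, and with
positive definite fibrewise Hessian off the zero section. -/
structure IsLagrangian (L : TangentBundle (𝓡 n) M → ℝ) : Prop where
  nonneg : ∀ v, 0 ≤ L v
  contMDiff_one : ContMDiff (𝓡 n).tangent 𝓘(ℝ, ℝ) 1 L
  contMDiffOn : ContMDiffOn (𝓡 n).tangent 𝓘(ℝ, ℝ) ∞ L {v | v.2 ≠ 0}
  zero : ∀ x : M, L ⟨x, 0⟩ = 0
  superlinear : ∃ g : Bundle.ContMDiffRiemannianMetric (𝓡 n) ∞ (Coord n)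
      (fun x : M => TangentSpace (𝓡 n) x),
    IsCompleteMetric g ∧ ∃ C : ℝ, 0 < C ∧
      ∀ (x : M) (v : TangentSpace (𝓡 n) x), Real.sqrt (g.inner x v v) - C ≤ L ⟨x, v⟩
  strongly_convex : ∀ (x : M) (v w : Coord n), v ≠ 0 → w ≠ 0 →
    0 < fderiv ℝ (fderiv ℝ (fun v' : Coord n => L ⟨x, v'⟩)) v w w

/-- The Hamiltonian `H(α) = sup_v {α(v) - L(v)}` on the cotangent space at `x`. -/
noncomputable def hamiltonian (L : TangentBundle (𝓡 n) M → ℝ) (x : M)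
    (α : TangentSpace (𝓡 n) x →L[ℝ] ℝ) : ℝ :=
  ⨆ v : TangentSpace (𝓡 n) x, (α v - L ⟨x, v⟩)

/-- The Hamiltonian takes finite values on all of `T*M`. -/
def HasFiniteHamiltonian (L : TangentBundle (𝓡 n) M → ℝ) : Prop :=
  ∀ (x : M) (α : TangentSpace (𝓡 n) x →L[ℝ] ℝ),
    BddAbove (range fun v : TangentSpace (𝓡 n) x => α v - L ⟨x, v⟩)

/-- `ς` is a smooth function with `m = e^{-ς} dx¹ ⋯ dxⁿ` in the chart `φ`. -/
def IsWeight [MeasurableSpace M] (m : Measure M) (φ : OpenPartialHomeomorph M (Coord n))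
    (ς : Coord n → ℝ) : Prop :=
  ContDiffOn ℝ ∞ ς φ.target ∧
    (m.restrict φ.source).map φ =
      (volume.restrict φ.target).withDensity (fun q => ENNReal.ofReal (Real.exp (-ς q)))

/-- Positive `C^∞`-measures: in every smooth chart they have a positive smooth density. -/
def IsSmoothPositiveMeasure [MeasurableSpace M] (m : Measure M) : Prop :=
  ∀ φ ∈ IsManifold.maximalAtlas (𝓡 n) ∞ M, ∃ ς : Coord n → ℝ, IsWeight m φ ς

open Classical in
/-- The function `ς` with `m = e^{-ς} dx¹ ⋯ dxⁿ` in the chart `φ`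
(it is unique on the image of the chart). -/
noncomputable def weight [MeasurableSpace M] (m : Measure M)
    (φ : OpenPartialHomeomorph M (Coord n)) : Coord n → ℝ :=
  if h : ∃ ς : Coord n → ℝ, IsWeight m φ ς then h.choose else 0

/-- The covector `∑ pⱼ dxʲ` at `y`, with `xʲ` the coordinates of the chart `φ`. -/
noncomputable def covector (φ : OpenPartialHomeomorph M (Coord n)) (y : M) (p : Coord n) :
    TangentSpace (𝓡 n) y →L[ℝ] ℝ :=
  (innerSL ℝ p).comp (mfderiv (𝓡 n) (𝓡 n) φ y)

/-- The Hamiltonian in the coordinates of `T*M` given by `φ`. -/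
noncomputable def coordHamiltonian (L : TangentBundle (𝓡 n) M → ℝ)
    (φ : OpenPartialHomeomorph M (Coord n)) (z : Phase n) : ℝ :=
  hamiltonian L (φ.symm z.1) (covector φ (φ.symm z.1) z.2)

/-- The Lagrangian in the coordinates `(x¹, …, xⁿ; v¹, …, vⁿ)` of `TM` given by `φ`. -/
noncomputable def coordLagrangian (L : TangentBundle (𝓡 n) M → ℝ)
    (φ : OpenPartialHomeomorph M (Coord n)) (z : Coord n × Coord n) : ℝ :=
  L ⟨φ.symm z.1, mfderiv (𝓡 n) (𝓡 n) φ.symm z.1 z.2⟩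

/-- The domain in coordinate space that corresponds to `T*U`, `U` being the chart domain. -/
def phaseDomain (φ : OpenPartialHomeomorph M (Coord n)) : Set (Phase n) :=
  φ.target ×ˢ univ

end Manifold

/-! ### Hamiltonian flow, Jacobi curves and curvature

Here `h` is a Hamiltonian in coordinates and `D` is the coordinate domain on which the flow lives.
-/

variable {n : ℕ}

/-- The coordinate vector `∂/∂xⁱ` of the base. -/
noncomputable def baseDir (i : Fin n) : Coord n := EuclideanSpace.single i 1

/-- The coordinate vector `∂/∂xⁱ` of the cotangent bundle. -/
noncomputable def dirX (i : Fin n) : Phase n := (EuclideanSpace.single i 1, 0)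

/-- The coordinate vector `∂/∂αᵢ` of the cotangent bundle. -/
noncomputable def dirA (i : Fin n) : Phase n := (0, EuclideanSpace.single i 1)

/-- `H_{xⁱ}`. -/
noncomputable def partialX (h : Phase n → ℝ) (i : Fin n) (z : Phase n) : ℝ :=
  fderiv ℝ h z (dirX i)

/-- `H_{αᵢ}`. -/
noncomputable def partialA (h : Phase n → ℝ) (i : Fin n) (z : Phase n) : ℝ :=
  fderiv ℝ h z (dirA i)

/-- `H_{αᵢ αⱼ}`. -/
noncomputable def partialAA (h : Phase n → ℝ) (i j : Fin n) (z : Phase n) : ℝ :=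
  fderiv ℝ (partialA h i) z (dirA j)

/-- `∂f/∂xⁱ` for a function of the base coordinates. -/
noncomputable def partialBase (f : Coord n → ℝ) (i : Fin n) (q : Coord n) : ℝ :=
  fderiv ℝ f q (baseDir i)

/-- The Hamiltonian vector field `∑ {H_{αᵢ} ∂_{xⁱ} - H_{xⁱ} ∂_{αᵢ}}`. -/
noncomputable def hamVectorField (h : Phase n → ℝ) (z : Phase n) : Phase n :=
  (WithLp.toLp 2 fun i => partialA h i z, WithLp.toLp 2 fun i => -partialX h i z)

/-- `Φ` is a (continuous) local flow of the Hamiltonian vector field in `D`, for times in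
`(-ε, ε)` and initial points in a neighbourhood of `α`. -/
def IsLocalFlow (h : Phase n → ℝ) (D : Set (Phase n)) (α : Phase n) (ε : ℝ)
    (Φ : ℝ → Phase n → Phase n) : Prop :=
  ∃ W ∈ 𝓝 α, ContinuousOn (uncurry Φ) (Ioo (-ε) ε ×ˢ W) ∧
    ∀ β ∈ W, Φ 0 β = β ∧ ∀ t ∈ Ioo (-ε) ε,
      Φ t β ∈ D ∧ HasDerivAt (fun s => Φ s β) (hamVectorField h (Φ t β)) t

open Classical in
/-- The Hamiltonian flow `Φ_t` near `α`; by uniqueness of integral curves, its germ at `(0, α)`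
does not depend on the choice. -/
noncomputable def hamFlow (h : Phase n → ℝ) (D : Set (Phase n)) (α : Phase n) :
    ℝ → Phase n → Phase n :=
  if hex : ∃ Φ : ℝ → Phase n → Phase n, ∃ ε : ℝ, 0 < ε ∧ IsLocalFlow h D α ε Φ
  then hex.choose else fun _ z => z

/-- The canonical symplectic form `∑ dαᵢ ∧ dxⁱ`. -/
noncomputable def symp (v w : Phase n) : ℝ :=
  ∑ i, (v.2 i * w.1 i - v.1 i * w.2 i)

/-- The vertical space `span {∂_{αᵢ}}`. -/
noncomputable def vertical (n : ℕ) : Submodule ℝ (Phase n) :=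
  Submodule.span ℝ (range (dirA : Fin n → Phase n))

/-- The Jacobi curve `J_α^t = (dΦ_t)⁻¹(V_{Φ_t(α)})` of a flow. -/
noncomputable def jacobiCurve (Φ : ℝ → Phase n → Phase n) (α : Phase n) (t : ℝ) :
    Submodule ℝ (Phase n) :=
  (vertical n).comap (fderiv ℝ (Φ t) α : Phase n →ₗ[ℝ] Phase n)

/-- The inner product `⟨ξ, ζ⟩_α = ∑ H_{αᵢ αⱼ}(α) ξⁱ ζʲ` of the vertical space. -/
noncomputable def vertInner (h : Phase n → ℝ) (α ξ ζ : Phase n) : ℝ :=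
  ∑ i, ∑ j, partialAA h i j α * ξ.2 i * ζ.2 j

/-- Canonical frames: smooth curves `eᵢ^t` in the Jacobi curve with `ω(ėᵢ, eⱼ) = δᵢⱼ` and
`ëᵢ` in the Jacobi curve, for `t ∈ (-ε, ε)`. -/
structure IsCanonicalFrame (Φ : ℝ → Phase n → Phase n) (α : Phase n) (ε : ℝ)
    (e : Fin n → ℝ → Phase n) : Prop where
  smooth : ∀ i, ContDiffOn ℝ ∞ (e i) (Ioo (-ε) ε)
  mem : ∀ i, ∀ t ∈ Ioo (-ε) ε, e i t ∈ jacobiCurve Φ α t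
  darboux : ∀ i j, ∀ t ∈ Ioo (-ε) ε, symp (deriv (e i) t) (e j t) = if i = j then 1 else 0
  accel_mem : ∀ i, ∀ t ∈ Ioo (-ε) ε, deriv (deriv (e i)) t ∈ jacobiCurve Φ α t

open Classical in
/-- A canonical frame along `t ↦ Φ_t(α)`; it is unique near `t = 0` up to a constant orthogonal
matrix. -/
noncomputable def canonicalFrame (h : Phase n → ℝ) (D : Set (Phase n)) (α : Phase n) :
    Fin n → ℝ → Phase n :=
  if hex : ∃ e : Fin n → ℝ → Phase n, ∃ ε : ℝ, 0 < ε ∧ IsCanonicalFrame (hamFlow h D α) α ε e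
  then hex.choose else fun _ _ => 0

open Classical in
/-- The curvature operator `R_α^t : J_α^t → J_α^t`, determined by `R_α^t(eᵢ^t) = -ëᵢ^t`
(for `t` near `0`, where the canonical frame is a basis of `J_α^t`). -/
noncomputable def curvatureOperator (h : Phase n → ℝ) (D : Set (Phase n)) (α : Phase n) (t : ℝ) :
    jacobiCurve (hamFlow h D α) α t →ₗ[ℝ] jacobiCurve (hamFlow h D α) α t :=
  if hex : ∃ R : jacobiCurve (hamFlow h D α) α t →ₗ[ℝ] jacobiCurve (hamFlow h D α) α t,
      ∀ (i : Fin n) (v : jacobiCurve (hamFlow h D α) α t),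
        (v : Phase n) = canonicalFrame h D α i t →
          (R v : Phase n) = -deriv (deriv (canonicalFrame h D α i)) t
  then hex.choose else 0

open Classical in
/-- The Ricci curvature `Ric^H(α)`: the trace of `R_α^0`, and `0` on the zero section. -/
noncomputable def ricci (h : Phase n → ℝ) (D : Set (Phase n)) (α : Phase n) : ℝ :=
  if α.2 = 0 then 0 else LinearMap.trace ℝ _ (curvatureOperator h D α 0)

/-- The curve `η(t) = π(Φ_t(α))`. -/
noncomputable def baseCurve (h : Phase n → ℝ) (D : Set (Phase n)) (α : Phase n) (t : ℝ) :
    Coord n :=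
  (hamFlow h D α t α).1

/-- The matrix `L_{vⁱ vʲ}(x; v)` of a Lagrangian in coordinates. -/
noncomputable def lagHessian (l : Coord n × Coord n → ℝ) (x v : Coord n) :
    Matrix (Fin n) (Fin n) ℝ :=
  Matrix.of fun i j => fderiv ℝ (fderiv ℝ (fun v' => l (x, v'))) v (baseDir i) (baseDir j)

/-- The function `ψ ∘ η` in the decomposition `m = e^{-ψ} vol_{η̇}` along `η`, where
`m = e^{-ς} dx¹ ⋯ dxⁿ` and `vol_{η̇} = √det (L_{vⁱ vʲ}(η̇)) dx¹ ⋯ dxⁿ`. -/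
noncomputable def psiAlong (h : Phase n → ℝ) (l : Coord n × Coord n → ℝ) (ς : Coord n → ℝ)
    (D : Set (Phase n)) (α : Phase n) (t : ℝ) : ℝ :=
  ς (baseCurve h D α t) +
    Real.log (Real.sqrt (lagHessian l (baseCurve h D α t) (deriv (baseCurve h D α) t)).det)

open Classical in
/-- The weighted Ricci curvature `Ric^H_∞(α)`. -/
noncomputable def ricciInfty (h : Phase n → ℝ) (l : Coord n × Coord n → ℝ) (ς : Coord n → ℝ)
    (D : Set (Phase n)) (α : Phase n) : ℝ :=
  if α.2 = 0 then 0 else ricci h D α + deriv (deriv (psiAlong h l ς D α)) 0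

open Classical in
/-- The weighted Ricci curvature `Ric^H_N(α)` for finite `N ≥ n`; it may be `-∞` when `N = n`. -/
noncomputable def ricciN (h : Phase n → ℝ) (l : Coord n × Coord n → ℝ) (ς : Coord n → ℝ)
    (D : Set (Phase n)) (N : ℝ) (α : Phase n) : EReal :=
  if α.2 = 0 then 0
  else if N = n then
    if deriv (psiAlong h l ς D α) 0 = 0 then
      ((ricci h D α + deriv (deriv (psiAlong h l ς D α)) 0 : ℝ) : EReal)
    else ⊥
  else
    ((ricci h D α + deriv (deriv (psiAlong h l ς D α)) 0
      - (deriv (psiAlong h l ς D α) 0) ^ 2 / (N - n) : ℝ) : EReal)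

/-! ### Gradient, Hessian and Laplacians

Here `w` is a function on the base and `ς` the weight of the measure, both in coordinates. -/

/-- The point `(q; dw_q)` of the cotangent bundle. -/
noncomputable def dPoint (w : Coord n → ℝ) (q : Coord n) : Phase n :=
  (q, WithLp.toLp 2 fun i => partialBase w i q)

/-- The horizontal space `span {ėᵢ^0}` of a canonical frame. -/
noncomputable def horizontal (e : Fin n → ℝ → Phase n) : Submodule ℝ (Phase n) :=
  Submodule.span ℝ (range fun i => deriv (e i) 0)

/-- The image of `d(dw)_q`, spanned by `∂_{xⁱ} + ∑ⱼ (∂²w/∂xⁱ∂xʲ) ∂_{αⱼ}`. -/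
noncomputable def graphSpace (w : Coord n → ℝ) (q : Coord n) : Submodule ℝ (Phase n) :=
  Submodule.span ℝ (range fun i : Fin n =>
    dirX i + ∑ j, partialBase (partialBase w j) i q • (dirA j : Phase n))

open Classical in
/-- The Hessian of `w` at `q`, as a map from the horizontal to the vertical space: the negative of
the linear map whose graph is the image of `d(dw)_q`. -/
noncomputable def hessian (e : Fin n → ℝ → Phase n) (w : Coord n → ℝ) (q : Coord n) :
    horizontal e →ₗ[ℝ] vertical n :=
  if hex : ∃ T : horizontal e →ₗ[ℝ] vertical n, ∀ z : Phase n,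
      z ∈ graphSpace w q ↔ ∃ v : horizontal e, z = (v : Phase n) + (T v : Phase n)
  then -hex.choose else 0

/-- The squared Hilbert–Schmidt norm of the Hessian with respect to the canonical frame along
`t ↦ Φ_t(dw_q)`: the basis `ėᵢ^0` of the horizontal space is taken to be orthonormal, and the
vertical space carries the inner product for which `eᵢ^0` is orthonormal. -/
noncomputable def hessianHSNormSq (h : Phase n → ℝ) (D : Set (Phase n)) (w : Coord n → ℝ)
    (q : Coord n) : ℝ :=
  let e := canonicalFrame h D (dPoint w q)
  ∑ i, (let ξ : Phase n := hessian e w q ⟨deriv (e i) 0, Submodule.subset_span ⟨i, rfl⟩⟩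
    vertInner h (dPoint w q) ξ ξ)

/-- The divergence of a vector field with respect to `e^{-ς} dx¹ ⋯ dxⁿ`. -/
noncomputable def divergence (ς : Coord n → ℝ) (V : Coord n → Coord n) (q : Coord n) : ℝ :=
  ∑ i, (partialBase (fun y => V y i) i q - V q i * partialBase ς i q)

/-- The gradient vector field `∇w = ∑ H_{αᵢ}(dw) ∂_{xⁱ}`. -/
noncomputable def gradient (h : Phase n → ℝ) (w : Coord n → ℝ) (q : Coord n) : Coord n :=
  WithLp.toLp 2 fun i => partialA h i (dPoint w q)

/-- The nonlinear Laplacian `Δ^H_m w = div_m (∇w)`. -/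
noncomputable def laplacian (h : Phase n → ℝ) (ς w : Coord n → ℝ) (q : Coord n) : ℝ :=
  divergence ς (gradient h w) q

/-- The linearized Laplacian
`Δ^{dw}_m f = div_m (∑ᵢⱼ H_{αᵢ αⱼ}(dw) (∂f/∂xʲ) ∂_{xⁱ})`. -/
noncomputable def linLaplacian (h : Phase n → ℝ) (ς w f : Coord n → ℝ) (q : Coord n) : ℝ :=
  divergence ς
    (fun y => WithLp.toLp 2 fun i => ∑ j, partialAA h i j (dPoint w y) * partialBase f j y) q

/-- The quantity `Δ^{dw}_m (H(dw)) - d(Δ^H_m w)(∇w)`. -/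
noncomputable def bochner (h : Phase n → ℝ) (ς w : Coord n → ℝ) (q : Coord n) : ℝ :=
  linLaplacian h ς w (fun y => h (dPoint w y)) q
    - fderiv ℝ (laplacian h ς w) q (gradient h w q)

/-! ### The quantities on the manifold, computed in a chart

Here `L` is the Lagrangian, `m` the measure, `φ` a smooth chart around `x` and `u` a function. -/

section Chart

variable {M : Type*} [TopologicalSpace M] [ChartedSpace (Coord n) M] [IsManifold (𝓡 n) ∞ M]

/-- The point of the cotangent bundle `du_x`, in coordinates. -/
noncomputable def chartDu (φ : OpenPartialHomeomorph M (Coord n)) (u : M → ℝ) (x : M) : Phase n :=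
  dPoint (u ∘ φ.symm) (φ x)

/-- `Δ^{du}_m (H(du)) - d(Δ^H_m u)(∇u)` at `x`. -/
noncomputable def chartBochner [MeasurableSpace M] (L : TangentBundle (𝓡 n) M → ℝ) (m : Measure M)
    (φ : OpenPartialHomeomorph M (Coord n)) (u : M → ℝ) (x : M) : ℝ :=
  bochner (coordHamiltonian L φ) (weight m φ) (u ∘ φ.symm) (φ x)

/-- `Δ^H_m u` at `x`. -/
noncomputable def chartLaplacian [MeasurableSpace M] (L : TangentBundle (𝓡 n) M → ℝ)
    (m : Measure M) (φ : OpenPartialHomeomorph M (Coord n)) (u : M → ℝ) (x : M) : ℝ :=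
  laplacian (coordHamiltonian L φ) (weight m φ) (u ∘ φ.symm) (φ x)

/-- `Ric^H_∞(du_x)`. -/
noncomputable def chartRicciInfty [MeasurableSpace M] (L : TangentBundle (𝓡 n) M → ℝ)
    (m : Measure M) (φ : OpenPartialHomeomorph M (Coord n)) (u : M → ℝ) (x : M) : ℝ :=
  ricciInfty (coordHamiltonian L φ) (coordLagrangian L φ) (weight m φ) (phaseDomain φ)
    (chartDu φ u x)

/-- `Ric^H_N(du_x)`. -/
noncomputable def chartRicciN [MeasurableSpace M] (L : TangentBundle (𝓡 n) M → ℝ)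
    (m : Measure M) (φ : OpenPartialHomeomorph M (Coord n)) (N : ℝ) (u : M → ℝ) (x : M) : EReal :=
  ricciN (coordHamiltonian L φ) (coordLagrangian L φ) (weight m φ) (phaseDomain φ) N
    (chartDu φ u x)

/-- `‖Hess^H u‖²` (Hilbert–Schmidt) at `x`. -/
noncomputable def chartHessianHSNormSq (L : TangentBundle (𝓡 n) M → ℝ)
    (φ : OpenPartialHomeomorph M (Coord n)) (u : M → ℝ) (x : M) : ℝ :=
  hessianHSNormSq (coordHamiltonian L φ) (phaseDomain φ) (u ∘ φ.symm) (φ x)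

end Chart

end HamiltonianBW

/-!
# The Bochner–Weitzenböck formula for Hamiltonians

Everything takes place in a chart, where `T*M` becomes a product of two coordinate spaces and `H` is
the Legendre transform of `L` on each fibre. The supremum that defines `H` is attained because
finiteness of `H` forces superlinear growth of `L`; off the zero section the maximizer depends
smoothly on the covector by the inverse function theorem. Hence `H` is smooth with positive definite
fibre Hessian there, its fibre derivative is the maximizer, and `H_αα` is inverse to `L_vv`
(`IsCoordLagrangian.contDiffOn_hamiltonian`,
`IsCoordLagrangian.fderiv_fderiv_fibre_hamVectorField`).

Write the linearization of the Hamiltonian vector field `X` as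
`(ξ, ζ) ↦ (Q ξ + P ζ, N ζ - S ξ)`, with `P = H_αα`, `Q = H_αx`, `S = H_xx` and `N = -Qᵀ`, and let a
prime on these operators denote the derivative along `X`. The derivative of the flow solves the
first variation equation (`exists_hasFDerivAt_localFlow`). Transporting a canonical frame to the
vertical spaces by this derivative turns its members into `(0, E)`, where the `E` are orthonormal
for `P` and `E' = (C + N) E` with `2 P C = -P' + Q P - P N`. The transported velocities are
`(-P E, C E)`, and the curvature is `R = S P - C' - C² - C N + N C` (`exists_frame_values`). The
curvature quantities become traces:

* `Ric^H = tr (S P) - tr C' - tr C²` (`ricci_eq_tr`);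
* with `U` the matrix of second derivatives of `u`, the Hessian is `K = U P + C` in the frame, its
  squared norm is `tr K²`, and `(tr K)² ≤ n tr K²` (`hessianHSNormSq_eq`);
* `ψ' = tr C + dς(H_α) - tr Q`, by Jacobi's formula for `det H_αα` (`deriv_psiAlong`).

In the sum of `Ric^H_∞` and `tr K²` the operator `C` drops out (`tr_Rop_add`). On the other side, the
two Laplacians are divergences, that is, traces of derivatives along the graph of `du`
(`bochner_eq`). The velocity of that graph along `∇u` is `X` plus the vertical vector `(0, d(H(du)))`,
so that the derivatives of `Q` and `P` in this vertical direction, as well as the third derivatives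
of `u`, appear in both terms and cancel. What remains is the same expression.

The inequality follows from `Δu = tr K - ψ'` (`laplacian_eq_tr_K`) and
`(a - b)² / N ≤ a² / n + b² / (N - n)`.
-/

namespace HamiltonianBW

/-! ### Ordinary differential equations: smoothness of trajectories and of the flow -/

section ODE

variable {E F : Type*} [NormedAddCommGroup E] [NormedSpace ℝ E] [NormedAddCommGroup F]
  [NormedSpace ℝ F]

/-- Trajectories of a smooth vector field are smooth: bootstrap the equation `y' = Y(y)`. -/
theorem contDiffOn_of_hasDerivAt_comp {Y : E → E} {Ω : Set E} (hY : ContDiffOn ℝ ∞ Y Ω)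
    {I : Set ℝ} (hI : IsOpen I) {y : ℝ → E}
    (hy : ∀ t ∈ I, HasDerivAt y (Y (y t)) t ∧ y t ∈ Ω) : ContDiffOn ℝ ∞ y I := by
  rw [contDiffOn_infty]
  intro k
  induction k with
  | zero =>
    simp only [Nat.cast_zero, contDiffOn_zero]
    exact fun t ht => (hy t ht).1.continuousAt.continuousWithinAt
  | succ k ih =>
    rw [Nat.cast_succ, contDiffOn_succ_iff_deriv_of_isOpen hI]
    refine ⟨fun t ht => (hy t ht).1.differentiableAt.differentiableWithinAt, by simp, ?_⟩
    have h1 : ContDiffOn ℝ k (fun t => Y (y t)) I :=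
      (hY.of_le (mod_cast le_top)).comp ih fun t ht => (hy t ht).2
    exact h1.congr fun t ht => (hy t ht).1.deriv

/-- Two trajectories of a `C¹` vector field through the same point agree near that time. -/
theorem eventuallyEq_of_hasDerivAt {Y : E → E} {t₀ : ℝ} {y z : ℝ → E}
    (hY : ContDiffAt ℝ 1 Y (y t₀)) (hy : ∀ᶠ t in 𝓝 t₀, HasDerivAt y (Y (y t)) t)
    (hz : ∀ᶠ t in 𝓝 t₀, HasDerivAt z (Y (z t)) t) (h0 : y t₀ = z t₀) : y =ᶠ[𝓝 t₀] z := by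
  obtain ⟨K, s, hs, hl⟩ := hY.exists_lipschitzOnWith
  have hy0 : ∀ᶠ t in 𝓝 t₀, y t ∈ s := hy.self_of_nhds.continuousAt.eventually_mem hs
  have hz0 : ∀ᶠ t in 𝓝 t₀, z t ∈ s :=
    hz.self_of_nhds.continuousAt.eventually_mem (by rwa [← h0])
  exact ODE_solution_unique_of_eventually (v := fun _ => Y) (s := fun _ => s) (K := K)
    (Eventually.of_forall fun _ => hl) (hy.and hy0) (hz.and hz0) h0

/-- A linear equation `y' = B(z(t)) y` along a trajectory `z` of a smooth vector field has a smooth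
solution near the initial time. -/
theorem exists_linear_solution_along [CompleteSpace E] [CompleteSpace F] {X : E → E} {Ω : Set E}
    (hΩ : IsOpen Ω) (hX : ContDiffOn ℝ ∞ X Ω) {z : ℝ → E} (hz0 : z 0 ∈ Ω)
    (hz : ∀ᶠ t in 𝓝 0, HasDerivAt z (X (z t)) t)
    {B : E → F →L[ℝ] F} (hB : ContDiffOn ℝ ∞ B Ω) (y₀ : F) :
    ∃ (y : ℝ → F) (ε : ℝ), 0 < ε ∧ y 0 = y₀ ∧
      (∀ t ∈ Ioo (-ε) ε, HasDerivAt y (B (z t) (y t)) t) ∧ ContDiffOn ℝ ∞ y (Ioo (-ε) ε) := by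
  let Y : E × F → E × F := fun p => (X p.1, B p.1 p.2)
  have hY : ContDiffOn ℝ ∞ Y (Ω ×ˢ univ) := by
    refine ContDiffOn.prodMk (hX.comp contDiffOn_fst fun p hp => hp.1) ?_
    exact (hB.comp contDiffOn_fst fun p hp => hp.1).clm_apply contDiffOn_snd
  have hopen : IsOpen (Ω ×ˢ (univ : Set F)) := hΩ.prod isOpen_univ
  have hmem : (z 0, y₀) ∈ Ω ×ˢ (univ : Set F) := ⟨hz0, mem_univ _⟩
  have hYat : ContDiffAt ℝ 1 Y (z 0, y₀) :=
    ((hY.contDiffAt (hopen.mem_nhds hmem)).of_le (by simp))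
  obtain ⟨p, hp0, ε, hε, hp⟩ :=
    hYat.exists_forall_mem_closedBall_exists_eq_forall_mem_Ioo_hasDerivAt₀ 0
  have hpev : ∀ᶠ t in 𝓝 (0 : ℝ), HasDerivAt p (Y (p t)) t :=
    Filter.eventually_of_mem (Ioo_mem_nhds (by linarith) (by linarith)) hp
  have hp1 : ∀ᶠ t in 𝓝 (0 : ℝ), HasDerivAt (fun t => (p t).1) (X (p t).1) t :=
    hpev.mono fun t ht => ht.fst
  have heq : z =ᶠ[𝓝 0] fun t => (p t).1 := by
    refine eventuallyEq_of_hasDerivAt (Y := X)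
      ((hX.contDiffAt (hΩ.mem_nhds hz0)).of_le (by simp)) hz hp1 (by rw [hp0])
  have hΩev : ∀ᶠ t in 𝓝 (0 : ℝ), p t ∈ Ω ×ˢ (univ : Set F) :=
    hpev.self_of_nhds.continuousAt.eventually_mem (hopen.mem_nhds (by rwa [hp0]))
  obtain ⟨δ, hδ, hall⟩ := Metric.eventually_nhds_iff_ball.mp ((hpev.and hΩev).and heq)
  rw [Real.ball_eq_Ioo, zero_sub, zero_add] at hall
  refine ⟨fun t => (p t).2, δ, hδ, congrArg Prod.snd hp0, fun t ht => ?_, ?_⟩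
  · rw [(hall t ht).2]
    exact (hall t ht).1.1.snd
  · exact contDiff_snd.comp_contDiffOn
      (contDiffOn_of_hasDerivAt_comp hY isOpen_Ioo fun t ht => (hall t ht).1)

/-- The fundamental solution of a linear equation along a trajectory of a smooth vector field. -/
theorem exists_fundamental_solution_along [CompleteSpace E] [CompleteSpace F] {X : E → E}
    {Ω : Set E} (hΩ : IsOpen Ω) (hX : ContDiffOn ℝ ∞ X Ω) {z : ℝ → E} (hz0 : z 0 ∈ Ω)
    (hz : ∀ᶠ t in 𝓝 0, HasDerivAt z (X (z t)) t)
    {B : E → F →L[ℝ] F} (hB : ContDiffOn ℝ ∞ B Ω) :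
    ∃ (Y : ℝ → F →L[ℝ] F) (ε : ℝ), 0 < ε ∧ Y 0 = 1 ∧
      (∀ t ∈ Ioo (-ε) ε, HasDerivAt Y ((B (z t)).comp (Y t)) t) ∧
      ContDiffOn ℝ ∞ Y (Ioo (-ε) ε) :=
  exists_linear_solution_along hΩ hX hz0 hz
    (B := fun x => ContinuousLinearMap.compL ℝ F F F (B x))
    ((ContinuousLinearMap.compL ℝ F F F).contDiff.comp_contDiffOn hB) 1

/-- The first variation controls the flow up to second order, for positive times. -/
theorem norm_flow_sub_variation_le_right {X : E → E} {X' : E → E →L[ℝ] E} {s : Set E}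
    (hs : Convex ℝ s) {K K' T : ℝ} (hK : 0 < K) (hK' : 0 ≤ K')
    (hX : ∀ x ∈ s, HasFDerivAt X (X' x) x) (hX1 : ∀ x ∈ s, ‖X' x‖ ≤ K)
    (hX2 : ∀ x ∈ s, ∀ y ∈ s, ‖X' x - X' y‖ ≤ K' * ‖x - y‖)
    {x y : ℝ → E} {A : ℝ → E →L[ℝ] E}
    (hx : ∀ t ∈ Icc 0 T, HasDerivAt x (X (x t)) t ∧ x t ∈ s)
    (hy : ∀ t ∈ Icc 0 T, HasDerivAt y (X (y t)) t ∧ y t ∈ s)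
    (hA : ∀ t ∈ Icc 0 T, HasDerivAt A ((X' (x t)).comp (A t)) t) (hA0 : A 0 = 1)
    {t : ℝ} (ht : t ∈ Icc 0 T) :
    ‖y t - x t - A t (y 0 - x 0)‖ ≤
      K' * Real.exp (K * T) ^ 2 / K * Real.exp (K * T) * ‖y 0 - x 0‖ ^ 2 := by
  set M := Real.exp (K * T)
  have hd : ∀ t ∈ Icc 0 T, ‖y t - x t‖ ≤ ‖y 0 - x 0‖ * M := by
    intro t ht
    have h := norm_le_gronwallBound_of_norm_deriv_right_le (f := fun t => y t - x t)
      (f' := fun t => X (y t) - X (x t)) (δ := ‖y 0 - x 0‖) (K := K) (ε := 0) (a := 0) (b := T)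
      (fun t ht => ((hy t ht).1.sub (hx t ht).1).continuousAt.continuousWithinAt)
      (fun t ht => ((hy t (Ico_subset_Icc_self ht)).1.sub
        (hx t (Ico_subset_Icc_self ht)).1).hasDerivWithinAt) le_rfl
      (fun t ht => by
        have ht' := Ico_subset_Icc_self ht
        have := hs.norm_image_sub_le_of_norm_hasFDerivWithin_le
          (fun z hz => (hX z hz).hasFDerivWithinAt) hX1 (hx t ht').2 (hy t ht').2
        simpa using this) t ht
    rw [gronwallBound_ε0, sub_zero] at h
    exact h.trans (by gcongr; exact Real.exp_le_exp.mpr (by gcongr; exact ht.2))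
  have he : ∀ t ∈ Icc 0 T, HasDerivAt (fun t => y t - x t - A t (y 0 - x 0))
      (X (y t) - X (x t) - X' (x t) (A t (y 0 - x 0))) t := by
    intro t ht
    have h1 := (hA t ht).clm_apply (hasDerivAt_const t (y 0 - x 0))
    rw [map_zero, add_zero] at h1
    exact ((hy t ht).1.sub (hx t ht).1).sub h1
  have h := norm_le_gronwallBound_of_norm_deriv_right_le
    (f := fun t => y t - x t - A t (y 0 - x 0))
    (f' := fun t => X (y t) - X (x t) - X' (x t) (A t (y 0 - x 0))) (δ := 0) (K := K)
    (ε := K' * (‖y 0 - x 0‖ * M) ^ 2) (a := 0) (b := T)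
    (fun t ht => (he t ht).continuousAt.continuousWithinAt)
    (fun t ht => (he t (Ico_subset_Icc_self ht)).hasDerivWithinAt) (by simp [hA0])
    (fun t ht => by
      have ht' := Ico_subset_Icc_self ht
      have hseg : segment ℝ (x t) (y t) ⊆ s := hs.segment_subset (hx t ht').2 (hy t ht').2
      have h1 : ‖X (y t) - X (x t) - X' (x t) (y t - x t)‖
          ≤ (K' * ‖y t - x t‖) * ‖y t - x t‖ := by
        refine (convex_segment (x t) (y t)).norm_image_sub_le_of_norm_hasFDerivWithin_le'
          (fun z hz => (hX z (hseg hz)).hasFDerivWithinAt) (fun z hz => ?_)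
          (left_mem_segment ℝ _ _) (right_mem_segment ℝ _ _)
        refine (hX2 z (hseg hz) _ (hx t ht').2).trans ?_
        gcongr
        obtain ⟨θ, hθ, rfl⟩ := (segment_eq_image' ℝ (x t) (y t)).subset hz
        rw [add_sub_cancel_left, norm_smul, Real.norm_of_nonneg hθ.1]
        exact mul_le_of_le_one_left (norm_nonneg _) hθ.2
      have h2 : X (y t) - X (x t) - X' (x t) (A t (y 0 - x 0))
          = (X (y t) - X (x t) - X' (x t) (y t - x t))
            + X' (x t) (y t - x t - A t (y 0 - x 0)) := by
        simp only [map_sub]; abel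
      rw [h2, add_comm (K * _)]
      refine (norm_add_le _ _).trans (add_le_add (h1.trans ?_) ?_)
      · rw [mul_assoc, ← sq]
        gcongr
        exact hd t ht'
      · exact ((X' (x t)).le_opNorm _).trans (by gcongr; exact hX1 _ (hx t ht').2)) t ht
  rw [gronwallBound_of_K_ne_0 hK.ne', sub_zero] at h
  have h3 : Real.exp (K * t) - 1 ≤ M := by
    have : Real.exp (K * t) ≤ M := Real.exp_le_exp.mpr (by gcongr; exact ht.2)
    linarith
  calc _ ≤ _ := h
    _ = K' * (‖y 0 - x 0‖ * M) ^ 2 / K * (Real.exp (K * t) - 1) := by ring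
    _ ≤ K' * (‖y 0 - x 0‖ * M) ^ 2 / K * M := by gcongr
    _ = _ := by ring

/-- The first variation controls the flow up to second order. -/
theorem norm_flow_sub_variation_le {X : E → E} {X' : E → E →L[ℝ] E} {s : Set E}
    (hs : Convex ℝ s) {K K' T : ℝ} (hK : 0 < K) (hK' : 0 ≤ K')
    (hX : ∀ x ∈ s, HasFDerivAt X (X' x) x) (hX1 : ∀ x ∈ s, ‖X' x‖ ≤ K)
    (hX2 : ∀ x ∈ s, ∀ y ∈ s, ‖X' x - X' y‖ ≤ K' * ‖x - y‖)
    {x y : ℝ → E} {A : ℝ → E →L[ℝ] E}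
    (hx : ∀ t ∈ Icc (-T) T, HasDerivAt x (X (x t)) t ∧ x t ∈ s)
    (hy : ∀ t ∈ Icc (-T) T, HasDerivAt y (X (y t)) t ∧ y t ∈ s)
    (hA : ∀ t ∈ Icc (-T) T, HasDerivAt A ((X' (x t)).comp (A t)) t) (hA0 : A 0 = 1)
    {t : ℝ} (ht : t ∈ Icc (-T) T) :
    ‖y t - x t - A t (y 0 - x 0)‖ ≤
      K' * Real.exp (K * T) ^ 2 / K * Real.exp (K * T) * ‖y 0 - x 0‖ ^ 2 := by
  rcases le_total 0 t with h0 | h0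
  · have hsub : Icc 0 T ⊆ Icc (-T) T := Icc_subset_Icc_left (by linarith [h0.trans ht.2])
    exact norm_flow_sub_variation_le_right hs hK hK' hX hX1 hX2 (fun t h => hx t (hsub h))
      (fun t h => hy t (hsub h)) (fun t h => hA t (hsub h)) hA0 ⟨h0, ht.2⟩
  -- negative times: reverse time, which replaces `X` by `-X`
  · have hneg : ∀ t ∈ Icc 0 T, -t ∈ Icc (-T) T := fun t h => ⟨by linarith [h.2], by
      linarith [h.1, h.2]⟩
    have key := norm_flow_sub_variation_le_right (X := fun z => -X z) (X' := fun z => -X' z)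
      (x := fun t => x (-t)) (y := fun t => y (-t)) (A := fun t => A (-t)) (T := T) hs hK hK'
      (fun z hz => (hX z hz).neg) (fun z hz => by rw [norm_neg]; exact hX1 z hz)
      (fun z hz w hw => by
        have : -X' z - -X' w = -(X' z - X' w) := by abel
        rw [this, norm_neg]; exact hX2 z hz w hw)
      (fun t h => ⟨by simpa [Function.comp_def] using (hx _ (hneg t h)).1.scomp t (hasDerivAt_neg t),
        (hx _ (hneg t h)).2⟩)
      (fun t h => ⟨by simpa [Function.comp_def] using (hy _ (hneg t h)).1.scomp t (hasDerivAt_neg t),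
        (hy _ (hneg t h)).2⟩)
      (fun t h => by simpa [Function.comp_def] using (hA _ (hneg t h)).scomp t (hasDerivAt_neg t))
      (by simpa using hA0) (t := -t) ⟨by linarith, by linarith [ht.1]⟩
    simpa using key

/-- A smooth vector field has a continuous local flow that stays in a given neighbourhood. -/
theorem exists_continuous_localFlow [CompleteSpace E] {X : E → E} {α : E}
    (hX : ContDiffAt ℝ 1 X α) {D : Set E} (hD : D ∈ 𝓝 α) :
    ∃ (Φ : ℝ → E → E) (ε : ℝ), 0 < ε ∧ ∃ W ∈ 𝓝 α,
      ContinuousOn (uncurry Φ) (Ioo (-ε) ε ×ˢ W) ∧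
      ∀ β ∈ W, Φ 0 β = β ∧ ∀ t ∈ Ioo (-ε) ε, Φ t β ∈ D ∧ HasDerivAt (fun s => Φ s β) (X (Φ t β)) t
    := by
  obtain ⟨ε, hε, a, r, L, K, hr, hpl⟩ := IsPicardLindelof.of_contDiffAt_one hX
  obtain ⟨φ, hφ, hc⟩ := (hpl 0).exists_forall_mem_closedBall_eq_hasDerivWithinAt_continuousOn
  simp only [zero_sub, zero_add] at hφ hc
  have hα : α ∈ Metric.closedBall α (r : ℝ) := Metric.mem_closedBall_self r.2
  have hcat : ContinuousAt φ (α, 0) := hc.continuousAt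
    (prod_mem_nhds (Metric.closedBall_mem_nhds α (by exact_mod_cast hr))
      (Icc_mem_nhds (by linarith) hε))
  have hev : ∀ᶠ p in 𝓝 (α, (0 : ℝ)), φ p ∈ D :=
    hcat.eventually_mem (by rw [(hφ α hα).1]; exact hD)
  rw [nhds_prod_eq] at hev
  obtain ⟨V, hV, V', hV', hVV⟩ := Filter.eventually_prod_iff.mp hev
  obtain ⟨δ, hδ, hδV⟩ := Metric.eventually_nhds_iff_ball.mp hV'
  rw [Real.ball_eq_Ioo, zero_sub, zero_add] at hδV
  have hsub : Ioo (-min ε δ) (min ε δ) ⊆ Ioo (-ε) ε :=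
    Ioo_subset_Ioo (neg_le_neg (min_le_left _ _)) (min_le_left _ _)
  have hsub' : Ioo (-min ε δ) (min ε δ) ⊆ Ioo (-δ) δ :=
    Ioo_subset_Ioo (neg_le_neg (min_le_right _ _)) (min_le_right _ _)
  refine ⟨fun t x => φ (x, t), min ε δ, lt_min hε hδ, {x | V x} ∩ Metric.closedBall α r,
    inter_mem hV (Metric.closedBall_mem_nhds α (by exact_mod_cast hr)), ?_, ?_⟩
  · exact hc.comp continuous_swap.continuousOn fun p hp =>
      ⟨hp.2.2, Ioo_subset_Icc_self (hsub hp.1)⟩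
  · intro β hβ
    refine ⟨(hφ β hβ.2).1, fun t ht => ⟨hVV hβ.1 (hδV t (hsub' ht)), ?_⟩⟩
    exact ((hφ β hβ.2).2 t (Ioo_subset_Icc_self (hsub ht))).hasDerivAt
      (Icc_mem_nhds (hsub ht).1 (hsub ht).2)

/-- A continuous local flow of a smooth vector field is differentiable in the initial point, and its
derivative `A(t)` along a trajectory solves the first variation equation `A' = DX(z(t)) A`. -/
theorem exists_hasFDerivAt_localFlow [CompleteSpace E] {X : E → E} {Ω : Set E} (hΩ : IsOpen Ω)
    (hX : ContDiffOn ℝ ∞ X Ω) {α : E} (hα : α ∈ Ω) {Φ : ℝ → E → E} {ε : ℝ} (hε : 0 < ε) {W : Set E}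
    (hW : W ∈ 𝓝 α) (hc : ContinuousOn (uncurry Φ) (Ioo (-ε) ε ×ˢ W))
    (hΦ : ∀ β ∈ W, Φ 0 β = β ∧ ∀ t ∈ Ioo (-ε) ε, HasDerivAt (fun s => Φ s β) (X (Φ t β)) t) :
    ∃ (A : ℝ → E →L[ℝ] E) (δ : ℝ), 0 < δ ∧ A 0 = 1 ∧
      ContDiffOn ℝ ∞ A (Ioo (-δ) δ) ∧
      ContDiffOn ℝ ∞ (fun t => Φ t α) (Ioo (-δ) δ) ∧
      ∀ t ∈ Ioo (-δ) δ, Φ t α ∈ Ω ∧ HasDerivAt (fun s => Φ s α) (X (Φ t α)) t ∧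
        HasDerivAt A ((fderiv ℝ X (Φ t α)).comp (A t)) t ∧ HasFDerivAt (Φ t) (A t) α := by
  have hαW : α ∈ W := mem_of_mem_nhds hW
  have hcat : ContinuousAt (uncurry Φ) (0, α) :=
    hc.continuousAt (prod_mem_nhds (Ioo_mem_nhds (by linarith) hε) hW)
  have h0 : uncurry Φ (0, α) = α := (hΦ α hαW).1
  have hX' : ContDiffOn ℝ ∞ (fderiv ℝ X) Ω := hX.fderiv_of_isOpen hΩ (by simp)
  have hXd : ∀ x ∈ Ω, HasFDerivAt X (fderiv ℝ X x) x := fun x hx =>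
    ((hX.contDiffAt (hΩ.mem_nhds hx)).differentiableAt (by simp)).hasFDerivAt
  obtain ⟨K', V, hV, hLip⟩ := ((hX'.contDiffAt (hΩ.mem_nhds hα)).of_le
    (m := 1) (by simp)).exists_lipschitzOnWith
  have hbd : ∀ᶠ x in 𝓝 α, ‖fderiv ℝ X x‖ < ‖fderiv ℝ X α‖ + 1 :=
    ((hX'.continuousOn.continuousAt (hΩ.mem_nhds hα)).norm).eventually_lt continuousAt_const
      (by linarith)
  obtain ⟨ρ, hρ, hball⟩ := Metric.eventually_nhds_iff_ball.mp
    ((hbd.and hV).and (hΩ.mem_nhds hα))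
  set s := Metric.ball α ρ
  have hevs : ∀ᶠ p in 𝓝 ((0 : ℝ), α), uncurry Φ p ∈ s :=
    hcat.eventually_mem (by rw [h0]; exact Metric.ball_mem_nhds α hρ)
  rw [nhds_prod_eq] at hevs
  obtain ⟨pa, ha, pb, hb, hab⟩ := Filter.eventually_prod_iff.mp hevs
  have hzev : ∀ᶠ t in 𝓝 (0 : ℝ), HasDerivAt (fun s => Φ s α) (X (Φ t α)) t :=
    Filter.eventually_of_mem (Ioo_mem_nhds (by linarith) hε) (hΦ α hαW).2
  obtain ⟨A, δ₁, hδ₁, hA0, hA, hAs⟩ := exists_fundamental_solution_along hΩ hX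
    (z := fun t => Φ t α) (by rw [(hΦ α hαW).1]; exact hα) hzev hX'
  obtain ⟨δ₂, hδ₂, hd₂⟩ := Metric.eventually_nhds_iff_ball.mp ha
  rw [Real.ball_eq_Ioo, zero_sub, zero_add] at hd₂
  set δ := min ε (min δ₁ δ₂)
  have hδ : 0 < δ := lt_min hε (lt_min hδ₁ hδ₂)
  have hle : δ ≤ ε := min_le_left _ _
  have hle₁ : δ ≤ δ₁ := (min_le_right _ _).trans (min_le_left _ _)
  have hle₂ : δ ≤ δ₂ := (min_le_right _ _).trans (min_le_right _ _)
  have hsub : Ioo (-δ) δ ⊆ Ioo (-ε) ε := Ioo_subset_Ioo (neg_le_neg hle) hle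
  have hsub₁ : Ioo (-δ) δ ⊆ Ioo (-δ₁) δ₁ := Ioo_subset_Ioo (neg_le_neg hle₁) hle₁
  have hsub₂ : Ioo (-δ) δ ⊆ Ioo (-δ₂) δ₂ := Ioo_subset_Ioo (neg_le_neg hle₂) hle₂
  have hs : ∀ t ∈ Ioo (-δ) δ, ∀ β, pb β → Φ t β ∈ s := fun t ht β hβ => hab (hd₂ t (hsub₂ ht)) hβ
  have hbα : pb α := hb.self_of_nhds
  have hzΩ : ∀ t ∈ Ioo (-δ) δ, Φ t α ∈ Ω := fun t ht => (hball _ (hs t ht α hbα)).2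
  refine ⟨A, δ, hδ, hA0, hAs.mono hsub₁, ?_, fun t ht =>
    ⟨hzΩ t ht, (hΦ α hαW).2 t (hsub ht), hA t (hsub₁ ht), ?_⟩⟩
  · exact contDiffOn_of_hasDerivAt_comp hX isOpen_Ioo fun t ht =>
      ⟨(hΦ α hαW).2 t (hsub ht), hzΩ t ht⟩
  · have hI : Icc (-|t|) |t| ⊆ Ioo (-δ) δ := fun τ hτ =>
      ⟨by linarith [hτ.1, abs_lt.mpr ht], by linarith [hτ.2, abs_lt.mpr ht]⟩
    have hquad : ∀ᶠ β in 𝓝 α, ‖Φ t β - Φ t α - A t (β - α)‖ ≤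
        K' * Real.exp ((‖fderiv ℝ X α‖ + 1) * |t|) ^ 2 / (‖fderiv ℝ X α‖ + 1)
          * Real.exp ((‖fderiv ℝ X α‖ + 1) * |t|) * ‖β - α‖ ^ 2 := by
      filter_upwards [hb, hW] with β hβ hβW
      have := norm_flow_sub_variation_le (X := X) (X' := fderiv ℝ X) (s := s)
        (convex_ball α ρ) (K := ‖fderiv ℝ X α‖ + 1) (K' := K') (T := |t|) (by positivity) K'.2
        (fun x hx => hXd x (hball x hx).2) (fun x hx => (hball x hx).1.1.le)
        (fun x hx y hy => by
          simpa only [dist_eq_norm] using hLip.dist_le_mul x (hball x hx).1.2 y (hball y hy).1.2)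
        (x := fun t => Φ t α) (y := fun t => Φ t β) (A := A)
        (fun τ hτ => ⟨(hΦ α hαW).2 τ (hsub (hI hτ)), hs τ (hI hτ) α hbα⟩)
        (fun τ hτ => ⟨(hΦ β hβW).2 τ (hsub (hI hτ)), hs τ (hI hτ) β hβ⟩)
        (fun τ hτ => hA τ (hsub₁ (hI hτ))) hA0 (t := t) ⟨neg_abs_le t, le_abs_self t⟩
      simpa only [(hΦ α hαW).1, (hΦ β hβW).1] using this
    refine .of_isLittleO ?_
    refine (Asymptotics.IsBigO.of_bound _ (g := fun β => ‖β - α‖ ^ 2) (hquad.mono fun β h => by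
      simpa using h)).trans_isLittleO ?_
    have h1 : Tendsto (fun β : E => ‖β - α‖) (𝓝 α) (𝓝 0) := by
      have := ((continuous_id.sub continuous_const).norm : Continuous fun β : E => ‖id β - α‖)
      simpa using this.tendsto α
    have h2 := (Asymptotics.isLittleO_pow_id (𝕜 := ℝ) (n := 2) (by norm_num)).comp_tendsto h1
    exact Asymptotics.IsLittleO.of_norm_right h2

end ODE

/-! ### The Legendre transform on a single fibre -/

section Fibre

variable {n : ℕ}

/-- The restriction of a Lagrangian to one tangent space, in linear coordinates: a non-negative
`C¹` function vanishing at the origin, smooth with positive definite Hessian off the origin, and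
with finite conjugate function. -/
structure IsFibreLagrangian (f : Coord n → ℝ) : Prop where
  nonneg : ∀ v, 0 ≤ f v
  zero : f 0 = 0
  contDiff_one : ContDiff ℝ 1 f
  contDiffOn : ContDiffOn ℝ ∞ f {v | v ≠ 0}
  pos : ∀ v w, v ≠ 0 → w ≠ 0 → 0 < fderiv ℝ (fderiv ℝ f) v w w
  bddAbove : ∀ p : Coord n, BddAbove (range fun v => inner ℝ p v - f v)

namespace IsFibreLagrangian

variable {f : Coord n → ℝ}

theorem differentiable (hf : IsFibreLagrangian f) : Differentiable ℝ f :=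
  hf.contDiff_one.differentiable (by simp)

theorem contDiffAt (hf : IsFibreLagrangian f) {v : Coord n} (hv : v ≠ 0) : ContDiffAt ℝ ∞ f v :=
  hf.contDiffOn.contDiffAt (isOpen_ne.mem_nhds hv)

theorem differentiableAt_fderiv (hf : IsFibreLagrangian f) {v : Coord n} (hv : v ≠ 0) :
    DifferentiableAt ℝ (fderiv ℝ f) v :=
  ((hf.contDiffAt hv).fderiv_right (m := ∞) (by simp)).differentiableAt (by simp)

/-- The tangent inequality along a half-open segment that avoids the origin. -/
theorem add_fderiv_le_of_segment (hf : IsFibreLagrangian f) {a b : Coord n}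
    (hab : ∀ t ∈ Ico (0 : ℝ) 1, a + t • b ≠ 0) : f a + fderiv ℝ f a b ≤ f (a + b) := by
  rcases eq_or_ne b 0 with rfl | hb
  · simp
  have hline : ∀ t : ℝ, HasDerivAt (fun t : ℝ => a + t • b) b t := fun t => by
    simpa using ((hasDerivAt_id t).smul_const b).const_add a
  have hcont : Continuous fun t : ℝ => a + t • b := by fun_prop
  -- the slope of `f` along the segment increases, because the Hessian is positive
  have hmono : MonotoneOn (fun t : ℝ => fderiv ℝ f (a + t • b) b) (Icc 0 1) := by
    have hd : ∀ t ∈ interior (Icc (0 : ℝ) 1), HasDerivAt (fun t : ℝ => fderiv ℝ f (a + t • b) b)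
        (fderiv ℝ (fderiv ℝ f) (a + t • b) b b) t := fun t ht => by
      rw [interior_Icc] at ht
      have h1 := ((hf.differentiableAt_fderiv (hab t ⟨ht.1.le, ht.2⟩)).hasFDerivAt).comp_hasDerivAt
        t (hline t)
      simpa using h1.clm_apply (hasDerivAt_const t b)
    refine monotoneOn_of_deriv_nonneg (convex_Icc 0 1) ?_
      (fun t ht => (hd t ht).differentiableAt.differentiableWithinAt) fun t ht => ?_
    · exact (((hf.contDiff_one.continuous_fderiv (by simp)).comp hcont).clm_apply
        continuous_const).continuousOn
    · rw [(hd t ht).deriv]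
      rw [interior_Icc] at ht
      exact (hf.pos _ _ (hab t ⟨ht.1.le, ht.2⟩) hb).le
  have hd : ∀ t : ℝ, HasDerivAt (fun t : ℝ => f (a + t • b) - t * fderiv ℝ f a b)
      (fderiv ℝ f (a + t • b) b - fderiv ℝ f a b) t := fun t => by
    have h1 := (hf.differentiable (a + t • b)).hasFDerivAt.comp_hasDerivAt t (hline t)
    simpa [Function.comp_def] using h1.fun_sub ((hasDerivAt_id t).mul_const (fderiv ℝ f a b))
  have hmono' : MonotoneOn (fun t : ℝ => f (a + t • b) - t * fderiv ℝ f a b) (Icc 0 1) := by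
    refine monotoneOn_of_deriv_nonneg (convex_Icc 0 1)
      (fun t _ => (hd t).continuousAt.continuousWithinAt)
      (fun t _ => (hd t).differentiableAt.differentiableWithinAt) fun t ht => ?_
    rw [(hd t).deriv]
    have := hmono (left_mem_Icc.mpr zero_le_one) (interior_subset ht) (interior_subset ht).1
    simpa using this
  have := hmono' (left_mem_Icc.mpr zero_le_one) (right_mem_Icc.mpr zero_le_one) zero_le_one
  simp only [zero_smul, add_zero, zero_mul, sub_zero, one_smul, one_mul] at this
  linarith

/-- The tangent inequality: a fibre Lagrangian lies above its tangent hyperplanes. -/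
theorem add_fderiv_le (hf : IsFibreLagrangian f) {v : Coord n} (hv : v ≠ 0) (w : Coord n) :
    f v + fderiv ℝ f v (w - v) ≤ f w := by
  by_cases h : ∀ t ∈ Ico (0 : ℝ) 1, v + t • (w - v) ≠ 0
  · simpa using hf.add_fderiv_le_of_segment h
  -- otherwise `w` is a non-positive multiple of `v`, and the tangent hyperplane is below zero there
  · push Not at h
    obtain ⟨t, ht, h0⟩ := h
    have ht0 : t ≠ 0 := by
      rintro rfl
      simp [hv] at h0
    have htpos : 0 < t := lt_of_le_of_ne ht.1 ht0.symm
    have h1 : f v + fderiv ℝ f v (-v) ≤ f (v + -v) := by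
      refine hf.add_fderiv_le_of_segment fun s hs => ?_
      rw [show v + s • -v = (1 - s) • v by module]
      exact smul_ne_zero (by linarith [hs.2]) hv
    rw [add_neg_cancel, hf.zero, map_neg] at h1
    have h2 : w - v = -(t⁻¹ • v) := by
      have : t • (w - v) = -v := by rwa [eq_neg_iff_add_eq_zero, add_comm]
      rw [← smul_neg, ← this, smul_smul, inv_mul_cancel₀ ht0, one_smul]
    rw [h2, map_neg, map_smul, smul_eq_mul]
    have h3 : 1 ≤ t⁻¹ := (one_le_inv₀ htpos).mpr ht.2.le
    have h4 : 0 ≤ fderiv ℝ f v v := by linarith [hf.nonneg v]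
    nlinarith [hf.nonneg w]

/-- A critical point of `v ↦ p(v) - f(v)` off the origin is a maximum. -/
theorem inner_sub_le_of_fderiv_eq (hf : IsFibreLagrangian f) {p v : Coord n} (hv : v ≠ 0)
    (hp : fderiv ℝ f v = innerSL ℝ p) (w : Coord n) :
    inner ℝ p w - f w ≤ inner ℝ p v - f v := by
  have := hf.add_fderiv_le hv w
  rw [hp, innerSL_apply_apply, inner_sub_right] at this
  linarith

/-- Finiteness of the conjugate function makes a fibre Lagrangian grow faster than any linear
function, so that the supremum defining the conjugate function is attained. -/
theorem exists_max (hf : IsFibreLagrangian f) (hn : 0 < n) (p : Coord n) :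
    ∃ v, ∀ w, inner ℝ p w - f w ≤ inner ℝ p v - f v := by
  have hc : Continuous fun v => inner ℝ p v - f v :=
    (continuous_const.inner continuous_id).sub hf.differentiable.continuous
  set R : ℝ := n * ‖p‖ + 1
  choose c hc1 using fun i : Fin n => hf.bddAbove (EuclideanSpace.single i R)
  choose d hd1 using fun i : Fin n => hf.bddAbove (EuclideanSpace.single i (-R))
  have hi : ∀ (i : Fin n) (v : Coord n), R * |v i| ≤ f v + max (c i) (d i) := by
    intro i v
    have h1 := hc1 i ⟨v, rfl⟩
    have h2 := hd1 i ⟨v, rfl⟩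
    simp only [EuclideanSpace.inner_single_left, conj_trivial] at h1 h2
    rcases abs_cases (v i) with ⟨h, -⟩ | ⟨h, -⟩ <;> rw [h]
    · linarith [le_max_left (c i) (d i)]
    · linarith [le_max_right (c i) (d i)]
  have hnorm : ∀ v : Coord n, ‖v‖ ≤ ∑ i, |v i| := by
    intro v
    have h1 : v = ∑ i, v i • EuclideanSpace.single i (1 : ℝ) := by
      ext j
      simp [Finset.sum_apply, Pi.single_apply]
    calc ‖v‖ = ‖∑ i, v i • EuclideanSpace.single i (1 : ℝ)‖ := by rw [← h1]
      _ ≤ ∑ i, ‖v i • EuclideanSpace.single i (1 : ℝ)‖ := norm_sum_le _ _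
      _ = ∑ i, |v i| := by simp [norm_smul]
  set Cst : ℝ := ∑ i, max (c i) (d i)
  have hR : 0 ≤ R := by positivity
  have hgrow : ∀ v : Coord n, R * ‖v‖ ≤ n * f v + Cst := by
    intro v
    calc R * ‖v‖ ≤ R * ∑ i, |v i| := by gcongr; exact hnorm v
      _ = ∑ i, R * |v i| := Finset.mul_sum _ _ _
      _ ≤ ∑ i, (f v + max (c i) (d i)) := Finset.sum_le_sum fun i _ => hi i v
      _ = n * f v + Cst := by simp [Finset.sum_add_distrib, Cst]
  refine hc.exists_forall_ge' 0 ?_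
  have hlarge : ∀ᶠ v : Coord n in cocompact _, Cst ≤ ‖v‖ :=
    tendsto_norm_cocompact_atTop.eventually_ge_atTop Cst
  filter_upwards [hlarge] with v hv
  rw [inner_zero_right, hf.zero, sub_zero]
  have h1 := real_inner_le_norm p v
  have h2 := hgrow v
  have hn' : (0 : ℝ) < n := by exact_mod_cast hn
  have h3 : (n : ℝ) * (inner ℝ p v - f v) ≤ 0 := by
    have : (n : ℝ) * inner ℝ p v ≤ n * (‖p‖ * ‖v‖) := by gcongr
    have h4 : R * ‖v‖ = n * (‖p‖ * ‖v‖) + ‖v‖ := by ring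
    linarith
  nlinarith

/-- For `p ≠ 0` the maximum of `v ↦ p(v) - f(v)` is attained at a critical point off the origin,
since the differential of `f` at the origin vanishes. -/
theorem exists_fderiv_eq (hf : IsFibreLagrangian f) (hn : 0 < n) {p : Coord n} (hp : p ≠ 0) :
    ∃ v, v ≠ 0 ∧ fderiv ℝ f v = innerSL ℝ p := by
  obtain ⟨v, hv⟩ := hf.exists_max hn p
  have h1 : HasFDerivAt (fun v => inner ℝ p v - f v) (innerSL ℝ p - fderiv ℝ f v) v :=
    (innerSL ℝ p).hasFDerivAt.sub (hf.differentiable v).hasFDerivAt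
  have h2 : innerSL ℝ p - fderiv ℝ f v = 0 :=
    (IsLocalMax.hasFDerivAt_eq_zero (Eventually.of_forall hv) h1)
  refine ⟨v, ?_, (sub_eq_zero.mp h2).symm⟩
  rintro rfl
  have h3 : fderiv ℝ f 0 = 0 :=
    IsLocalMin.fderiv_eq_zero (Eventually.of_forall fun w => by rw [hf.zero]; exact hf.nonneg w)
  rw [h3, sub_zero] at h2
  apply hp
  have := DFunLike.congr_fun h2 p
  simpa using this

end IsFibreLagrangian

end Fibre

/-! ### Hamiltonian vector fields in coordinates -/

section Basic

variable {n : ℕ}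

theorem coord_eq_sum (v : Coord n) : v = ∑ i, v i • baseDir i := by
  ext j
  simp [baseDir, Finset.sum_apply, Pi.single_apply]

theorem phase_eq_sum (z : Phase n) : z = ∑ i, z.1 i • dirX i + ∑ i, z.2 i • dirA i := by
  ext j <;> simp [dirX, dirA, Prod.fst_sum, Prod.snd_sum, Finset.sum_apply, Pi.single_apply]

/-- The differential of `h` in terms of the Hamiltonian vector field. -/
theorem fderiv_eq_hamVectorField (h : Phase n → ℝ) (z w : Phase n) :
    fderiv ℝ h z w =
      inner ℝ (hamVectorField h z).1 w.2 - inner ℝ (hamVectorField h z).2 w.1 := by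
  conv_lhs => rw [phase_eq_sum w]
  simp only [map_add, map_sum, map_smul, smul_eq_mul, PiLp.inner_apply, RCLike.inner_apply,
    conj_trivial, hamVectorField, partialA, partialX]
  rw [← sub_eq_zero]
  simp only [mul_neg, Finset.sum_neg_distrib]
  ring

theorem symp_eq_inner (v w : Phase n) : symp v w = inner ℝ v.2 w.1 - inner ℝ v.1 w.2 := by
  simp only [symp, PiLp.inner_apply, RCLike.inner_apply, conj_trivial, ← Finset.sum_sub_distrib]
  exact Finset.sum_congr rfl fun i _ => by ring

theorem contDiffOn_partialA {h : Phase n → ℝ} {Ω : Set (Phase n)} (hΩ : IsOpen Ω)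
    (hh : ContDiffOn ℝ ∞ h Ω) (i : Fin n) : ContDiffOn ℝ ∞ (partialA h i) Ω :=
  (hh.fderiv_of_isOpen hΩ (by simp)).clm_apply contDiffOn_const

theorem contDiffOn_partialX {h : Phase n → ℝ} {Ω : Set (Phase n)} (hΩ : IsOpen Ω)
    (hh : ContDiffOn ℝ ∞ h Ω) (i : Fin n) : ContDiffOn ℝ ∞ (partialX h i) Ω :=
  (hh.fderiv_of_isOpen hΩ (by simp)).clm_apply contDiffOn_const

theorem contDiffOn_hamVectorField {h : Phase n → ℝ} {Ω : Set (Phase n)} (hΩ : IsOpen Ω)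
    (hh : ContDiffOn ℝ ∞ h Ω) : ContDiffOn ℝ ∞ (hamVectorField h) Ω :=
  ContDiffOn.prodMk (contDiffOn_euclidean.mpr fun i => contDiffOn_partialA hΩ hh i)
    (contDiffOn_euclidean.mpr fun i => (contDiffOn_partialX hΩ hh i).neg)

/-- The differential of the Hamiltonian vector field in terms of the second differential of `h`. -/
theorem inner_fderiv_hamVectorField {h : Phase n → ℝ} {Ω : Set (Phase n)} (hΩ : IsOpen Ω)
    (hh : ContDiffOn ℝ ∞ h Ω) {z : Phase n} (hz : z ∈ Ω) (v w : Phase n) :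
    fderiv ℝ (fderiv ℝ h) z v w =
      inner ℝ (fderiv ℝ (hamVectorField h) z v).1 w.2
        - inner ℝ (fderiv ℝ (hamVectorField h) z v).2 w.1 := by
  have hX : HasFDerivAt (hamVectorField h) (fderiv ℝ (hamVectorField h) z) z :=
    (((contDiffOn_hamVectorField hΩ hh).contDiffAt (hΩ.mem_nhds hz)).differentiableAt
      (by simp)).hasFDerivAt
  have hD : HasFDerivAt (fderiv ℝ h) (fderiv ℝ (fderiv ℝ h) z) z :=
    (((hh.fderiv_of_isOpen (m := ∞) hΩ (by simp)).contDiffAt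
      (hΩ.mem_nhds hz)).differentiableAt (by simp)).hasFDerivAt
  have h1 := hD.clm_apply (hasFDerivAt_const w z)
  have h2 := (hX.fst.inner ℝ (hasFDerivAt_const w.2 z)).fun_sub
    (hX.snd.inner ℝ (hasFDerivAt_const w.1 z))
  simp only [← fderiv_eq_hamVectorField] at h2
  have h3 := DFunLike.congr_fun (h1.unique h2) v
  simpa using h3

theorem fderiv_fderiv_symm {h : Phase n → ℝ} {Ω : Set (Phase n)} (hΩ : IsOpen Ω)
    (hh : ContDiffOn ℝ ∞ h Ω) {z : Phase n} (hz : z ∈ Ω) (v w : Phase n) :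
    fderiv ℝ (fderiv ℝ h) z v w = fderiv ℝ (fderiv ℝ h) z w v :=
  (hh.contDiffAt (hΩ.mem_nhds hz)).isSymmSndFDerivAt
    (by rw [minSmoothness_of_isRCLikeNormedField]; exact ENat.LEInfty.out) v w

end Basic

/-! ### The Legendre transform in coordinates -/

section Legendre

variable {n : ℕ}

/-- A Lagrangian in the coordinates of the tangent bundle over the coordinate domain `U`: a fibre
Lagrangian on each tangent space, jointly smooth off the zero section. -/
structure IsCoordLagrangian (U : Set (Coord n)) (l : Coord n × Coord n → ℝ) : Prop where
  fibre : ∀ x ∈ U, IsFibreLagrangian fun v => l (x, v)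
  contDiffOn : ContDiffOn ℝ ∞ l (U ×ˢ {v | v ≠ 0})

namespace IsCoordLagrangian

variable {U : Set (Coord n)} {l : Coord n × Coord n → ℝ} {h : Phase n → ℝ}

theorem fderiv_fibre (hU : IsOpen U) (hl : IsCoordLagrangian U l) {x v : Coord n} (hx : x ∈ U)
    (hv : v ≠ 0) :
    fderiv ℝ (fun v' => l (x, v')) v = (fderiv ℝ l (x, v)).comp (.inr ℝ (Coord n) (Coord n)) := by
  have hd : DifferentiableAt ℝ l (x, v) :=
    (hl.contDiffOn.contDiffAt
      (prod_mem_nhds (hU.mem_nhds hx) (isOpen_ne.mem_nhds hv))).differentiableAt (by simp)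
  exact (hd.hasFDerivAt.comp v (hasFDerivAt_prodMk_right x v)).fderiv

theorem differentiableAt_fderiv (hU : IsOpen U) (hl : IsCoordLagrangian U l) {x v : Coord n}
    (hx : x ∈ U) (hv : v ≠ 0) : DifferentiableAt ℝ (fderiv ℝ l) (x, v) :=
  ((hl.contDiffOn.fderiv_of_isOpen (m := ∞) (hU.prod isOpen_ne) (by simp)).contDiffAt
    (prod_mem_nhds (hU.mem_nhds hx) (isOpen_ne.mem_nhds hv))).differentiableAt (by simp)

theorem fderiv_fderiv_fibre (hU : IsOpen U) (hl : IsCoordLagrangian U l) {x v : Coord n}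
    (hx : x ∈ U) (hv : v ≠ 0) (ν w : Coord n) :
    fderiv ℝ (fderiv ℝ fun v' => l (x, v')) v ν w = fderiv ℝ (fderiv ℝ l) (x, v) (0, ν) (0, w) := by
  have h1 : (fderiv ℝ fun v' => l (x, v')) =ᶠ[𝓝 v]
      fun v' => (fderiv ℝ l (x, v')).comp (.inr ℝ (Coord n) (Coord n)) := by
    filter_upwards [isOpen_ne.mem_nhds hv] with v' hv'
    exact fderiv_fibre hU hl hx hv'
  rw [h1.fderiv_eq]
  have h2 : HasFDerivAt (fun v' => fderiv ℝ l (x, v'))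
      ((fderiv ℝ (fderiv ℝ l) (x, v)).comp (.inr ℝ (Coord n) (Coord n))) v :=
    (differentiableAt_fderiv hU hl hx hv).hasFDerivAt.comp v (hasFDerivAt_prodMk_right x v)
  have h3 := h2.clm_comp
    (hasFDerivAt_const (ContinuousLinearMap.inr ℝ (Coord n) (Coord n)) v)
  rw [h3.fderiv]
  simp

/-- The Legendre map `(x, v) ↦ (x, ∂l/∂v)`. -/
noncomputable def legendreMap (l : Coord n × Coord n → ℝ) (z : Coord n × Coord n) :
    Coord n × (Coord n →L[ℝ] ℝ) :=
  (z.1, (fderiv ℝ l z).comp (.inr ℝ (Coord n) (Coord n)))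

/-- The Legendre map is a local diffeomorphism off the zero section. -/
theorem exists_equiv_legendreMap (hU : IsOpen U) (hl : IsCoordLagrangian U l) {x v : Coord n}
    (hx : x ∈ U) (hv : v ≠ 0) :
    ∃ e : (Coord n × Coord n) ≃L[ℝ] (Coord n × (Coord n →L[ℝ] ℝ)),
      HasFDerivAt (legendreMap l) (e : _ →L[ℝ] _) (x, v) := by
  set R : ((Coord n × Coord n) →L[ℝ] ℝ) →L[ℝ] (Coord n →L[ℝ] ℝ) :=
    (ContinuousLinearMap.compL ℝ (Coord n) (Coord n × Coord n) ℝ).flip (.inr ℝ _ _)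
  set T : (Coord n × Coord n) →L[ℝ] (Coord n × (Coord n →L[ℝ] ℝ)) :=
    (ContinuousLinearMap.fst ℝ (Coord n) (Coord n)).prod
      (R.comp (fderiv ℝ (fderiv ℝ l) (x, v)))
  have hT : HasFDerivAt (legendreMap l) T (x, v) :=
    hasFDerivAt_fst.prodMk
      (R.hasFDerivAt.comp (x, v) (differentiableAt_fderiv hU hl hx hv).hasFDerivAt)
  -- a kernel vector `(0, ν)` would be in the kernel of the fibre Hessian
  have hinj : Injective T := by
    rw [injective_iff_map_eq_zero]
    rintro ⟨ξ, ν⟩ h0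
    have h1 : ξ = 0 := congrArg Prod.fst h0
    have h2 : R (fderiv ℝ (fderiv ℝ l) (x, v) (ξ, ν)) = 0 := congrArg Prod.snd h0
    subst h1
    by_contra hne
    have hν : ν ≠ 0 := fun h => hne (by rw [h]; rfl)
    have h3 := (hl.fibre x hx).pos v ν hv hν
    rw [fderiv_fderiv_fibre hU hl hx hv] at h3
    have h4 := DFunLike.congr_fun h2 ν
    simp only [R, ContinuousLinearMap.flip_apply, ContinuousLinearMap.compL_apply,
      ContinuousLinearMap.comp_apply, ContinuousLinearMap.inr_apply,
      zero_apply] at h4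
    exact h3.ne' h4
  have hfr : Module.finrank ℝ (Coord n × Coord n)
      = Module.finrank ℝ (Coord n × (Coord n →L[ℝ] ℝ)) := by
    have := (InnerProductSpace.toDual ℝ (Coord n)).toLinearEquiv
    rw [Module.finrank_prod, Module.finrank_prod]
    congr 1
    rw [← (LinearMap.toContinuousLinearMap (𝕜 := ℝ) (E := Coord n) (F' := ℝ)).finrank_eq]
    exact (Subspace.dual_finrank_eq).symm
  refine ⟨(LinearEquiv.ofInjectiveOfFinrankEq (T : _ →ₗ[ℝ] _) hinj hfr).toContinuousLinearEquiv, ?_⟩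
  convert hT using 1
  exact ContinuousLinearMap.ext fun _ => rfl

theorem contDiffAt_legendreMap (hU : IsOpen U) (hl : IsCoordLagrangian U l) {x v : Coord n}
    (hx : x ∈ U) (hv : v ≠ 0) : ContDiffAt ℝ ∞ (legendreMap l) (x, v) := by
  have h1 := (hl.contDiffOn.fderiv_of_isOpen (m := ∞) (hU.prod isOpen_ne) (by simp)).contDiffAt
    (prod_mem_nhds (hU.mem_nhds hx) (isOpen_ne.mem_nhds hv))
  exact contDiffAt_fst.prodMk (h1.clm_comp contDiffAt_const)

/-- The maximizer in the Legendre transform depends smoothly on the covector, by the inverse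
function theorem. -/
theorem exists_smooth_maximizer (hU : IsOpen U) (hl : IsCoordLagrangian U l) (hn : 0 < n)
    {z : Phase n} (hz : z.1 ∈ U) (hz2 : z.2 ≠ 0) :
    ∃ ν : Phase n → Coord n, ContDiffAt ℝ ∞ ν z ∧
      ∀ᶠ y in 𝓝 z, y.1 ∈ U ∧ ν y ≠ 0 ∧
        fderiv ℝ (fun v => l (y.1, v)) (ν y) = innerSL ℝ y.2 := by
  obtain ⟨v, hv, hvz⟩ := (hl.fibre _ hz).exists_fderiv_eq hn hz2
  obtain ⟨e, he⟩ := exists_equiv_legendreMap hU hl hz hv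
  have hG := contDiffAt_legendreMap hU hl hz hv
  set g := hG.localInverse he (by simp)
  let j : Phase n → Coord n × (Coord n →L[ℝ] ℝ) := fun y => (y.1, innerSL ℝ y.2)
  have hj : ContDiff ℝ ∞ j := contDiff_fst.prodMk ((innerSL ℝ).contDiff.comp contDiff_snd)
  have hjz : legendreMap l (z.1, v) = j z := by
    simp only [legendreMap, j, ← fderiv_fibre hU hl hz hv, hvz]
  have hg : ContDiffAt ℝ ∞ g (j z) := by
    rw [← hjz]; exact hG.to_localInverse he (by simp)
  have hgz : g (j z) = (z.1, v) := by
    rw [← hjz]; exact hG.localInverse_apply_image he (by simp)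
  have hgj : ContDiffAt ℝ ∞ (fun y => g (j y)) z := hg.comp z hj.contDiffAt
  have hinv : ∀ᶠ w in 𝓝 (j z), legendreMap l (g w) = w := by
    rw [← hjz]
    exact (hG.hasStrictFDerivAt' he (by simp)).eventually_right_inverse
  refine ⟨fun y => (g (j y)).2, contDiffAt_snd.comp z hgj, ?_⟩
  have h1 : ∀ᶠ y in 𝓝 z, (g (j y)).2 ≠ 0 :=
    (continuousAt_snd.comp hgj.continuousAt).eventually_ne (by simpa [hgz] using hv)
  filter_upwards [hj.continuous.continuousAt.eventually hinv, h1,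
    continuousAt_fst.eventually_mem (hU.mem_nhds hz)] with y hy hy1 hyU
  have h2 : (g (j y)).1 = y.1 := by
    have := congrArg Prod.fst hy
    exact this
  have h3 : (fderiv ℝ l (g (j y))).comp (.inr ℝ (Coord n) (Coord n)) = innerSL ℝ y.2 := by
    have := congrArg Prod.snd hy
    exact this
  refine ⟨hyU, hy1, ?_⟩
  rw [fderiv_fibre hU hl hyU hy1, ← h2]
  exact h3

/-- The supremum defining the Hamiltonian is attained at every critical point off the origin. -/
theorem hamiltonian_eq_of_fderiv_eq (hl : IsCoordLagrangian U l)
    (hh : ∀ x ∈ U, ∀ p : Coord n, h (x, p) = ⨆ v, (inner ℝ p v - l (x, v)))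
    {x p v : Coord n} (hx : x ∈ U) (hv : v ≠ 0)
    (hp : fderiv ℝ (fun v => l (x, v)) v = innerSL ℝ p) : h (x, p) = inner ℝ p v - l (x, v) := by
  rw [hh x hx p]
  exact le_antisymm (ciSup_le fun w => (hl.fibre x hx).inner_sub_le_of_fderiv_eq hv hp w)
    (le_ciSup ((hl.fibre x hx).bddAbove p) v)

/-- Off the zero section the Hamiltonian is smooth, because the maximizer is. -/
theorem contDiffAt_hamiltonian (hU : IsOpen U) (hl : IsCoordLagrangian U l) (hn : 0 < n)
    (hh : ∀ x ∈ U, ∀ p : Coord n, h (x, p) = ⨆ v, (inner ℝ p v - l (x, v)))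
    {z : Phase n} (hz : z.1 ∈ U) (hz2 : z.2 ≠ 0) : ContDiffAt ℝ ∞ h z := by
  obtain ⟨ν, hν, hev⟩ := exists_smooth_maximizer hU hl hn hz hz2
  have h1 : h =ᶠ[𝓝 z] fun y => inner ℝ y.2 (ν y) - l (y.1, ν y) := by
    filter_upwards [hev] with y hy
    exact hamiltonian_eq_of_fderiv_eq hl hh hy.1 hy.2.1 hy.2.2
  refine ContDiffAt.congr_of_eventuallyEq ?_ h1
  refine (contDiffAt_snd.inner ℝ hν).sub ?_
  have h2 : ContDiffAt ℝ ∞ l (z.1, ν z) := hl.contDiffOn.contDiffAt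
    ((hU.prod isOpen_ne).mem_nhds ⟨hz, hev.self_of_nhds.2.1⟩)
  exact h2.comp z (contDiffAt_fst.prodMk hν)

/-- The fibre derivative of the Hamiltonian is the maximizer of the Legendre transform. -/
theorem hamVectorField_fst_eq (hU : IsOpen U) (hl : IsCoordLagrangian U l) (hn : 0 < n)
    (hh : ∀ x ∈ U, ∀ p : Coord n, h (x, p) = ⨆ v, (inner ℝ p v - l (x, v)))
    {z : Phase n} (hz : z.1 ∈ U) (hz2 : z.2 ≠ 0) {v : Coord n} (hv : v ≠ 0)
    (hp : fderiv ℝ (fun v => l (z.1, v)) v = innerSL ℝ z.2) : (hamVectorField h z).1 = v := by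
  have hd : HasFDerivAt h (fderiv ℝ h z) z :=
    ((contDiffAt_hamiltonian hU hl hn hh hz hz2).differentiableAt (by simp)).hasFDerivAt
  have h1 : HasFDerivAt (fun p => h (z.1, p)) ((fderiv ℝ h z).comp (.inr ℝ _ _)) z.2 :=
    HasFDerivAt.comp (g := h) z.2 hd (hasFDerivAt_prodMk_right z.1 z.2)
  have h2 := h1.sub (innerSL ℝ v).hasFDerivAt
  -- `p ↦ h(x, p) - ⟨v, p⟩` is minimal at the covector for which `v` is the maximizer
  have h3 : IsLocalMin ((fun p => h (z.1, p)) - ⇑(innerSL ℝ v)) z.2 := by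
    refine Eventually.of_forall fun p => ?_
    have h4 := hamiltonian_eq_of_fderiv_eq hl hh hz hv hp
    have h5 : inner ℝ p v - l (z.1, v) ≤ h (z.1, p) := by
      rw [hh z.1 hz p]
      exact le_ciSup ((hl.fibre _ hz).bddAbove p) v
    simp only [Pi.sub_apply, innerSL_apply_apply]
    rw [h4, real_inner_comm z.2 v, real_inner_comm p v]
    linarith
  have h6 := h3.hasFDerivAt_eq_zero h2
  refine ext_inner_right ℝ fun w => ?_
  have h7 := DFunLike.congr_fun h6 w
  have h8 := fderiv_eq_hamVectorField h z (0, w)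
  simp only [sub_apply, ContinuousLinearMap.comp_apply,
    ContinuousLinearMap.inr_apply, innerSL_apply_apply, zero_apply] at h7
  rw [inner_zero_right, sub_zero] at h8
  linarith

theorem contDiffOn_hamiltonian (hU : IsOpen U) (hl : IsCoordLagrangian U l) (hn : 0 < n)
    (hh : ∀ x ∈ U, ∀ p : Coord n, h (x, p) = ⨆ v, (inner ℝ p v - l (x, v))) :
    ContDiffOn ℝ ∞ h (U ×ˢ {p | p ≠ 0}) := fun _ hz =>
  (contDiffAt_hamiltonian hU hl hn hh hz.1 hz.2).contDiffWithinAt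

/-- The fibre Hessians of the Lagrangian and the Hamiltonian are inverse to each other. -/
theorem fderiv_fderiv_fibre_hamVectorField (hU : IsOpen U) (hl : IsCoordLagrangian U l) (hn : 0 < n)
    (hh : ∀ x ∈ U, ∀ p : Coord n, h (x, p) = ⨆ v, (inner ℝ p v - l (x, v)))
    {z : Phase n} (hz : z.1 ∈ U) (hz2 : z.2 ≠ 0) :
    (hamVectorField h z).1 ≠ 0 ∧ ∀ ζ w : Coord n,
      fderiv ℝ (fderiv ℝ fun v => l (z.1, v)) (hamVectorField h z).1
        (fderiv ℝ (hamVectorField h) z (0, ζ)).1 w = inner ℝ ζ w := by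
  have hcrit : ∀ p : Coord n, p ≠ 0 → (hamVectorField h (z.1, p)).1 ≠ 0 ∧
      fderiv ℝ (fun v => l (z.1, v)) (hamVectorField h (z.1, p)).1 = innerSL ℝ p := by
    intro p hp
    obtain ⟨v, hv, hvp⟩ := (hl.fibre _ hz).exists_fderiv_eq hn hp
    rw [hamVectorField_fst_eq hU hl hn hh (z := (z.1, p)) hz hp hv hvp]
    exact ⟨hv, hvp⟩
  refine ⟨(hcrit z.2 hz2).1, fun ζ w => ?_⟩
  have hΩ : IsOpen (U ×ˢ {p : Coord n | p ≠ 0}) := hU.prod isOpen_ne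
  have hX : HasFDerivAt (hamVectorField h) (fderiv ℝ (hamVectorField h) z) (z.1, z.2) :=
    (((contDiffOn_hamVectorField hΩ (contDiffOn_hamiltonian hU hl hn hh)).contDiffAt
      (hΩ.mem_nhds ⟨hz, hz2⟩)).differentiableAt (by simp)).hasFDerivAt
  have h1 : HasFDerivAt (fun p => (hamVectorField h (z.1, p)).1)
      ((ContinuousLinearMap.fst ℝ _ _).comp
        ((fderiv ℝ (hamVectorField h) z).comp (.inr ℝ _ _))) z.2 :=
    (HasFDerivAt.comp (g := hamVectorField h) z.2 hX (hasFDerivAt_prodMk_right z.1 z.2)).fst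
  have h2 := (((hl.fibre _ hz).differentiableAt_fderiv (hcrit z.2 hz2).1).hasFDerivAt).comp z.2 h1
  have h3 : (fderiv ℝ fun v => l (z.1, v)) ∘ (fun p => (hamVectorField h (z.1, p)).1)
      =ᶠ[𝓝 z.2] innerSL ℝ := by
    filter_upwards [isOpen_ne.mem_nhds hz2] with p hp
    exact (hcrit p hp).2
  have h4 := (h2.congr_of_eventuallyEq h3.symm).unique (innerSL ℝ).hasFDerivAt
  have h5 := DFunLike.congr_fun (DFunLike.congr_fun h4 ζ) w
  rw [innerSL_apply_apply] at h5
  exact h5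

/-- The fibre Hessian of the Hamiltonian is positive definite. -/
theorem fibreHessian_pos (hU : IsOpen U) (hl : IsCoordLagrangian U l) (hn : 0 < n)
    (hh : ∀ x ∈ U, ∀ p : Coord n, h (x, p) = ⨆ v, (inner ℝ p v - l (x, v)))
    {z : Phase n} (hz : z.1 ∈ U) (hz2 : z.2 ≠ 0) {ζ : Coord n} (hζ : ζ ≠ 0) :
    0 < inner ℝ (fderiv ℝ (hamVectorField h) z (0, ζ)).1 ζ := by
  obtain ⟨hv, h1⟩ := fderiv_fderiv_fibre_hamVectorField hU hl hn hh hz hz2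
  rw [real_inner_comm, ← h1]
  refine (hl.fibre _ hz).pos _ _ hv fun h0 => hζ ?_
  have := h1 ζ ζ
  rw [h0, map_zero, zero_apply] at this
  exact inner_self_eq_zero.mp this.symm

end IsCoordLagrangian

theorem partialAA_eq_inner {h : Phase n → ℝ} {Ω : Set (Phase n)} (hΩ : IsOpen Ω)
    (hh : ContDiffOn ℝ ∞ h Ω) {z : Phase n} (hz : z ∈ Ω) (i j : Fin n) :
    partialAA h i j z = (fderiv ℝ (hamVectorField h) z (dirA j)).1 i := by
  have hX : HasFDerivAt (hamVectorField h) (fderiv ℝ (hamVectorField h) z) z :=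
    (((contDiffOn_hamVectorField hΩ hh).contDiffAt (hΩ.mem_nhds hz)).differentiableAt
      (by simp)).hasFDerivAt
  have h1 : HasFDerivAt (partialA h i)
      ((EuclideanSpace.proj i).comp ((ContinuousLinearMap.fst ℝ _ _).comp
        (fderiv ℝ (hamVectorField h) z))) z :=
    (EuclideanSpace.proj (𝕜 := ℝ) i).hasFDerivAt.comp z hX.fst
  rw [partialAA, h1.fderiv]
  rfl

end Legendre

/-! ### Lagrangians, Hamiltonians and differentials in a chart -/

section Chart

variable {n : ℕ} {M : Type*} [TopologicalSpace M] [ChartedSpace (Coord n) M]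
  {φ : OpenPartialHomeomorph M (Coord n)}

theorem mdifferentiable_of_mem_maximalAtlas (hφ : φ ∈ IsManifold.maximalAtlas (𝓡 n) ∞ M) :
    φ.MDifferentiable (𝓡 n) (𝓡 n) :=
  ⟨(contMDiffOn_of_mem_maximalAtlas hφ).mdifferentiableOn (by simp),
    (contMDiffOn_symm_of_mem_maximalAtlas hφ).mdifferentiableOn (by simp)⟩

/-- The identification of `Coord n × Coord n` with the tangent bundle of `Coord n` is smooth. -/
theorem contMDiff_toTangentBundle :
    ContMDiff 𝓘(ℝ, Coord n × Coord n) (𝓡 n).tangent ∞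
      (fun z : Coord n × Coord n => (⟨z.1, z.2⟩ : TangentBundle (𝓡 n) (Coord n))) := by
  intro z
  apply Bundle.contMDiffAt_totalSpace.2
  refine ⟨contDiff_fst.contMDiff.contMDiffAt, ?_⟩
  have h := (contDiff_snd (𝕜 := ℝ) (n := ∞) (E := Coord n) (F := Coord n)).contMDiff.contMDiffAt
    (x := z)
  refine h.congr_of_eventuallyEq (Eventually.of_forall fun y => ?_)
  exact congrArg Prod.snd (trivializationAt_model_space_apply (I := 𝓡 n) _ _)

/-- The coordinates of the tangent bundle given by a chart are smooth. -/
theorem contMDiffOn_tangentMap_symm [IsManifold (𝓡 n) ∞ M]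
    (hφ : φ ∈ IsManifold.maximalAtlas (𝓡 n) ∞ M) :
    ContMDiffOn 𝓘(ℝ, Coord n × Coord n) (𝓡 n).tangent ∞
      (fun z : Coord n × Coord n => (⟨φ.symm z.1, mfderiv (𝓡 n) (𝓡 n) φ.symm z.1 z.2⟩ :
        TangentBundle (𝓡 n) M)) (φ.target ×ˢ univ) := by
  have h1 := (contMDiffOn_symm_of_mem_maximalAtlas hφ).contMDiffOn_tangentMapWithin (m := ∞)
    (by simp) φ.open_target.uniqueMDiffOn
  have h2 := h1.comp (contMDiff_toTangentBundle (n := n)).contMDiffOn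
    (s := φ.target ×ˢ univ) (fun z hz => hz.1)
  refine h2.congr fun z hz => ?_
  simp only [comp_apply, tangentMapWithin]
  rw [mfderivWithin_of_isOpen φ.open_target hz.1]

theorem contDiffOn_coordLagrangian_one [IsManifold (𝓡 n) ∞ M]
    {L : TangentBundle (𝓡 n) M → ℝ} (hL : IsLagrangian L)
    (hφ : φ ∈ IsManifold.maximalAtlas (𝓡 n) ∞ M) :
    ContDiffOn ℝ 1 (coordLagrangian L φ) (φ.target ×ˢ univ) := by
  rw [← contMDiffOn_iff_contDiffOn]
  exact hL.contMDiff_one.comp_contMDiffOn ((contMDiffOn_tangentMap_symm hφ).of_le (by simp))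

theorem mfderiv_symm_ne_zero [IsManifold (𝓡 n) ∞ M]
    (hφ : φ ∈ IsManifold.maximalAtlas (𝓡 n) ∞ M) {x v : Coord n}
    (hx : x ∈ φ.target) (hv : v ≠ 0) : mfderiv (𝓡 n) (𝓡 n) φ.symm x v ≠ 0 := by
  have h := (mdifferentiable_of_mem_maximalAtlas hφ).symm.mfderiv_injective (x := x) hx
  intro h0
  exact hv (h (h0.trans (map_zero _).symm))

theorem contDiffOn_coordLagrangian [IsManifold (𝓡 n) ∞ M]
    {L : TangentBundle (𝓡 n) M → ℝ} (hL : IsLagrangian L)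
    (hφ : φ ∈ IsManifold.maximalAtlas (𝓡 n) ∞ M) :
    ContDiffOn ℝ ∞ (coordLagrangian L φ) (φ.target ×ˢ {v | v ≠ 0}) := by
  rw [← contMDiffOn_iff_contDiffOn]
  refine hL.contMDiffOn.comp ((contMDiffOn_tangentMap_symm hφ).mono
    (prod_mono_right (subset_univ _))) fun z hz => mfderiv_symm_ne_zero hφ hz.1 hz.2

theorem mfderiv_mfderiv_symm [IsManifold (𝓡 n) ∞ M]
    (hφ : φ ∈ IsManifold.maximalAtlas (𝓡 n) ∞ M) {x : Coord n}
    (hx : x ∈ φ.target) (v : Coord n) :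
    mfderiv (𝓡 n) (𝓡 n) φ (φ.symm x) (mfderiv (𝓡 n) (𝓡 n) φ.symm x v) = v := by
  have h := (mdifferentiable_of_mem_maximalAtlas hφ).comp_symm_deriv hx
  exact DFunLike.congr_fun h v

theorem mfderiv_symm_mfderiv [IsManifold (𝓡 n) ∞ M]
    (hφ : φ ∈ IsManifold.maximalAtlas (𝓡 n) ∞ M) {x : Coord n}
    (hx : x ∈ φ.target) (v : Coord n) :
    mfderiv (𝓡 n) (𝓡 n) φ.symm x (mfderiv (𝓡 n) (𝓡 n) φ (φ.symm x) v) = v := by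
  have h := (mdifferentiable_of_mem_maximalAtlas hφ).symm.comp_symm_deriv
    (x := φ.symm x) (φ.map_target hx)
  rw [OpenPartialHomeomorph.symm_symm, φ.right_inv hx] at h
  exact DFunLike.congr_fun h v

/-- In a chart, the Hamiltonian is the Legendre transform of the Lagrangian. -/
theorem coordHamiltonian_eq_iSup [IsManifold (𝓡 n) ∞ M] (L : TangentBundle (𝓡 n) M → ℝ)
    (hφ : φ ∈ IsManifold.maximalAtlas (𝓡 n) ∞ M) {x : Coord n} (hx : x ∈ φ.target) (p : Coord n) :
    coordHamiltonian L φ (x, p) = ⨆ v, (inner ℝ p v - coordLagrangian L φ (x, v)) := by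
  have hs : Surjective fun v : Coord n =>
      (mfderiv (𝓡 n) (𝓡 n) φ.symm x v : TangentSpace (𝓡 n) (φ.symm x)) :=
    fun v => ⟨_, mfderiv_symm_mfderiv hφ hx v⟩
  rw [coordHamiltonian, hamiltonian, ← hs.iSup_comp]
  refine iSup_congr fun v => ?_
  have : covector φ (φ.symm x) p (mfderiv (𝓡 n) (𝓡 n) φ.symm x v) = inner ℝ p v := by
    have h1 : covector φ (φ.symm x) p (mfderiv (𝓡 n) (𝓡 n) φ.symm x v) = inner ℝ p
      (mfderiv (𝓡 n) (𝓡 n) φ (φ.symm x) (mfderiv (𝓡 n) (𝓡 n) φ.symm x v) : Coord n) := rfl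
    rw [h1, mfderiv_mfderiv_symm hφ hx v]
  rw [this]
  rfl

theorem isFibreLagrangian_coordLagrangian [IsManifold (𝓡 n) ∞ M]
    {L : TangentBundle (𝓡 n) M → ℝ} (hL : IsLagrangian L)
    (hH : HasFiniteHamiltonian L) (hφ : φ ∈ IsManifold.maximalAtlas (𝓡 n) ∞ M) {x : Coord n}
    (hx : x ∈ φ.target) : IsFibreLagrangian fun v => coordLagrangian L φ (x, v) where
  nonneg v := hL.nonneg _
  zero := by
    have h1 : mfderiv (𝓡 n) (𝓡 n) φ.symm x (0 : Coord n) = 0 := map_zero _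
    simp only [coordLagrangian]
    rw [h1]
    exact hL.zero _
  contDiff_one := by
    rw [← contDiffOn_univ]
    exact (contDiffOn_coordLagrangian_one hL hφ).comp
      (contDiff_prodMk_right x).contDiffOn fun v _ => ⟨hx, mem_univ _⟩
  contDiffOn := (contDiffOn_coordLagrangian hL hφ).comp
      (contDiff_prodMk_right x).contDiffOn fun v hv => ⟨hx, hv⟩
  bddAbove p := by
    obtain ⟨c, hc⟩ := hH (φ.symm x) (covector φ (φ.symm x) p)
    refine ⟨c, ?_⟩
    rintro _ ⟨v, rfl⟩
    have h1 := hc ⟨mfderiv (𝓡 n) (𝓡 n) φ.symm x v, rfl⟩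
    have h2 : covector φ (φ.symm x) p (mfderiv (𝓡 n) (𝓡 n) φ.symm x v) = inner ℝ p
      (mfderiv (𝓡 n) (𝓡 n) φ (φ.symm x) (mfderiv (𝓡 n) (𝓡 n) φ.symm x v) : Coord n) := rfl
    simp only [h2] at h1
    rw [mfderiv_mfderiv_symm hφ hx v] at h1
    exact h1
  -- `B` carries coordinate vectors to the fibre over `φ.symm x`; the Hessian transforms by `B`
  pos v w hv hw := by
    let B : Coord n ≃L[ℝ] Coord n := ContinuousLinearEquiv.equivOfInverse
      (mfderiv (𝓡 n) (𝓡 n) φ.symm x : Coord n →L[ℝ] Coord n)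
      (mfderiv (𝓡 n) (𝓡 n) φ (φ.symm x) : Coord n →L[ℝ] Coord n)
      (mfderiv_mfderiv_symm hφ hx) (mfderiv_symm_mfderiv hφ hx)
    let f : Coord n → ℝ := fun v => L ⟨φ.symm x, v⟩
    have hf : (fun v => coordLagrangian L φ (x, v)) = f ∘ B := rfl
    have hf' : f = (fun v => coordLagrangian L φ (x, v)) ∘ B.symm := by
      rw [hf, comp_assoc, B.self_comp_symm, comp_id]
    have hBv : B v ≠ 0 := by simpa using hv
    have hBw : B w ≠ 0 := by simpa using hw
    have hsm : ContDiffAt ℝ ∞ f (B v) := by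
      rw [hf']
      refine ContDiffAt.comp _ ?_ B.symm.contDiff.contDiffAt
      rw [B.symm_apply_apply]
      exact ((contDiffOn_coordLagrangian hL hφ).comp (contDiff_prodMk_right x).contDiffOn
        fun v hv => ⟨hx, hv⟩ : ContDiffOn ℝ ∞ (fun v => coordLagrangian L φ (x, v))
          {v | v ≠ 0}).contDiffAt (isOpen_ne.mem_nhds hv)
    have hd : HasFDerivAt (fderiv ℝ f) (fderiv ℝ (fderiv ℝ f) (B v)) (B v) :=
      ((hsm.fderiv_right (m := ∞) (by simp)).differentiableAt (by simp)).hasFDerivAt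
    have h1 : fderiv ℝ (f ∘ B) = fun v => (fderiv ℝ f (B v)).comp (B : Coord n →L[ℝ] Coord n) :=
      funext fun v => B.comp_right_fderiv
    have h2 := (hd.comp v B.hasFDerivAt).clm_comp
      (hasFDerivAt_const (B : Coord n →L[ℝ] Coord n) v)
    have h3 : fderiv ℝ (fderiv ℝ (f ∘ B)) v w w = fderiv ℝ (fderiv ℝ f) (B v) (B w) (B w) := by
      rw [h1]
      have := h2.fderiv
      simp only [comp_def] at this
      rw [this]
      simp
    rw [hf, h3]
    exact hL.strongly_convex _ _ _ hBv hBw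

theorem isCoordLagrangian_coordLagrangian [IsManifold (𝓡 n) ∞ M]
    {L : TangentBundle (𝓡 n) M → ℝ} (hL : IsLagrangian L)
    (hH : HasFiniteHamiltonian L) (hφ : φ ∈ IsManifold.maximalAtlas (𝓡 n) ∞ M) :
    IsCoordLagrangian φ.target (coordLagrangian L φ) where
  fibre _ hx := isFibreLagrangian_coordLagrangian hL hH hφ hx
  contDiffOn := contDiffOn_coordLagrangian hL hφ

theorem contDiffOn_weight [MeasurableSpace M] {m : Measure M}
    (hm : IsSmoothPositiveMeasure (n := n) m) (hφ : φ ∈ IsManifold.maximalAtlas (𝓡 n) ∞ M) :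
    ContDiffOn ℝ ∞ (weight m φ) φ.target := by
  have h := hm φ hφ
  rw [weight, dif_pos h]
  exact h.choose_spec.1

theorem contDiffOn_comp_symm {u : M → ℝ} (hu : ContMDiff (𝓡 n) 𝓘(ℝ, ℝ) ∞ u)
    (hφ : φ ∈ IsManifold.maximalAtlas (𝓡 n) ∞ M) : ContDiffOn ℝ ∞ (u ∘ φ.symm) φ.target := by
  rw [← contMDiffOn_iff_contDiffOn]
  exact hu.comp_contMDiffOn (contMDiffOn_symm_of_mem_maximalAtlas hφ)

theorem chartDu_snd_ne_zero [IsManifold (𝓡 n) ∞ M] {u : M → ℝ} (hu : ContMDiff (𝓡 n) 𝓘(ℝ, ℝ) ∞ u)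
    (hφ : φ ∈ IsManifold.maximalAtlas (𝓡 n) ∞ M) {x : M} (hxφ : x ∈ φ.source)
    (hx : mfderiv (𝓡 n) 𝓘(ℝ, ℝ) u x ≠ 0) : (chartDu φ u x).2 ≠ 0 := by
  intro h0
  apply hx
  have hφd := mdifferentiable_of_mem_maximalAtlas hφ
  have hcd := (contDiffOn_comp_symm hu hφ).contDiffAt (φ.open_target.mem_nhds (φ.map_source hxφ))
  have hd0 : fderiv ℝ (u ∘ φ.symm) (φ x) = 0 := by
    ext v
    rw [coord_eq_sum v, map_sum]
    refine Finset.sum_eq_zero fun i _ => ?_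
    have : partialBase (u ∘ φ.symm) i (φ x) = 0 := by
      have := congrArg (fun w : Coord n => w i) h0
      exact this
    rw [map_smul, ← partialBase, this, smul_zero]
  have hd : HasFDerivAt (u ∘ φ.symm) (0 : Coord n →L[ℝ] ℝ) (φ x) := by
    rw [← hd0]
    exact (hcd.differentiableAt (by simp)).hasFDerivAt
  have h1 : u =ᶠ[𝓝 x] (u ∘ φ.symm) ∘ φ := by
    filter_upwards [φ.open_source.mem_nhds hxφ] with y hy
    simp [φ.left_inv hy]
  have h3 := (hd.hasMFDerivAt.comp x
    (hφd.mdifferentiableAt hxφ).hasMFDerivAt).congr_of_eventuallyEq h1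
  rw [h3.mfderiv]
  exact ContinuousLinearMap.zero_comp _

end Chart

/-! ### The linearized Hamiltonian flow -/

section Blocks

variable {n : ℕ}

/-- The block `H_{αα}` of the linearization of the Hamiltonian vector field. -/
noncomputable def Pop (h : Phase n → ℝ) (z : Phase n) : Coord n →L[ℝ] Coord n :=
  (ContinuousLinearMap.fst ℝ (Coord n) (Coord n)).comp
    ((fderiv ℝ (hamVectorField h) z).comp (.inr ℝ (Coord n) (Coord n)))

/-- The block `H_{αx}` of the linearization of the Hamiltonian vector field. -/
noncomputable def Qop (h : Phase n → ℝ) (z : Phase n) : Coord n →L[ℝ] Coord n :=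
  (ContinuousLinearMap.fst ℝ (Coord n) (Coord n)).comp
    ((fderiv ℝ (hamVectorField h) z).comp (.inl ℝ (Coord n) (Coord n)))

/-- The block `-H_{xα}` of the linearization of the Hamiltonian vector field; it is the negative of
the adjoint of `Qop`. -/
noncomputable def Nop (h : Phase n → ℝ) (z : Phase n) : Coord n →L[ℝ] Coord n :=
  (ContinuousLinearMap.snd ℝ (Coord n) (Coord n)).comp
    ((fderiv ℝ (hamVectorField h) z).comp (.inr ℝ (Coord n) (Coord n)))

/-- The operator `H_{xx}`, the negative of the remaining block of the linearization of the
Hamiltonian vector field. -/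
noncomputable def Sop (h : Phase n → ℝ) (z : Phase n) : Coord n →L[ℝ] Coord n :=
  -(ContinuousLinearMap.snd ℝ (Coord n) (Coord n)).comp
    ((fderiv ℝ (hamVectorField h) z).comp (.inl ℝ (Coord n) (Coord n)))

/-- The derivative of `H_{αα}` along the Hamiltonian vector field. -/
noncomputable def dPop (h : Phase n → ℝ) (z : Phase n) : Coord n →L[ℝ] Coord n :=
  fderiv ℝ (Pop h) z (hamVectorField h z)

/-- The operator `C = ½ P⁻¹ (-P' + Q P + P Qᵀ)`. The velocities of a canonical frame with vertical
part `E` are `(-P E, C E)`, so that `-C P⁻¹` is the slope of the horizontal space. -/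
noncomputable def Cop (h : Phase n → ℝ) (z : Phase n) : Coord n →L[ℝ] Coord n :=
  (1 / 2 : ℝ) • (Ring.inverse (Pop h z) *
    (-dPop h z + Qop h z * Pop h z - Pop h z * Nop h z))

theorem fderiv_hamVectorField_apply (h : Phase n → ℝ) (z : Phase n) (ξ ζ : Coord n) :
    fderiv ℝ (hamVectorField h) z (ξ, ζ) =
      (Qop h z ξ + Pop h z ζ, Nop h z ζ - Sop h z ξ) := by
  have h1 : (ξ, ζ) = ContinuousLinearMap.inl ℝ (Coord n) (Coord n) ξ
      + ContinuousLinearMap.inr ℝ (Coord n) (Coord n) ζ := by simp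
  rw [h1, map_add]
  ext i
  · simp [Pop, Qop]
  · simp [Nop, Sop, add_comm]

/-- A Hamiltonian that is smooth, with positive definite fibre Hessian, on an open set. -/
structure IsConvexHamiltonian (Ω : Set (Phase n)) (h : Phase n → ℝ) : Prop where
  isOpen : IsOpen Ω
  contDiffOn : ContDiffOn ℝ ∞ h Ω
  pos : ∀ z ∈ Ω, ∀ ζ : Coord n, ζ ≠ 0 → 0 < inner ℝ (Pop h z ζ) ζ

namespace IsConvexHamiltonian

variable {Ω : Set (Phase n)} {h : Phase n → ℝ} (H : IsConvexHamiltonian Ω h)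
include H

theorem contDiffOn_X : ContDiffOn ℝ ∞ (hamVectorField h) Ω :=
  contDiffOn_hamVectorField H.isOpen H.contDiffOn

theorem contDiffOn_fderiv : ContDiffOn ℝ ∞ (fderiv ℝ (hamVectorField h)) Ω :=
  H.contDiffOn_X.fderiv_of_isOpen H.isOpen (by simp)

theorem contDiffOn_P : ContDiffOn ℝ ∞ (Pop h) Ω :=
  contDiffOn_const.clm_comp (H.contDiffOn_fderiv.clm_comp contDiffOn_const)

theorem contDiffOn_Q : ContDiffOn ℝ ∞ (Qop h) Ω :=
  contDiffOn_const.clm_comp (H.contDiffOn_fderiv.clm_comp contDiffOn_const)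

theorem contDiffOn_N : ContDiffOn ℝ ∞ (Nop h) Ω :=
  contDiffOn_const.clm_comp (H.contDiffOn_fderiv.clm_comp contDiffOn_const)

theorem contDiffOn_dP : ContDiffOn ℝ ∞ (dPop h) Ω :=
  (H.contDiffOn_P.fderiv_of_isOpen H.isOpen (by simp)).clm_apply H.contDiffOn_X

theorem hasFDerivAt {F : Type*} [NormedAddCommGroup F] [NormedSpace ℝ F] {f : Phase n → F}
    (hf : ContDiffOn ℝ ∞ f Ω) {z : Phase n} (hz : z ∈ Ω) : HasFDerivAt f (fderiv ℝ f z) z :=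
  ((hf.contDiffAt (H.isOpen.mem_nhds hz)).differentiableAt (by simp)).hasFDerivAt

theorem isUnit_P {z : Phase n} (hz : z ∈ Ω) : IsUnit (Pop h z) := by
  have hinj : Injective (Pop h z : Coord n →ₗ[ℝ] Coord n) := by
    rw [injective_iff_map_eq_zero]
    intro ζ h0
    by_contra hne
    have := H.pos z hz ζ hne
    have h1 : Pop h z ζ = 0 := h0
    rw [h1, inner_zero_left] at this
    exact lt_irrefl _ this
  exact ⟨ContinuousLinearEquiv.toUnit
    (LinearEquiv.ofInjectiveEndo _ hinj).toContinuousLinearEquiv, by ext; rfl⟩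

theorem contDiffOn_C : ContDiffOn ℝ ∞ (Cop h) Ω := by
  refine ContDiffOn.const_smul (1 / 2 : ℝ) (ContDiffOn.clm_comp (g := fun z => Ring.inverse (Pop h z))
    ?_ ((H.contDiffOn_dP.neg.add
    (H.contDiffOn_Q.clm_comp H.contDiffOn_P)).sub (H.contDiffOn_P.clm_comp H.contDiffOn_N)))
  intro z hz
  obtain ⟨u, hu⟩ := H.isUnit_P hz
  have h1 := contDiffAt_ringInverse (n := ∞) ℝ u
  rw [hu] at h1
  exact (h1.comp z (H.contDiffOn_P.contDiffAt (H.isOpen.mem_nhds hz))).contDiffWithinAt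

theorem P_injective {z : Phase n} (hz : z ∈ Ω) {a b : Coord n} (hab : Pop h z a = Pop h z b) :
    a = b := by
  by_contra hne
  have := H.pos z hz (a - b) (sub_ne_zero.mpr hne)
  rw [map_sub, hab, sub_self, inner_zero_left] at this
  exact lt_irrefl _ this

/-- The defining property of `C`: `2 P C = -P' + Q P - P N`. -/
theorem two_smul_P_C {z : Phase n} (hz : z ∈ Ω) (a : Coord n) :
    (2 : ℝ) • Pop h z (Cop h z a) =
      -dPop h z a + Qop h z (Pop h z a) - Pop h z (Nop h z a) := by
  have h1 : ∀ b, Pop h z (Ring.inverse (Pop h z) b) = b :=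
    DFunLike.congr_fun (Ring.mul_inverse_cancel _ (H.isUnit_P hz))
  have h2 : Cop h z a = (1 / 2 : ℝ) • Ring.inverse (Pop h z)
      (-dPop h z a + Qop h z (Pop h z a) - Pop h z (Nop h z a)) := rfl
  rw [h2, map_smul, h1, smul_smul]
  norm_num

theorem P_symm {z : Phase n} (hz : z ∈ Ω) (a b : Coord n) :
    inner ℝ (Pop h z a) b = inner ℝ a (Pop h z b) := by
  have h1 := fderiv_fderiv_symm H.isOpen H.contDiffOn hz (0, a) (0, b)
  rw [inner_fderiv_hamVectorField H.isOpen H.contDiffOn hz,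
    inner_fderiv_hamVectorField H.isOpen H.contDiffOn hz] at h1
  simp only [fderiv_hamVectorField_apply, map_zero, zero_add, inner_zero_right, sub_zero] at h1
  rw [h1, real_inner_comm]

/-- `N = -Qᵀ`. -/
theorem N_adjoint {z : Phase n} (hz : z ∈ Ω) (a b : Coord n) :
    inner ℝ (Nop h z a) b = -inner ℝ a (Qop h z b) := by
  have h1 := fderiv_fderiv_symm H.isOpen H.contDiffOn hz (0, a) (b, 0)
  rw [inner_fderiv_hamVectorField H.isOpen H.contDiffOn hz,
    inner_fderiv_hamVectorField H.isOpen H.contDiffOn hz] at h1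
  simp only [fderiv_hamVectorField_apply, map_zero, inner_zero_right, zero_sub,
    sub_zero, add_zero] at h1
  rw [real_inner_comm _ a, ← h1, neg_neg]

theorem dP_symm {z : Phase n} (hz : z ∈ Ω) (a b : Coord n) :
    inner ℝ (dPop h z a) b = inner ℝ a (dPop h z b) := by
  have hP := H.hasFDerivAt H.contDiffOn_P hz
  have h1 := (hP.clm_apply (hasFDerivAt_const a z)).inner ℝ (hasFDerivAt_const b z)
  have h2 := (hasFDerivAt_const a z).inner ℝ (hP.clm_apply (hasFDerivAt_const b z))
  have h3 : (fun z => inner ℝ (Pop h z a) b) =ᶠ[𝓝 z] fun z => inner ℝ a (Pop h z b) := by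
    filter_upwards [H.isOpen.mem_nhds hz] with y hy
    exact H.P_symm hy a b
  have h4 := DFunLike.congr_fun (h1.unique (h2.congr_of_eventuallyEq h3)) (hamVectorField h z)
  simpa [dPop] using h4

/-- `P C` is symmetric. -/
theorem PC_symm {z : Phase n} (hz : z ∈ Ω) (a b : Coord n) :
    inner ℝ (Pop h z (Cop h z a)) b = inner ℝ a (Pop h z (Cop h z b)) := by
  have h1 : inner ℝ ((2 : ℝ) • Pop h z (Cop h z a)) b
      = inner ℝ a ((2 : ℝ) • Pop h z (Cop h z b)) := by
    rw [H.two_smul_P_C hz, H.two_smul_P_C hz]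
    simp only [inner_sub_left, inner_add_left, inner_neg_left, inner_sub_right, inner_add_right,
      inner_neg_right]
    rw [H.dP_symm hz, H.P_symm hz (Nop h z a), H.N_adjoint hz a, real_inner_comm b,
      ← H.P_symm hz a (Nop h z b), real_inner_comm (Nop h z b), H.N_adjoint hz b]
    ring
  rw [inner_smul_left, inner_smul_right] at h1
  simpa using h1

/-- The linearization of the Hamiltonian vector field is infinitesimally symplectic. -/
theorem symp_fderiv_add {z : Phase n} (hz : z ∈ Ω) (v w : Phase n) :
    symp (fderiv ℝ (hamVectorField h) z v) w + symp v (fderiv ℝ (hamVectorField h) z w) = 0 := by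
  have h1 := fderiv_fderiv_symm H.isOpen H.contDiffOn hz v w
  rw [inner_fderiv_hamVectorField H.isOpen H.contDiffOn hz,
    inner_fderiv_hamVectorField H.isOpen H.contDiffOn hz] at h1
  rw [symp_eq_inner, symp_eq_inner, real_inner_comm _ v.2, real_inner_comm _ v.1]
  linarith

end IsConvexHamiltonian

theorem mem_vertical_iff (z : Phase n) : z ∈ vertical n ↔ z.1 = 0 := by
  constructor
  · intro hz
    induction hz using Submodule.span_induction with
    | mem x hx => obtain ⟨i, rfl⟩ := hx; rfl
    | zero => rfl
    | add x y _ _ hx hy => rw [Prod.fst_add, hx, hy, add_zero]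
    | smul c x _ hx => rw [Prod.smul_fst, hx, smul_zero]
  · intro hz
    rw [phase_eq_sum z, hz]
    simp only [PiLp.zero_apply, zero_smul, Finset.sum_const_zero, zero_add]
    exact Submodule.sum_mem _ fun i _ => Submodule.smul_mem _ _ (Submodule.subset_span ⟨i, rfl⟩)

end Blocks

theorem hasDerivAt_fst {E F : Type*} [NormedAddCommGroup E] [NormedSpace ℝ E]
    [NormedAddCommGroup F] [NormedSpace ℝ F] {f : ℝ → E × F} {f' : E × F} {t : ℝ}
    (hf : HasDerivAt f f' t) : HasDerivAt (fun s => (f s).1) f'.1 t := hf.fst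

theorem hasDerivAt_snd {E F : Type*} [NormedAddCommGroup E] [NormedSpace ℝ E]
    [NormedAddCommGroup F] [NormedSpace ℝ F] {f : ℝ → E × F} {f' : E × F} {t : ℝ}
    (hf : HasDerivAt f f' t) : HasDerivAt (fun s => (f s).2) f'.2 t := hf.snd

/-! ### Canonical frames -/

section Frames

variable {n : ℕ} {Ω : Set (Phase n)} {h : Phase n → ℝ}

/-- The linearization `A` of the flow `Φ` along the trajectory of `α`, for times in `(-δ, δ)`. -/
structure IsVariation (h : Phase n → ℝ) (Ω : Set (Phase n)) (Φ : ℝ → Phase n → Phase n)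
    (α : Phase n) (δ : ℝ) (A : ℝ → Phase n →L[ℝ] Phase n) : Prop where
  pos : 0 < δ
  zero : A 0 = 1
  flow_zero : Φ 0 α = α
  contDiffOn : ContDiffOn ℝ ∞ A (Ioo (-δ) δ)
  contDiffOn_flow : ContDiffOn ℝ ∞ (fun t => Φ t α) (Ioo (-δ) δ)
  mem : ∀ t ∈ Ioo (-δ) δ, Φ t α ∈ Ω
  deriv_flow : ∀ t ∈ Ioo (-δ) δ, HasDerivAt (fun s => Φ s α) (hamVectorField h (Φ t α)) t
  hasDerivAt : ∀ t ∈ Ioo (-δ) δ,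
    HasDerivAt A ((fderiv ℝ (hamVectorField h) (Φ t α)).comp (A t)) t
  fderiv_flow : ∀ t ∈ Ioo (-δ) δ, fderiv ℝ (Φ t) α = A t

/-- Every continuous local flow is differentiable in the initial point, with derivative solving the
first variation equation. -/
theorem exists_isVariation (H : IsConvexHamiltonian Ω h) {α : Phase n} (hα : α ∈ Ω)
    {D : Set (Phase n)} {ε : ℝ} (hε : 0 < ε) {Φ : ℝ → Phase n → Phase n}
    (hΦ : IsLocalFlow h D α ε Φ) : ∃ δ A, IsVariation h Ω Φ α δ A := by
  obtain ⟨W, hW, hc, hf⟩ := hΦ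
  obtain ⟨A, δ, hδ, hA0, hAs, hzs, hall⟩ := exists_hasFDerivAt_localFlow H.isOpen H.contDiffOn_X hα
    hε hW hc fun β hβ => ⟨(hf β hβ).1, fun t ht => ((hf β hβ).2 t ht).2⟩
  exact ⟨δ, A, hδ, hA0, (hf α (mem_of_mem_nhds hW)).1, hAs, hzs, fun t ht => (hall t ht).1,
    fun t ht => (hall t ht).2.1, fun t ht => (hall t ht).2.2.1,
    fun t ht => (hall t ht).2.2.2.fderiv⟩

namespace IsVariation

variable {Φ : ℝ → Phase n → Phase n} {α : Phase n} {δ : ℝ} {A : ℝ → Phase n →L[ℝ] Phase n}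

theorem mono (V : IsVariation h Ω Φ α δ A) {δ' : ℝ} (h0 : 0 < δ') (hle : δ' ≤ δ) :
    IsVariation h Ω Φ α δ' A := by
  have hsub : Ioo (-δ') δ' ⊆ Ioo (-δ) δ := Ioo_subset_Ioo (neg_le_neg hle) hle
  exact ⟨h0, V.zero, V.flow_zero, V.contDiffOn.mono hsub, V.contDiffOn_flow.mono hsub,
    fun t ht => V.mem t (hsub ht), fun t ht => V.deriv_flow t (hsub ht),
    fun t ht => V.hasDerivAt t (hsub ht), fun t ht => V.fderiv_flow t (hsub ht)⟩

theorem zero_mem (V : IsVariation h Ω Φ α δ A) : (0 : ℝ) ∈ Ioo (-δ) δ :=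
  ⟨by linarith [V.pos], V.pos⟩

theorem mem_nhds {t : ℝ} (ht : t ∈ Ioo (-δ) δ) : Ioo (-δ) δ ∈ 𝓝 t := isOpen_Ioo.mem_nhds ht

/-- The linearized flow is symplectic. -/
theorem symp_eq (V : IsVariation h Ω Φ α δ A) (H : IsConvexHamiltonian Ω h) {t : ℝ}
    (ht : t ∈ Ioo (-δ) δ) (v w : Phase n) : symp (A t v) (A t w) = symp v w := by
  have hd : ∀ s ∈ Ioo (-δ) δ, HasDerivAt (fun s => symp (A s v) (A s w)) 0 s := by
    intro s hs
    have hv := (V.hasDerivAt s hs).clm_apply (hasDerivAt_const s v)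
    have hw := (V.hasDerivAt s hs).clm_apply (hasDerivAt_const s w)
    simp only [map_zero, add_zero, ContinuousLinearMap.comp_apply] at hv hw
    have h1 := ((hasDerivAt_snd hv).inner ℝ (hasDerivAt_fst hw)).fun_sub
      ((hasDerivAt_fst hv).inner ℝ (hasDerivAt_snd hw))
    simp only [← symp_eq_inner] at h1
    refine h1.congr_deriv ?_
    have h2 := H.symp_fderiv_add (V.mem s hs) (A s v) (A s w)
    rw [symp_eq_inner, symp_eq_inner] at h2
    rw [← h2]
    ring
  have h1 := isOpen_Ioo.is_const_of_deriv_eq_zero isPreconnected_Ioo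
    (fun s hs => (hd s hs).differentiableAt.differentiableWithinAt)
    (fun s hs => (hd s hs).deriv) ht V.zero_mem
  simpa [V.zero] using h1

/-- A smooth function on phase space, differentiated along the flow. -/
theorem hasDerivAt_comp (V : IsVariation h Ω Φ α δ A) (H : IsConvexHamiltonian Ω h)
    {F : Type*} [NormedAddCommGroup F] [NormedSpace ℝ F] {f : Phase n → F}
    (hf : ContDiffOn ℝ ∞ f Ω) {t : ℝ} (ht : t ∈ Ioo (-δ) δ) :
    HasDerivAt (fun s => f (Φ s α)) (fderiv ℝ f (Φ t α) (hamVectorField h (Φ t α))) t :=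
  (H.hasFDerivAt hf (V.mem t ht)).comp_hasDerivAt t (V.deriv_flow t ht)

end IsVariation

/-- The curvature operator in the fibre coordinates of the vertical space:
`R = S P - C' - C² - C N + N C`, where `C'` is the derivative of `C` along the flow. -/
noncomputable def Rop (h : Phase n → ℝ) (z : Phase n) : Coord n →L[ℝ] Coord n :=
  Sop h z * Pop h z - fderiv ℝ (Cop h) z (hamVectorField h z) - Cop h z * Cop h z
    - Cop h z * Nop h z + Nop h z * Cop h z

/-- The values at time `0` of a canonical frame and its first two derivatives. Transported to the
vertical space by the linearized flow, the frame is `(0, E)`; its velocity has base part `-P E`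
because the base part of the frame stays zero, and fibre part `C E` because the base part of the
acceleration vanishes. -/
theorem IsCanonicalFrame.exists_values (H : IsConvexHamiltonian Ω h)
    {Φ : ℝ → Phase n → Phase n} {α : Phase n} {δ : ℝ} {A : ℝ → Phase n →L[ℝ] Phase n}
    (V₀ : IsVariation h Ω Φ α δ A) {ε : ℝ} (hε : 0 < ε) {e : Fin n → ℝ → Phase n}
    (he : IsCanonicalFrame Φ α ε e) :
    ∃ E : Fin n → Coord n, (∀ i j, inner ℝ (Pop h α (E i)) (E j) = if i = j then 1 else 0) ∧
      ∀ i, e i 0 = (0, E i) ∧ deriv (e i) 0 = (-Pop h α (E i), Cop h α (E i)) ∧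
        deriv (deriv (e i)) 0 = (0, -Rop h α (E i)) := by
  set r := min δ ε
  have V := V₀.mono (lt_min V₀.pos hε) (min_le_left δ ε)
  have hsub : Ioo (-r) r ⊆ Ioo (-ε) ε :=
    Ioo_subset_Ioo (neg_le_neg (min_le_right _ _)) (min_le_right _ _)
  have hde : ∀ i, ∀ t ∈ Ioo (-r) r, HasDerivAt (e i) (deriv (e i) t) t := fun i t ht =>
    (((he.smooth i).contDiffAt (isOpen_Ioo.mem_nhds (hsub ht))).differentiableAt
      (by simp)).hasDerivAt
  have hdde : ∀ i, ∀ t ∈ Ioo (-r) r, HasDerivAt (deriv (e i)) (deriv (deriv (e i)) t) t :=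
    fun i t ht => ((((he.smooth i).deriv_of_isOpen (m := ∞) isOpen_Ioo (by simp)).contDiffAt
      (isOpen_Ioo.mem_nhds (hsub ht))).differentiableAt (by simp)).hasDerivAt
  have hda : ∀ i, ∀ t ∈ Ioo (-r) r, HasDerivAt (fun s => A s (e i s))
      (fderiv ℝ (hamVectorField h) (Φ t α) (A t (e i t)) + A t (deriv (e i) t)) t :=
    fun i t ht => (V.hasDerivAt t ht).clm_apply (hde i t ht)
  have hdb : ∀ i, ∀ t ∈ Ioo (-r) r, HasDerivAt (fun s => A s (deriv (e i) s))
      (fderiv ℝ (hamVectorField h) (Φ t α) (A t (deriv (e i) t)) + A t (deriv (deriv (e i)) t)) t :=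
    fun i t ht => (V.hasDerivAt t ht).clm_apply (hdde i t ht)
  have hvert : ∀ i, ∀ t ∈ Ioo (-r) r, (A t (e i t)).1 = 0 := fun i t ht => by
    have h1 := he.mem i t (hsub ht)
    rw [← V.fderiv_flow t ht]
    exact (mem_vertical_iff _).mp h1
  have hacc : ∀ i, ∀ t ∈ Ioo (-r) r, (A t (deriv (deriv (e i)) t)).1 = 0 := fun i t ht => by
    have h1 := he.accel_mem i t (hsub ht)
    rw [← V.fderiv_flow t ht]
    exact (mem_vertical_iff _).mp h1
  let E : Fin n → ℝ → Coord n := fun i t => (A t (e i t)).2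
  have hAe : ∀ i, ∀ t ∈ Ioo (-r) r, A t (e i t) = (0, E i t) := fun i t ht =>
    Prod.ext (hvert i t ht) rfl
  -- the base component of the velocity
  have hb1 : ∀ i, ∀ t ∈ Ioo (-r) r, (A t (deriv (e i) t)).1 = -Pop h (Φ t α) (E i t) := by
    intro i t ht
    have h1 : HasDerivAt (fun s => (A s (e i s)).1) 0 t :=
      (hasDerivAt_const t (0 : Coord n)).congr_of_eventuallyEq <| by
        filter_upwards [isOpen_Ioo.mem_nhds ht] with s hs using hvert i s hs
    have h2 := (hasDerivAt_fst (hda i t ht)).unique h1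
    rw [hAe i t ht, fderiv_hamVectorField_apply] at h2
    simp only [Prod.fst_add, map_zero, zero_add] at h2
    exact (neg_eq_of_add_eq_zero_right h2).symm
  have hdE : ∀ i, ∀ t ∈ Ioo (-r) r,
      HasDerivAt (E i) (Nop h (Φ t α) (E i t) + (A t (deriv (e i) t)).2) t := by
    intro i t ht
    have h1 := (hasDerivAt_snd (hda i t ht))
    rw [hAe i t ht, fderiv_hamVectorField_apply] at h1
    simpa only [Prod.snd_add, map_zero, sub_zero] using h1
  -- the fibre component of the velocity
  have hb2 : ∀ i, ∀ t ∈ Ioo (-r) r, (A t (deriv (e i) t)).2 = Cop h (Φ t α) (E i t) := by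
    intro i t ht
    have hz := V.mem t ht
    have h1 : HasDerivAt (fun s => (A s (deriv (e i) s)).1)
        (-(dPop h (Φ t α) (E i t)
          + Pop h (Φ t α) (Nop h (Φ t α) (E i t) + (A t (deriv (e i) t)).2))) t :=
      (((V.hasDerivAt_comp H H.contDiffOn_P ht).clm_apply (hdE i t ht)).fun_neg).congr_of_eventuallyEq
        <| by filter_upwards [isOpen_Ioo.mem_nhds ht] with s hs using hb1 i s hs
    have h2 := (hasDerivAt_fst (hdb i t ht)).unique h1
    have h3 : A t (deriv (e i) t) = (-Pop h (Φ t α) (E i t), (A t (deriv (e i) t)).2) :=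
      Prod.ext (hb1 i t ht) rfl
    rw [Prod.fst_add, hacc i t ht, add_zero, h3, fderiv_hamVectorField_apply] at h2
    simp only [map_neg, map_add] at h2
    apply H.P_injective hz
    have h4 : (2 : ℝ) • Pop h (Φ t α) (A t (deriv (e i) t)).2
        = (2 : ℝ) • Pop h (Φ t α) (Cop h (Φ t α) (E i t)) := by
      rw [H.two_smul_P_C hz, two_smul]
      have h5 := eq_add_of_neg_add_eq h2
      nth_rewrite 1 [h5]
      abel
    exact smul_right_injective _ (two_ne_zero : (2 : ℝ) ≠ 0) h4
  have h0 := V.zero_mem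
  refine ⟨fun i => E i 0, fun i j => ?_, fun i => ⟨?_, ?_, ?_⟩⟩
  · have h1 := he.darboux i j 0 (hsub h0)
    have h2 := hb1 i 0 h0
    have h3 := hAe j 0 h0
    rw [← V.symp_eq H h0, symp_eq_inner, h3, h2, inner_zero_right, zero_sub, inner_neg_left,
      neg_neg, V.flow_zero] at h1
    exact h1
  · simpa [V.zero] using hAe i 0 h0
  · have h1 := hb1 i 0 h0
    have h2 := hb2 i 0 h0
    rw [V.zero, V.flow_zero] at h1 h2
    exact Prod.ext h1 h2
  · have h1 : HasDerivAt (fun s => (A s (deriv (e i) s)).2)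
        (fderiv ℝ (Cop h) (Φ 0 α) (hamVectorField h (Φ 0 α)) (E i 0)
          + Cop h (Φ 0 α) (Nop h (Φ 0 α) (E i 0) + (A 0 (deriv (e i) 0)).2)) 0 :=
      ((V.hasDerivAt_comp H H.contDiffOn_C h0).clm_apply (hdE i 0 h0)).congr_of_eventuallyEq
        <| by filter_upwards [isOpen_Ioo.mem_nhds h0] with s hs using hb2 i s hs
    have h2 := (hasDerivAt_snd (hdb i 0 h0)).unique h1
    have h3 : A 0 (deriv (e i) 0) = (-Pop h (Φ 0 α) (E i 0), Cop h (Φ 0 α) (E i 0)) :=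
      Prod.ext (hb1 i 0 h0) (hb2 i 0 h0)
    have h4 := hacc i 0 h0
    rw [Prod.snd_add, h3, fderiv_hamVectorField_apply] at h2
    rw [V.zero] at h2 h4
    rw [V.flow_zero] at h2
    refine Prod.ext h4 ?_
    have h5 : (deriv (deriv (e i)) 0).2 = _ := eq_sub_of_add_eq' h2
    rw [h5]
    simp only [Rop, map_neg, map_add, add_apply, sub_apply,
      mul_apply_eq_comp]
    abel

end Frames

/-! ### Existence of flows and canonical frames -/

section Existence

variable {n : ℕ} {Ω : Set (Phase n)} {h : Phase n → ℝ}

theorem hamFlow_spec (H : IsConvexHamiltonian Ω h) {D : Set (Phase n)} (hD : Ω ⊆ D) {α : Phase n}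
    (hα : α ∈ Ω) : ∃ ε : ℝ, 0 < ε ∧ IsLocalFlow h D α ε (hamFlow h D α) := by
  have hex : ∃ Φ : ℝ → Phase n → Phase n, ∃ ε : ℝ, 0 < ε ∧ IsLocalFlow h D α ε Φ := by
    obtain ⟨Φ, ε, hε, W, hW, hc, hf⟩ := exists_continuous_localFlow
      (X := hamVectorField h) (α := α) (D := D)
      ((H.contDiffOn_X.contDiffAt (H.isOpen.mem_nhds hα)).of_le (by simp))
      (mem_of_superset (H.isOpen.mem_nhds hα) hD)
    exact ⟨Φ, ε, hε, W, hW, hc, hf⟩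
  rw [hamFlow, dif_pos hex]
  exact hex.choose_spec

/-- A positive definite symmetric operator admits an orthonormal basis for its quadratic form:
rescale an orthonormal basis of eigenvectors. -/
theorem exists_orthonormal_of_pos {T : Coord n →L[ℝ] Coord n}
    (hsymm : ∀ a b, inner ℝ (T a) b = inner ℝ a (T b)) (hpos : ∀ a, a ≠ 0 → 0 < inner ℝ (T a) a) :
    ∃ E : Fin n → Coord n, ∀ i j, inner ℝ (T (E i)) (E j) = if i = j then 1 else 0 := by
  have hT : (T : Coord n →ₗ[ℝ] Coord n).IsSymmetric := hsymm
  have hn : Module.finrank ℝ (Coord n) = n := finrank_euclideanSpace_fin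
  set b := hT.eigenvectorBasis hn
  set μ := hT.eigenvalues hn
  have hb : ∀ i, T (b i) = μ i • b i := fun i => hT.apply_eigenvectorBasis hn i
  have hμ : ∀ i, 0 < μ i := fun i => by
    have h1 := hpos (b i) (b.orthonormal.ne_zero i)
    rw [hb, inner_smul_left, b.inner_eq_one] at h1
    simpa using h1
  refine ⟨fun i => (Real.sqrt (μ i))⁻¹ • b i, fun i j => ?_⟩
  rw [map_smul, hb, inner_smul_left, inner_smul_left, inner_smul_right, b.inner_eq_ite]
  split_ifs with hij
  · subst hij
    have h1 := Real.mul_self_sqrt (hμ i).le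
    have h2 : Real.sqrt (μ i) ≠ 0 := (Real.sqrt_pos.mpr (hμ i)).ne'
    simp only [conj_trivial, mul_one]
    field_simp
    rw [sq, h1]
  · simp

/-- Existence of canonical frames: take an orthonormal frame of the vertical space at time `0`, let
it evolve by `E' = (C + N) E`, and pull it back by the linearized flow. -/
theorem IsVariation.exists_canonicalFrame (H : IsConvexHamiltonian Ω h)
    {Φ : ℝ → Phase n → Phase n} {α : Phase n} {δ : ℝ} {A : ℝ → Phase n →L[ℝ] Phase n}
    (V₀ : IsVariation h Ω Φ α δ A) :
    ∃ e : Fin n → ℝ → Phase n, ∃ ε : ℝ, 0 < ε ∧ IsCanonicalFrame Φ α ε e := by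
  have hα : α ∈ Ω := V₀.flow_zero ▸ V₀.mem 0 V₀.zero_mem
  obtain ⟨E₀, hE₀⟩ := exists_orthonormal_of_pos (H.P_symm hα) (H.pos α hα)
  obtain ⟨Y, δ₁, hδ₁, hY0, hY, hYs⟩ := exists_fundamental_solution_along H.isOpen H.contDiffOn_X
    (z := fun t => Φ t α) (V₀.mem 0 V₀.zero_mem)
    (Filter.eventually_of_mem (IsVariation.mem_nhds V₀.zero_mem) V₀.deriv_flow)
    (H.contDiffOn_C.add H.contDiffOn_N)
  have hunit : ∀ᶠ t in 𝓝 (0 : ℝ), IsUnit (A t) := by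
    have h1 : ContinuousAt A 0 := (V₀.hasDerivAt 0 V₀.zero_mem).continuousAt
    refine h1.eventually_mem (Units.isOpen.mem_nhds ?_)
    rw [mem_ofPred_eq, V₀.zero]
    exact isUnit_one
  obtain ⟨δ₂, hδ₂, hU⟩ := Metric.eventually_nhds_iff_ball.mp hunit
  rw [Real.ball_eq_Ioo, zero_sub, zero_add] at hU
  set r := min δ (min δ₁ δ₂)
  have hr : 0 < r := lt_min V₀.pos (lt_min hδ₁ hδ₂)
  have V := V₀.mono hr (min_le_left _ _)
  have hle₁ : r ≤ δ₁ := (min_le_right _ _).trans (min_le_left _ _)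
  have hle₂ : r ≤ δ₂ := (min_le_right _ _).trans (min_le_right _ _)
  have hsub₁ : Ioo (-r) r ⊆ Ioo (-δ₁) δ₁ := Ioo_subset_Ioo (neg_le_neg hle₁) hle₁
  have hsub₂ : Ioo (-r) r ⊆ Ioo (-δ₂) δ₂ := Ioo_subset_Ioo (neg_le_neg hle₂) hle₂
  let E : Fin n → ℝ → Coord n := fun i t => Y t (E₀ i)
  have hE : ∀ i, ∀ t ∈ Ioo (-r) r,
      HasDerivAt (E i) (Cop h (Φ t α) (E i t) + Nop h (Φ t α) (E i t)) t := fun i t ht => by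
    have h1 := (hY t (hsub₁ ht)).clm_apply (hasDerivAt_const t (E₀ i))
    simpa [E] using h1
  have hEs : ∀ i, ContDiffOn ℝ ∞ (E i) (Ioo (-r) r) := fun i =>
    (hYs.mono hsub₁).clm_apply contDiffOn_const
  let e : Fin n → ℝ → Phase n := fun i t => Ring.inverse (A t) (0, E i t)
  have hAe : ∀ i, ∀ t ∈ Ioo (-r) r, A t (e i t) = (0, E i t) := fun i t ht =>
    DFunLike.congr_fun (Ring.mul_inverse_cancel _ (hU t (hsub₂ ht))) (0, E i t)
  have hes : ∀ i, ContDiffOn ℝ ∞ (e i) (Ioo (-r) r) := fun i => by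
    refine ContDiffOn.clm_apply (f := fun t => Ring.inverse (A t)) (fun t ht => ?_)
      (contDiffOn_const.prodMk (hEs i))
    obtain ⟨u, hu⟩ := hU t (hsub₂ ht)
    have h1 := contDiffAt_ringInverse (n := ∞) ℝ u
    rw [hu] at h1
    exact (h1.comp t (V.contDiffOn.contDiffAt (isOpen_Ioo.mem_nhds ht))).contDiffWithinAt
  have hde : ∀ i, ∀ t ∈ Ioo (-r) r, HasDerivAt (e i) (deriv (e i) t) t := fun i t ht =>
    (((hes i).contDiffAt (isOpen_Ioo.mem_nhds ht)).differentiableAt (by simp)).hasDerivAt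
  have hdde : ∀ i, ∀ t ∈ Ioo (-r) r, HasDerivAt (deriv (e i)) (deriv (deriv (e i)) t) t :=
    fun i t ht => ((((hes i).deriv_of_isOpen (m := ∞) isOpen_Ioo (by simp)).contDiffAt
      (isOpen_Ioo.mem_nhds ht)).differentiableAt (by simp)).hasDerivAt
  have hAde : ∀ i, ∀ t ∈ Ioo (-r) r, A t (deriv (e i) t)
      = (-Pop h (Φ t α) (E i t), Cop h (Φ t α) (E i t)) := by
    intro i t ht
    have h1 := (V.hasDerivAt t ht).clm_apply (hde i t ht)
    have h2 := ((hasDerivAt_const t (0 : Coord n)).prodMk (hE i t ht)).congr_of_eventuallyEq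
      (f₁ := fun s => A s (e i s))
      (by filter_upwards [isOpen_Ioo.mem_nhds ht] with s hs using hAe i s hs)
    have h3 := h1.unique h2
    rw [ContinuousLinearMap.comp_apply, hAe i t ht, fderiv_hamVectorField_apply] at h3
    rw [eq_sub_of_add_eq' h3]
    simp
  -- `E` stays orthonormal for the fibre Hessian
  have horth : ∀ i j, ∀ t ∈ Ioo (-r) r,
      inner ℝ (Pop h (Φ t α) (E i t)) (E j t) = if i = j then 1 else 0 := by
    intro i j t ht
    have hd : ∀ s ∈ Ioo (-r) r,
        HasDerivAt (fun s => inner ℝ (Pop h (Φ s α) (E i s)) (E j s)) 0 s := by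
      intro s hs
      have hz := V.mem s hs
      have h1 := (((V.hasDerivAt_comp H H.contDiffOn_P hs).clm_apply (hE i s hs)).inner ℝ
        (hE j s hs))
      refine h1.congr_deriv ?_
      have h2 := congrArg (fun x => inner ℝ x (E j s)) (H.two_smul_P_C hz (E i s))
      have h3 := H.PC_symm hz (E i s) (E j s)
      have h4 := H.P_symm hz (E i s) (Cop h (Φ s α) (E j s))
      have h5 := H.N_adjoint hz (E j s) (Pop h (Φ s α) (E i s))
      rw [real_inner_comm, real_inner_comm _ (E j s)] at h5
      simp only [inner_smul_left, inner_sub_left, inner_add_left, inner_neg_left,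
        conj_trivial] at h2
      simp only [map_add, inner_add_left, inner_add_right]
      change _ + _ + (inner ℝ (dPop h (Φ s α) (E i s)) (E j s) + _) = 0
      linear_combination h4 + h3.symm + h5 + h2
    have h1 := isOpen_Ioo.is_const_of_deriv_eq_zero isPreconnected_Ioo
      (fun s hs => (hd s hs).differentiableAt.differentiableWithinAt)
      (fun s hs => (hd s hs).deriv) ht V.zero_mem
    rw [h1]
    simpa [E, hY0, V.flow_zero] using hE₀ i j
  refine ⟨e, r, hr, hes, fun i t ht => ?_, fun i j t ht => ?_, fun i t ht => ?_⟩
  · rw [jacobiCurve, V.fderiv_flow t ht]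
    exact (mem_vertical_iff _).mpr (congrArg Prod.fst (hAe i t ht))
  · rw [← V.symp_eq H ht, hAde i t ht, hAe j t ht, symp_eq_inner, inner_zero_right, zero_sub,
      inner_neg_left, neg_neg]
    exact horth i j t ht
  · rw [jacobiCurve, V.fderiv_flow t ht]
    refine (mem_vertical_iff _).mpr ?_
    have hz := V.mem t ht
    have h1 := (V.hasDerivAt t ht).clm_apply (hdde i t ht)
    have h2 := ((V.hasDerivAt_comp H H.contDiffOn_P ht).clm_apply (hE i t ht)).fun_neg
    have h3 := h2.congr_of_eventuallyEq (f₁ := fun s => (A s (deriv (e i) s)).1)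
      (by filter_upwards [isOpen_Ioo.mem_nhds ht] with s hs using congrArg Prod.fst (hAde i s hs))
    have h4 := (hasDerivAt_fst h1).unique h3
    rw [ContinuousLinearMap.comp_apply, hAde i t ht, fderiv_hamVectorField_apply,
      Prod.fst_add] at h4
    have h5 : (A t (deriv (deriv (e i)) t)).1 = _ := eq_sub_of_add_eq' h4
    have h6 := H.two_smul_P_C hz (E i t)
    change (A t (deriv (deriv (e i)) t)).1 = 0
    rw [h5]
    change -(dPop h (Φ t α) (E i t) + _) - _ = 0
    simp only [map_neg, map_add]
    rw [two_smul] at h6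
    have h7 : dPop h (Φ t α) (E i t) = Qop h (Φ t α) (Pop h (Φ t α) (E i t))
        - Pop h (Φ t α) (Nop h (Φ t α) (E i t)) - (Pop h (Φ t α) (Cop h (Φ t α) (E i t))
          + Pop h (Φ t α) (Cop h (Φ t α) (E i t))) := by rw [h6]; abel
    rw [h7]
    abel

/-- The linearization of the chosen flow and the values of the chosen canonical frame. -/
theorem exists_frame_values (H : IsConvexHamiltonian Ω h) {D : Set (Phase n)} (hD : Ω ⊆ D)
    {α : Phase n} (hα : α ∈ Ω) :
    ∃ δ A, IsVariation h Ω (hamFlow h D α) α δ A ∧ ∃ E : Fin n → Coord n,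
      (∀ i j, inner ℝ (Pop h α (E i)) (E j) = if i = j then 1 else 0) ∧
      ∀ i, canonicalFrame h D α i 0 = (0, E i) ∧
        deriv (canonicalFrame h D α i) 0 = (-Pop h α (E i), Cop h α (E i)) ∧
        deriv (deriv (canonicalFrame h D α i)) 0 = (0, -Rop h α (E i)) := by
  obtain ⟨ε, hε, hf⟩ := hamFlow_spec H hD hα
  obtain ⟨δ, A, V⟩ := exists_isVariation H hα hε hf
  refine ⟨δ, A, V, ?_⟩
  have hex := V.exists_canonicalFrame H
  rw [canonicalFrame, dif_pos hex]
  obtain ⟨ε', hε', hF⟩ := hex.choose_spec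
  exact hF.exists_values H V hε'

end Existence

/-! ### Traces and determinants -/

section Trace

variable {n : ℕ}

/-- The trace of an operator on the coordinate space. -/
noncomputable def tr (T : Coord n →L[ℝ] Coord n) : ℝ :=
  LinearMap.trace ℝ (Coord n) (T : Coord n →ₗ[ℝ] Coord n)

/-- The matrix of an operator on the coordinate space. -/
noncomputable def mat (T : Coord n →L[ℝ] Coord n) : Matrix (Fin n) (Fin n) ℝ :=
  Matrix.of fun i j => T (baseDir j) i

theorem mat_eq_toMatrix (T : Coord n →L[ℝ] Coord n) :
    mat T = LinearMap.toMatrix (EuclideanSpace.basisFun (Fin n) ℝ).toBasis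
      (EuclideanSpace.basisFun (Fin n) ℝ).toBasis (T : Coord n →ₗ[ℝ] Coord n) := by
  ext i j
  simp [mat, LinearMap.toMatrix_apply, baseDir]

theorem tr_eq_trace_mat (T : Coord n →L[ℝ] Coord n) : tr T = (mat T).trace := by
  rw [tr, mat_eq_toMatrix,
    LinearMap.trace_eq_matrix_trace ℝ (EuclideanSpace.basisFun (Fin n) ℝ).toBasis]

theorem tr_eq_sum (T : Coord n →L[ℝ] Coord n) : tr T = ∑ i, T (baseDir i) i := by
  rw [tr_eq_trace_mat]; rfl

theorem mat_mul (T R : Coord n →L[ℝ] Coord n) : mat (T * R) = mat T * mat R := by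
  rw [mat_eq_toMatrix, mat_eq_toMatrix, mat_eq_toMatrix, ← LinearMap.toMatrix_mul]
  rfl

theorem tr_mul_comm (T R : Coord n →L[ℝ] Coord n) : tr (T * R) = tr (R * T) := by
  rw [tr_eq_trace_mat, tr_eq_trace_mat, mat_mul, mat_mul, Matrix.trace_mul_comm]

theorem tr_add (T R : Coord n →L[ℝ] Coord n) : tr (T + R) = tr T + tr R := by
  simp [tr_eq_sum, Finset.sum_add_distrib]

theorem tr_sub (T R : Coord n →L[ℝ] Coord n) : tr (T - R) = tr T - tr R := by
  simp [tr_eq_sum, Finset.sum_sub_distrib]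

theorem tr_neg (T : Coord n →L[ℝ] Coord n) : tr (-T) = -tr T := by
  simp [tr_eq_sum]

theorem tr_smul (c : ℝ) (T : Coord n →L[ℝ] Coord n) : tr (c • T) = c * tr T := by
  simp [tr_eq_sum, Finset.mul_sum]

/-- The trace as a continuous linear functional. -/
noncomputable def trL : (Coord n →L[ℝ] Coord n) →L[ℝ] ℝ :=
  LinearMap.toContinuousLinearMap
    { toFun := tr, map_add' := tr_add, map_smul' := fun c T => by simp [tr_smul] }

theorem trL_apply (T : Coord n →L[ℝ] Coord n) : trL T = tr T := rfl

/-- Jacobi's formula: the logarithmic derivative of the determinant is the trace of `A⁻¹ A'`. -/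
theorem hasDerivAt_det {A : ℝ → Matrix (Fin n) (Fin n) ℝ}
    {A' M : Matrix (Fin n) (Fin n) ℝ} {t : ℝ}
    (hA : ∀ i j, HasDerivAt (fun s => A s i j) (A' i j) t) (hM : A' = A t * M) :
    HasDerivAt (fun s => (A s).det) ((A t).det * M.trace) t := by
  have h1 : HasDerivAt (fun s => (A s).det)
      (∑ σ : Equiv.Perm (Fin n), ((Equiv.Perm.sign σ : ℤ) : ℝ) *
        ∑ i, (∏ j ∈ Finset.univ.erase i, A t (σ j) j) * A' (σ i) i) t := by
    simp only [Matrix.det_apply']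
    refine HasDerivAt.fun_sum fun σ _ => HasDerivAt.const_mul _ ?_
    have := HasDerivAt.fun_finsetProd (u := Finset.univ) (f := fun j s => A s (σ j) j)
      (f' := fun j => A' (σ j) j) (x := t) fun j _ => hA (σ j) j
    simpa only [smul_eq_mul] using this
  refine h1.congr_deriv ?_
  have h2 : ∀ i, ((A t).updateCol i fun k => A' k i).det = ∑ σ : Equiv.Perm (Fin n),
      ((Equiv.Perm.sign σ : ℤ) : ℝ) * ((∏ j ∈ Finset.univ.erase i, A t (σ j) j) * A' (σ i) i) := by
    intro i
    rw [Matrix.det_apply']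
    refine Finset.sum_congr rfl fun σ _ => ?_
    congr 1
    rw [← Finset.prod_erase_mul _ _ (Finset.mem_univ i), Matrix.updateCol_self]
    congr 1
    refine Finset.prod_congr rfl fun j hj => ?_
    rw [Matrix.updateCol_ne (Finset.ne_of_mem_erase hj)]
  simp only [Finset.mul_sum]
  rw [Finset.sum_comm]
  simp only [← h2, ← Matrix.cramer_apply, Matrix.cramer_eq_adjugate_mulVec]
  have h3 : (A t).adjugate * A' = (A t).det • M := by
    rw [hM, ← Matrix.mul_assoc, Matrix.adjugate_mul, Matrix.smul_mul, Matrix.one_mul]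
  have h4 : ∀ i, ((A t).adjugate.mulVec fun k => A' k i) i = ((A t).adjugate * A') i i :=
    fun i => rfl
  simp only [h4, h3, Matrix.smul_apply, smul_eq_mul, ← Finset.mul_sum]
  rfl

end Trace

/-! ### Ricci curvature and the Hessian in terms of a canonical frame -/

section Curvature

variable {n : ℕ}

/-- A family that is orthonormal for a positive form on `Coord n` is a basis; its dual basis is
given by the form. -/
theorem exists_basis_of_orthonormal {P : Coord n →L[ℝ] Coord n} {E : Fin n → Coord n}
    (hE : ∀ i j, inner ℝ (P (E i)) (E j) = if i = j then (1 : ℝ) else 0) :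
    ∃ b : Module.Basis (Fin n) ℝ (Coord n), (∀ i, b i = E i) ∧
      ∀ x i, b.repr x i = inner ℝ (P (E i)) x := by
  have hsum : ∀ (c : Fin n → ℝ) (i : Fin n), inner ℝ (P (E i)) (∑ j, c j • E j) = c i := by
    intro c i
    rw [inner_sum]
    simp [inner_smul_right, hE]
  have hli : LinearIndependent ℝ E := by
    rw [Fintype.linearIndependent_iff]
    intro c hc i
    rw [← hsum c i, hc, inner_zero_right]
  have hcard : Fintype.card (Fin n) = Module.finrank ℝ (Coord n) := by simp
  rcases n.eq_zero_or_pos with rfl | hn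
  · exact ⟨(EuclideanSpace.basisFun (Fin 0) ℝ).toBasis, fun i => i.elim0, fun _ i => i.elim0⟩
  have : Nonempty (Fin n) := ⟨⟨0, hn⟩⟩
  let b := basisOfLinearIndependentOfCardEqFinrank hli hcard
  have hb : ∀ i, b i = E i := fun i => by
    simp [b, coe_basisOfLinearIndependentOfCardEqFinrank]
  refine ⟨b, hb, fun x i => ?_⟩
  conv_rhs => rw [← b.sum_repr x]
  simp only [hb]
  rw [hsum]

/-- The trace computed in a basis that is orthonormal for a positive form. -/
theorem tr_eq_sum_of_orthonormal {P : Coord n →L[ℝ] Coord n} {E : Fin n → Coord n}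
    (hE : ∀ i j, inner ℝ (P (E i)) (E j) = if i = j then (1 : ℝ) else 0)
    (T : Coord n →L[ℝ] Coord n) : tr T = ∑ i, inner ℝ (P (E i)) (T (E i)) := by
  obtain ⟨b, hb, hrepr⟩ := exists_basis_of_orthonormal hE
  rw [tr, LinearMap.trace_eq_matrix_trace ℝ b, Matrix.trace]
  refine Finset.sum_congr rfl fun i _ => ?_
  rw [Matrix.diag_apply, LinearMap.toMatrix_apply, hrepr, hb]
  rfl

/-- A subspace that consists of the vectors with vanishing base part, such as the vertical space,
is identified with the coordinate space. -/
noncomputable def verticalEquiv {J : Submodule ℝ (Phase n)} (hJ : ∀ z, z ∈ J ↔ z.1 = 0) :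
    Coord n ≃ₗ[ℝ] J where
  toFun ζ := ⟨(0, ζ), (hJ _).mpr rfl⟩
  map_add' a b := by ext i <;> simp
  map_smul' c a := by ext i <;> simp
  invFun z := (z : Phase n).2
  left_inv ζ := rfl
  right_inv z := Subtype.ext (Prod.ext ((hJ _).mp z.2).symm rfl)

/-- The trace of an operator on the vertical space, prescribed on a frame. -/
theorem trace_eq_of_frame {J : Submodule ℝ (Phase n)} (hJ : ∀ z, z ∈ J ↔ z.1 = 0)
    {P T : Coord n →L[ℝ] Coord n} {E : Fin n → Coord n}
    (hE : ∀ i j, inner ℝ (P (E i)) (E j) = if i = j then (1 : ℝ) else 0) (R : J →ₗ[ℝ] J)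
    (hR : ∀ i (v : J), (v : Phase n) = (0, E i) → (R v : Phase n) = (0, T (E i))) :
    LinearMap.trace ℝ J R = tr T := by
  obtain ⟨b, hb, -⟩ := exists_basis_of_orthonormal hE
  have h1 : R = (verticalEquiv hJ).conj (T : Coord n →ₗ[ℝ] Coord n) := by
    refine (b.map (verticalEquiv hJ)).ext fun i => ?_
    rw [Module.Basis.map_apply, hb, LinearEquiv.conj_apply_apply, LinearEquiv.symm_apply_apply]
    exact Subtype.ext (hR i _ rfl)
  rw [h1, LinearMap.trace_conj', tr]

variable {Ω : Set (Phase n)} {h : Phase n → ℝ}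

/-- The Ricci curvature is the trace of `Rop`. -/
theorem ricci_eq_tr (H : IsConvexHamiltonian Ω h) {D : Set (Phase n)} (hD : Ω ⊆ D)
    {α : Phase n} (hα : α ∈ Ω) (hα2 : α.2 ≠ 0) : ricci h D α = tr (Rop h α) := by
  obtain ⟨δ, A, V, E, hE, hval⟩ := exists_frame_values H hD hα
  have hJ : ∀ z, z ∈ jacobiCurve (hamFlow h D α) α 0 ↔ z.1 = 0 := by
    intro z
    rw [jacobiCurve, V.fderiv_flow 0 V.zero_mem, V.zero]
    exact mem_vertical_iff z
  rw [ricci, if_neg hα2]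
  have hex : ∃ R : jacobiCurve (hamFlow h D α) α 0 →ₗ[ℝ] jacobiCurve (hamFlow h D α) α 0,
      ∀ (i : Fin n) (v : jacobiCurve (hamFlow h D α) α 0),
        (v : Phase n) = canonicalFrame h D α i 0 →
          (R v : Phase n) = -deriv (deriv (canonicalFrame h D α i)) 0 := by
    refine ⟨(verticalEquiv hJ).conj (Rop h α : Coord n →ₗ[ℝ] Coord n), fun i v hv => ?_⟩
    rw [(hval i).1] at hv
    have h1 : v = verticalEquiv hJ (E i) := Subtype.ext hv
    rw [h1, LinearEquiv.conj_apply_apply, LinearEquiv.symm_apply_apply, (hval i).2.2]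
    refine Prod.ext ?_ ?_
    · simp [verticalEquiv]
    · simp [verticalEquiv]
  rw [curvatureOperator, dif_pos hex]
  refine trace_eq_of_frame hJ hE _ fun i v hv => ?_
  rw [hex.choose_spec i v (by rw [hv, (hval i).1]), (hval i).2.2]
  simp

/-- The Hessian of a function, as an operator: the derivative of its coordinate differential. -/
noncomputable def Uop (w : Coord n → ℝ) (q : Coord n) : Coord n →L[ℝ] Coord n :=
  fderiv ℝ (fun y => (dPoint w y).2) q

theorem partialBase_partialBase {w : Coord n → ℝ} {q : Coord n} (hw : ContDiffAt ℝ ∞ w q)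
    (i j : Fin n) : partialBase (partialBase w j) i q = Uop w q (baseDir i) j := by
  have h1 : DifferentiableAt ℝ (fun y => (dPoint w y).2) q := by
    refine differentiableAt_euclidean.mpr fun k => ?_
    exact ((hw.fderiv_right (m := ∞) (by simp)).clm_apply contDiffAt_const).differentiableAt
      (by simp)
  have h2 : HasFDerivAt (partialBase w j) ((EuclideanSpace.proj j).comp (Uop w q)) q :=
    (EuclideanSpace.proj (𝕜 := ℝ) j).hasFDerivAt.comp q h1.hasFDerivAt
  rw [partialBase, h2.fderiv]
  rfl

/-- The image of `d(dw)` is the graph of the Hessian operator. -/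
theorem mem_graphSpace_iff {w : Coord n → ℝ} {q : Coord n} (hw : ContDiffAt ℝ ∞ w q)
    (z : Phase n) : z ∈ graphSpace w q ↔ z.2 = Uop w q z.1 := by
  have hgen : ∀ i : Fin n, dirX i + ∑ j, partialBase (partialBase w j) i q • (dirA j : Phase n)
      = (baseDir i, Uop w q (baseDir i)) := by
    intro i
    conv_rhs => rw [coord_eq_sum (Uop w q (baseDir i))]
    simp only [partialBase_partialBase hw]
    refine Prod.ext ?_ ?_
    · simp [dirX, dirA, baseDir, Prod.fst_sum]
    · simp [dirX, dirA, baseDir, Prod.snd_sum]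
  have hspan : graphSpace w q
      = Submodule.span ℝ (range fun i => (baseDir i, Uop w q (baseDir i))) := by
    rw [graphSpace]
    simp only [hgen]
  rw [hspan]
  constructor
  · intro hz
    induction hz using Submodule.span_induction with
    | mem x hx => obtain ⟨i, rfl⟩ := hx; rfl
    | zero => simp
    | add x y _ _ hx hy => rw [Prod.snd_add, Prod.fst_add, hx, hy, map_add]
    | smul c x _ hx => rw [Prod.smul_snd, Prod.smul_fst, hx, map_smul]
  · intro hz
    have h1 : z = ∑ i, z.1 i • ((baseDir i, Uop w q (baseDir i)) : Phase n) := by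
      refine Prod.ext ?_ ?_
      · rw [Prod.fst_sum]
        exact coord_eq_sum z.1
      · rw [Prod.snd_sum, hz]
        conv_lhs => rw [coord_eq_sum z.1]
        simp
    rw [h1]
    exact Submodule.sum_mem _ fun i _ => Submodule.smul_mem _ _ (Submodule.subset_span ⟨i, rfl⟩)

/-- The Hessian when the horizontal space projects onto the base: a vector `(a, b)` is mapped to
`(0, b - U a)`. -/
theorem hessian_apply {w : Coord n → ℝ} {q : Coord n} (hw : ContDiffAt ℝ ∞ w q)
    {e : Fin n → ℝ → Phase n} (hsurj : ∀ y, ∃ v ∈ horizontal e, v.1 = y) (v : horizontal e) :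
    (hessian e w q v : Phase n) = (0, (v : Phase n).2 - Uop w q (v : Phase n).1) := by
  let T : horizontal e →ₗ[ℝ] vertical n :=
    { toFun := fun v =>
        ⟨(0, Uop w q (v : Phase n).1 - (v : Phase n).2), (mem_vertical_iff _).mpr rfl⟩
      map_add' := fun a b => by
        refine Subtype.ext (Prod.ext ?_ ?_)
        · simp
        · simp only [Submodule.coe_add, Prod.snd_add, Prod.fst_add, map_add]
          exact add_sub_add_comm _ _ _ _
      map_smul' := fun c a => by
        refine Subtype.ext (Prod.ext ?_ ?_)
        · simp
        · simp [smul_sub] }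
  have hex : ∃ T : horizontal e →ₗ[ℝ] vertical n, ∀ z : Phase n,
      z ∈ graphSpace w q ↔ ∃ v : horizontal e, z = (v : Phase n) + (T v : Phase n) := by
    refine ⟨T, fun z => ?_⟩
    rw [mem_graphSpace_iff hw]
    constructor
    · intro hz
      obtain ⟨v, hv, hvz⟩ := hsurj z.1
      refine ⟨⟨v, hv⟩, Prod.ext ?_ ?_⟩
      · simp [T, hvz]
      · simp [T, hvz, hz]
    · rintro ⟨v, rfl⟩
      simp [T]
  rw [hessian, dif_pos hex]
  have h1 := (mem_graphSpace_iff hw _).mp ((hex.choose_spec _).mpr ⟨v, rfl⟩)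
  have h2 : (hex.choose v : Phase n).1 = 0 := (mem_vertical_iff _).mp (hex.choose v).2
  rw [Prod.snd_add, Prod.fst_add, h2, add_zero] at h1
  rw [LinearMap.neg_apply, Submodule.coe_neg]
  refine Prod.ext ?_ ?_
  · rw [Prod.fst_neg, h2, neg_zero]
  · rw [Prod.snd_neg, eq_sub_of_add_eq' h1, neg_sub]

theorem vertInner_eq (H : IsConvexHamiltonian Ω h) {α : Phase n} (hα : α ∈ Ω) (ξ ζ : Phase n) :
    vertInner h α ξ ζ = inner ℝ (Pop h α ζ.2) ξ.2 := by
  have h1 : ∀ i, Pop h α ζ.2 i = ∑ j, partialAA h i j α * ζ.2 j := by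
    intro i
    conv_lhs => rw [coord_eq_sum ζ.2]
    simp only [map_sum, map_smul, WithLp.ofLp_sum, Finset.sum_apply, PiLp.smul_apply, smul_eq_mul]
    refine Finset.sum_congr rfl fun j _ => ?_
    rw [partialAA_eq_inner H.isOpen H.contDiffOn hα, mul_comm]
    rfl
  rw [vertInner, PiLp.inner_apply]
  refine Finset.sum_congr rfl fun i _ => ?_
  rw [h1 i, RCLike.inner_apply, conj_trivial, Finset.mul_sum]
  refine Finset.sum_congr rfl fun j _ => ?_
  ring

/-- The Hessian `K = U P + C` as an operator on the fibre coordinates of the vertical space: it sends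
the velocity `(-P E, C E)` of a canonical frame to `(0, K E)`. -/
noncomputable def Kop (h : Phase n → ℝ) (w : Coord n → ℝ) (q : Coord n) : Coord n →L[ℝ] Coord n :=
  Uop w q * Pop h (dPoint w q) + Cop h (dPoint w q)

theorem Uop_symm {w : Coord n → ℝ} {q : Coord n} (hw : ContDiffAt ℝ ∞ w q) (a b : Coord n) :
    inner ℝ (Uop w q a) b = inner ℝ a (Uop w q b) := by
  have hs : ∀ i j, Uop w q (baseDir i) j = Uop w q (baseDir j) i := by
    intro i j
    rw [← partialBase_partialBase hw, ← partialBase_partialBase hw]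
    have hd := (hw.fderiv_right (m := ∞) (by simp)).differentiableAt (by simp)
    have h1 : ∀ k l, partialBase (partialBase w k) l q
        = fderiv ℝ (fderiv ℝ w) q (baseDir l) (baseDir k) := by
      intro k l
      have := hd.hasFDerivAt.clm_apply (hasFDerivAt_const (baseDir k) q)
      rw [partialBase]
      change fderiv ℝ (fun y => fderiv ℝ w y (baseDir k)) q _ = _
      rw [this.fderiv]
      simp
    rw [h1, h1]
    exact hw.isSymmSndFDerivAt
      (by rw [minSmoothness_of_isRCLikeNormedField]; exact ENat.LEInfty.out) _ _
  have hU : ∀ (a : Coord n) j, Uop w q a j = ∑ i, a i * Uop w q (baseDir i) j := by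
    intro a j
    conv_lhs => rw [coord_eq_sum a]
    simp [WithLp.ofLp_sum, Finset.sum_apply]
  have hexp : ∀ a b, inner ℝ (Uop w q a) b = ∑ j, ∑ i, a i * b j * Uop w q (baseDir i) j := by
    intro a b
    rw [PiLp.inner_apply]
    refine Finset.sum_congr rfl fun j _ => ?_
    rw [RCLike.inner_apply, conj_trivial, hU, Finset.mul_sum]
    exact Finset.sum_congr rfl fun i _ => by ring
  rw [real_inner_comm _ a, hexp, hexp, Finset.sum_comm]
  refine Finset.sum_congr rfl fun i _ => Finset.sum_congr rfl fun j _ => ?_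
  rw [hs]
  ring

theorem PK_symm (H : IsConvexHamiltonian Ω h) {w : Coord n → ℝ} {q : Coord n}
    (hw : ContDiffAt ℝ ∞ w q) (hα : dPoint w q ∈ Ω) (a b : Coord n) :
    inner ℝ (Pop h (dPoint w q) (Kop h w q a)) b
      = inner ℝ a (Pop h (dPoint w q) (Kop h w q b)) := by
  simp only [Kop, add_apply, mul_apply_eq_comp, map_add, inner_add_left, inner_add_right]
  rw [H.PC_symm hα, H.P_symm hα, Uop_symm hw, H.P_symm hα]

/-- The Hilbert–Schmidt norm of the Hessian is `tr K²`, and it dominates `(tr K)² / n`. -/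
theorem hessianHSNormSq_eq (H : IsConvexHamiltonian Ω h) {D : Set (Phase n)} (hD : Ω ⊆ D)
    {w : Coord n → ℝ} {q : Coord n} (hw : ContDiffAt ℝ ∞ w q) (hα : dPoint w q ∈ Ω) :
    hessianHSNormSq h D w q = tr (Kop h w q * Kop h w q) ∧
      tr (Kop h w q) ^ 2 ≤ n * hessianHSNormSq h D w q := by
  obtain ⟨δ, A, V, E, hE, hval⟩ := exists_frame_values H hD hα
  set α := dPoint w q
  set e := canonicalFrame h D α with he
  -- the velocities `(-P E, C E)` project onto a basis of the base directions
  have hsurj : ∀ y, ∃ v ∈ horizontal e, v.1 = y := by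
    intro y
    obtain ⟨b, hb, -⟩ := exists_basis_of_orthonormal hE
    have h1 : Pop h α (Ring.inverse (Pop h α) (-y)) = -y :=
      DFunLike.congr_fun (Ring.mul_inverse_cancel _ (H.isUnit_P hα)) (-y)
    set c := b.repr (Ring.inverse (Pop h α) (-y))
    refine ⟨∑ i, c i • deriv (e i) 0, Submodule.sum_mem _ fun i _ => Submodule.smul_mem _ _
      (Submodule.subset_span ⟨i, rfl⟩), ?_⟩
    rw [Prod.fst_sum]
    simp only [Prod.smul_fst, (hval _).2.1, smul_neg, Finset.sum_neg_distrib, ← map_smul, ← map_sum]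
    rw [show ∑ i, c i • E i = Ring.inverse (Pop h α) (-y) by
      rw [← b.sum_repr (Ring.inverse (Pop h α) (-y))]; simp only [hb, c], h1, neg_neg]
  have hHS : hessianHSNormSq h D w q
      = ∑ i, inner ℝ (Pop h α (Kop h w q (E i))) (Kop h w q (E i)) := by
    rw [hessianHSNormSq]
    refine Finset.sum_congr rfl fun i _ => ?_
    change vertInner h α (hessian e w q ⟨deriv (e i) 0, _⟩ : Phase n)
      (hessian e w q ⟨deriv (e i) 0, _⟩ : Phase n) = _
    rw [vertInner_eq H hα, hessian_apply hw hsurj]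
    simp only [(hval i).2.1, map_neg, sub_neg_eq_add]
    rw [add_comm]
    rfl
  have hsq : ∀ i, inner ℝ (Pop h α (Kop h w q (E i))) (Kop h w q (E i))
      = inner ℝ (Pop h α (E i)) ((Kop h w q * Kop h w q) (E i)) := by
    intro i
    rw [PK_symm H hw hα, mul_apply_eq_comp, H.P_symm hα]
  constructor
  · rw [hHS, tr_eq_sum_of_orthonormal hE]
    exact Finset.sum_congr rfl fun i _ => hsq i
  · rw [hHS, tr_eq_sum_of_orthonormal hE]
    -- Cauchy–Schwarz, first for the sum and then for the form `P` on each term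
    have h1 : ∀ i, inner ℝ (Pop h α (E i)) (Kop h w q (E i)) ^ 2
        ≤ inner ℝ (Pop h α (Kop h w q (E i))) (Kop h w q (E i)) := by
      intro i
      set k := Kop h w q (E i)
      set c := inner ℝ (Pop h α (E i)) k
      have h2 : 0 ≤ inner ℝ (Pop h α (k - c • E i)) (k - c • E i) := by
        rcases eq_or_ne (k - c • E i) 0 with h0 | h0
        · rw [h0, inner_zero_right]
        · exact (H.pos α hα _ h0).le
      have h3 := hE i i
      rw [if_pos rfl] at h3
      have h4 : inner ℝ (Pop h α k) (E i) = c := by rw [H.P_symm hα, real_inner_comm]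
      simp only [map_sub, map_smul, inner_sub_left, inner_sub_right, inner_smul_left,
        inner_smul_right, conj_trivial, h3, h4] at h2
      have h5 : inner ℝ (Pop h α (E i)) k = c := rfl
      rw [h5] at h2
      nlinarith
    calc _ ≤ (n : ℝ) * ∑ i, inner ℝ (Pop h α (E i)) (Kop h w q (E i)) ^ 2 := by
          simpa using sq_sum_le_card_mul_sum_sq (s := (Finset.univ : Finset (Fin n)))
            (f := fun i => inner ℝ (Pop h α (E i)) (Kop h w q (E i)))
      _ ≤ _ := by gcongr with i; exact h1 i

end Curvature

/-! ### The weight along a trajectory -/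

section Weight

variable {n : ℕ} {Ω : Set (Phase n)} {h : Phase n → ℝ}

theorem tr_eq_sum_inner (T : Coord n →L[ℝ] Coord n) :
    tr T = ∑ i, inner ℝ (T (baseDir i)) (baseDir i) := by
  rw [tr_eq_sum]
  refine Finset.sum_congr rfl fun i _ => ?_
  simp [baseDir, EuclideanSpace.inner_single_right]

theorem tr_N (H : IsConvexHamiltonian Ω h) {z : Phase n} (hz : z ∈ Ω) :
    tr (Nop h z) = -tr (Qop h z) := by
  rw [tr_eq_sum_inner, tr_eq_sum_inner, ← Finset.sum_neg_distrib]
  refine Finset.sum_congr rfl fun i _ => ?_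
  rw [H.N_adjoint hz, real_inner_comm]

theorem det_mat_P_pos (H : IsConvexHamiltonian Ω h) {z : Phase n} (hz : z ∈ Ω) :
    0 < (mat (Pop h z)).det := by
  have hmul : ∀ x : Fin n → ℝ, (mat (Pop h z)).mulVec x = Pop h z (WithLp.toLp 2 x) := by
    intro x
    ext i
    conv_rhs => rw [coord_eq_sum (WithLp.toLp 2 x)]
    simp [Matrix.mulVec, dotProduct, mat, WithLp.ofLp_sum, Finset.sum_apply, mul_comm]
  refine Matrix.PosDef.det_pos (Matrix.PosDef.of_dotProduct_mulVec_pos ?_ ?_)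
  · ext i j
    have := H.P_symm hz (baseDir i) (baseDir j)
    simpa [mat, baseDir, EuclideanSpace.inner_single_right, EuclideanSpace.inner_single_left]
      using this
  · intro x hx
    have hx' : (WithLp.toLp 2 x : Coord n) ≠ 0 := fun h0 => hx (by
      have := congrArg WithLp.ofLp h0; simpa using this)
    have := H.pos z hz _ hx'
    rw [PiLp.inner_apply] at this
    simpa [dotProduct, hmul] using this

/-- The derivative of `ψ` along the Hamiltonian flow, as a function on phase space. -/
noncomputable def psiRate (h : Phase n → ℝ) (ς : Coord n → ℝ) (z : Phase n) : ℝ :=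
  tr (Cop h z) + fderiv ℝ ς z.1 (hamVectorField h z).1 - tr (Qop h z)

theorem contDiffOn_fderiv_weight (H : IsConvexHamiltonian Ω h) {U : Set (Coord n)} (hU : IsOpen U)
    {ς : Coord n → ℝ} (hς : ContDiffOn ℝ ∞ ς U) (hΩU : ∀ z ∈ Ω, z.1 ∈ U) :
    ContDiffOn ℝ ∞ (fun z : Phase n => fderiv ℝ ς z.1 (hamVectorField h z).1) Ω :=
  ((hς.fderiv_of_isOpen hU (by simp)).comp contDiffOn_fst hΩU).clm_apply
    (contDiff_fst.comp_contDiffOn H.contDiffOn_X)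

/-- The derivative of `log det H_{αα}` along the flow, from Jacobi's formula. -/
theorem hasDerivAt_log_det_P (H : IsConvexHamiltonian Ω h) {Φ : ℝ → Phase n → Phase n}
    {α : Phase n} {δ : ℝ} {A : ℝ → Phase n →L[ℝ] Phase n} (V : IsVariation h Ω Φ α δ A) {t : ℝ}
    (ht : t ∈ Ioo (-δ) δ) :
    HasDerivAt (fun s => Real.log (mat (Pop h (Φ s α))).det)
      (2 * tr (Qop h (Φ t α)) - 2 * tr (Cop h (Φ t α))) t := by
  have hz := V.mem t ht
  set z := Φ t α with hzdef
  set R : Coord n →L[ℝ] Coord n :=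
    Ring.inverse (Pop h z) * (Qop h z * Pop h z) - (2 : ℝ) • Cop h z - Nop h z with hR
  have hPR : dPop h z = Pop h z * R := by
    ext1 a
    have h1 := H.two_smul_P_C hz a
    have h2 : ∀ b, Pop h z (Ring.inverse (Pop h z) b) = b :=
      DFunLike.congr_fun (Ring.mul_inverse_cancel _ (H.isUnit_P hz))
    simp only [hR, mul_apply_eq_comp, sub_apply, map_sub, smul_apply, map_smul]
    rw [h2, h1]
    abel
  have htr : tr R = 2 * tr (Qop h z) - 2 * tr (Cop h z) := by
    rw [hR, tr_sub, tr_sub, tr_smul, tr_N H hz, tr_mul_comm, mul_assoc,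
      Ring.mul_inverse_cancel _ (H.isUnit_P hz), mul_one]
    ring
  have hent : ∀ i j, HasDerivAt (fun s => mat (Pop h (Φ s α)) i j) (mat (dPop h z) i j) t := by
    intro i j
    have h1 := (V.hasDerivAt_comp H H.contDiffOn_P ht).clm_apply (hasDerivAt_const t (baseDir j))
    simp only [map_zero, add_zero] at h1
    exact ((EuclideanSpace.proj (𝕜 := ℝ) i).hasFDerivAt.comp_hasDerivAt t h1)
  have h1 := (hasDerivAt_det hent (by rw [hPR, mat_mul] : _ = mat (Pop h (Φ t α)) * mat R)).log
    (det_mat_P_pos H hz).ne'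
  refine h1.congr_deriv ?_
  rw [mul_div_cancel_left₀ _ (det_mat_P_pos H hz).ne', ← tr_eq_trace_mat, htr]

/-- The first two derivatives at `0` of `ψ` along a trajectory. The assumption `hleg` says that the
fibre Hessians of the Lagrangian and the Hamiltonian are inverse to each other. -/
theorem deriv_psiAlong (H : IsConvexHamiltonian Ω h) {D : Set (Phase n)} (hD : Ω ⊆ D)
    {α : Phase n} (hα : α ∈ Ω) {U : Set (Coord n)} (hU : IsOpen U) {ς : Coord n → ℝ}
    (hς : ContDiffOn ℝ ∞ ς U) (hΩU : ∀ z ∈ Ω, z.1 ∈ U) {l : Coord n × Coord n → ℝ}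
    (hleg : ∀ z ∈ Ω, (lagHessian l z.1 (hamVectorField h z).1).det * (mat (Pop h z)).det = 1) :
    deriv (psiAlong h l ς D α) 0 = psiRate h ς α ∧
      deriv (deriv (psiAlong h l ς D α)) 0 = tr (fderiv ℝ (Cop h) α (hamVectorField h α))
        + fderiv ℝ (fun z : Phase n => fderiv ℝ ς z.1 (hamVectorField h z).1) α (hamVectorField h α)
        - tr (fderiv ℝ (Qop h) α (hamVectorField h α)) := by
  obtain ⟨δ, A, V, -⟩ := exists_frame_values H hD hα
  set Φ := hamFlow h D α with hΦ
  have hη : ∀ t ∈ Ioo (-δ) δ, deriv (baseCurve h D α) t = (hamVectorField h (Φ t α)).1 :=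
    fun t ht => (hasDerivAt_fst (V.deriv_flow t ht)).deriv
  -- the velocity of the trajectory is the Legendre dual vector, where `det L_vv = 1 / det H_αα`
  have hψ : ∀ t ∈ Ioo (-δ) δ, psiAlong h l ς D α t
      = ς (Φ t α).1 - Real.log (mat (Pop h (Φ t α))).det / 2 := by
    intro t ht
    have h1 := hleg _ (V.mem t ht)
    have h2 := det_mat_P_pos H (V.mem t ht)
    have h3 := eq_inv_of_mul_eq_one_left h1
    rw [psiAlong, hη t ht, baseCurve, h3, Real.log_sqrt (inv_nonneg.mpr h2.le), Real.log_inv]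
    ring
  have hdψ : ∀ t ∈ Ioo (-δ) δ, HasDerivAt (psiAlong h l ς D α) (psiRate h ς (Φ t α)) t := by
    intro t ht
    have hz := V.mem t ht
    have h1 : HasDerivAt (fun s => ς (Φ s α).1)
        (fderiv ℝ ς (Φ t α).1 (hamVectorField h (Φ t α)).1) t :=
      ((hς.contDiffAt (hU.mem_nhds (hΩU _ hz))).differentiableAt
        (by simp)).hasFDerivAt.comp_hasDerivAt t (hasDerivAt_fst (V.deriv_flow t ht))
    have h2 := h1.fun_sub ((hasDerivAt_log_det_P H V ht).div_const 2)
    refine (h2.congr_of_eventuallyEq ?_).congr_deriv ?_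
    · filter_upwards [isOpen_Ioo.mem_nhds ht] with s hs using hψ s hs
    · rw [psiRate]
      ring
  have h0 := V.zero_mem
  have hflow : Φ 0 α = α := V.flow_zero
  refine ⟨by rw [(hdψ 0 h0).deriv, hflow], ?_⟩
  have h1 : deriv (psiAlong h l ς D α) =ᶠ[𝓝 0] fun t => psiRate h ς (Φ t α) := by
    filter_upwards [isOpen_Ioo.mem_nhds h0] with t ht using (hdψ t ht).deriv
  have hC := trL.hasFDerivAt.comp_hasDerivAt (0 : ℝ) (V.hasDerivAt_comp H H.contDiffOn_C h0)
  have hQ := trL.hasFDerivAt.comp_hasDerivAt (0 : ℝ) (V.hasDerivAt_comp H H.contDiffOn_Q h0)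
  have hw := V.hasDerivAt_comp H (contDiffOn_fderiv_weight H hU hς hΩU) h0
  rw [hflow] at hC hQ hw
  rw [h1.deriv_eq]
  exact ((hC.fun_add hw).fun_sub hQ).deriv

end Weight

/-! ### The left-hand side of the Bochner formula -/

section Bochner

variable {n : ℕ} {Ω : Set (Phase n)} {h : Phase n → ℝ} {W : Set (Coord n)} {w ς : Coord n → ℝ}

theorem contDiffOn_dPoint_snd (hW : IsOpen W) (hw : ContDiffOn ℝ ∞ w W) :
    ContDiffOn ℝ ∞ (fun y => (dPoint w y).2) W :=
  contDiffOn_euclidean.mpr fun _ => (hw.fderiv_of_isOpen hW (by simp)).clm_apply contDiffOn_const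

theorem contDiffOn_dPoint (hW : IsOpen W) (hw : ContDiffOn ℝ ∞ w W) :
    ContDiffOn ℝ ∞ (dPoint w) W :=
  contDiffOn_id.prodMk (contDiffOn_dPoint_snd hW hw)

theorem contDiffOn_Uop (hW : IsOpen W) (hw : ContDiffOn ℝ ∞ w W) : ContDiffOn ℝ ∞ (Uop w) W :=
  (contDiffOn_dPoint_snd hW hw).fderiv_of_isOpen hW (by simp)

theorem hasFDerivAt_of_contDiffOn {E F : Type*} [NormedAddCommGroup E] [NormedSpace ℝ E]
    [NormedAddCommGroup F] [NormedSpace ℝ F] {s : Set E} (hs : IsOpen s) {f : E → F}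
    (hf : ContDiffOn ℝ ∞ f s) {y : E} (hy : y ∈ s) : HasFDerivAt f (fderiv ℝ f y) y :=
  ((hf.contDiffAt (hs.mem_nhds hy)).differentiableAt (by simp)).hasFDerivAt

theorem hasFDerivAt_dPoint (hW : IsOpen W) (hw : ContDiffOn ℝ ∞ w W) {y : Coord n} (hy : y ∈ W) :
    HasFDerivAt (dPoint w) ((ContinuousLinearMap.id ℝ (Coord n)).prod (Uop w y)) y :=
  (hasFDerivAt_id y).prodMk (hasFDerivAt_of_contDiffOn hW (contDiffOn_dPoint_snd hW hw) hy)

/-- A smooth function on phase space, differentiated along the graph of `dw`. -/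
theorem hasFDerivAt_comp_dPoint (H : IsConvexHamiltonian Ω h) (hW : IsOpen W)
    (hw : ContDiffOn ℝ ∞ w W) (hG : ∀ y ∈ W, dPoint w y ∈ Ω) {F : Type*} [NormedAddCommGroup F]
    [NormedSpace ℝ F] {f : Phase n → F} (hf : ContDiffOn ℝ ∞ f Ω) {y : Coord n} (hy : y ∈ W) :
    HasFDerivAt (fun y => f (dPoint w y)) ((fderiv ℝ f (dPoint w y)).comp
      ((ContinuousLinearMap.id ℝ (Coord n)).prod (Uop w y))) y :=
  (H.hasFDerivAt hf (hG y hy)).comp y (hasFDerivAt_dPoint hW hw hy)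

/-- The weighted divergence as a trace. -/
theorem divergence_eq {V : Coord n → Coord n} {V' : Coord n →L[ℝ] Coord n} {q : Coord n}
    (hV : HasFDerivAt V V' q) : divergence ς V q = tr V' - fderiv ℝ ς q (V q) := by
  have h1 : ∀ i, partialBase (fun y => V y i) i q = V' (baseDir i) i := by
    intro i
    have := (EuclideanSpace.proj (𝕜 := ℝ) i).hasFDerivAt.comp q hV
    rw [partialBase]
    change fderiv ℝ (EuclideanSpace.proj (𝕜 := ℝ) i ∘ V) q _ = _
    rw [this.fderiv]
    rfl
  rw [divergence, Finset.sum_sub_distrib, tr_eq_sum]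
  congr 1
  · exact Finset.sum_congr rfl fun i _ => h1 i
  · conv_rhs => rw [coord_eq_sum (V q)]
    simp [partialBase]

theorem gradient_eq (h : Phase n → ℝ) (w : Coord n → ℝ) (y : Coord n) :
    gradient h w y = (hamVectorField h (dPoint w y)).1 := rfl

theorem hasFDerivAt_gradient (H : IsConvexHamiltonian Ω h) (hW : IsOpen W)
    (hw : ContDiffOn ℝ ∞ w W) (hG : ∀ y ∈ W, dPoint w y ∈ Ω) {y : Coord n} (hy : y ∈ W) :
    HasFDerivAt (gradient h w)
      (Qop h (dPoint w y) + Pop h (dPoint w y) * Uop w y) y := by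
  have h1 := (hasFDerivAt_comp_dPoint H hW hw hG H.contDiffOn_X hy).fst
  refine h1.congr_fderiv ?_
  ext1 a
  change (fderiv ℝ (hamVectorField h) (dPoint w y) (a, Uop w y a)).1 = _
  rw [fderiv_hamVectorField_apply]
  rfl

theorem laplacian_eq (H : IsConvexHamiltonian Ω h) (hW : IsOpen W) (hw : ContDiffOn ℝ ∞ w W)
    (hG : ∀ y ∈ W, dPoint w y ∈ Ω) {y : Coord n} (hy : y ∈ W) :
    laplacian h ς w y = tr (Qop h (dPoint w y)) + tr (Pop h (dPoint w y) * Uop w y)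
      - fderiv ℝ ς y (hamVectorField h (dPoint w y)).1 := by
  rw [laplacian, divergence_eq (hasFDerivAt_gradient H hW hw hG hy), tr_add, gradient_eq]

/-- The differential of `H(dw)`, as a vector. -/
noncomputable def Fvec (h : Phase n → ℝ) (w : Coord n → ℝ) (y : Coord n) : Coord n :=
  Uop w y (hamVectorField h (dPoint w y)).1 - (hamVectorField h (dPoint w y)).2

theorem partialBase_comp_dPoint (H : IsConvexHamiltonian Ω h) (hW : IsOpen W)
    (hw : ContDiffOn ℝ ∞ w W) (hG : ∀ y ∈ W, dPoint w y ∈ Ω) {y : Coord n} (hy : y ∈ W)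
    (j : Fin n) : partialBase (fun y => h (dPoint w y)) j y = Fvec h w y j := by
  have h1 := hasFDerivAt_comp_dPoint H hW hw hG H.contDiffOn hy
  rw [partialBase, h1.fderiv]
  change fderiv ℝ h (dPoint w y) (baseDir j, Uop w y (baseDir j)) = _
  rw [fderiv_eq_hamVectorField, ← Uop_symm (hw.contDiffAt (hW.mem_nhds hy)), ← inner_sub_left]
  simp [Fvec, baseDir, EuclideanSpace.inner_single_right]

/-- Symmetry of the second derivative of the Hamiltonian vector field, in terms of its blocks. -/
theorem fderiv_P_apply (H : IsConvexHamiltonian Ω h) {z : Phase n} (hz : z ∈ Ω) (a b f : Coord n) :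
    fderiv ℝ (Pop h) z (a, b) f
      = fderiv ℝ (Qop h) z (0, f) a + fderiv ℝ (Pop h) z (0, f) b := by
  have hD := H.hasFDerivAt H.contDiffOn_fderiv hz
  have hs : ∀ v v', fderiv ℝ (fderiv ℝ (hamVectorField h)) z v v'
      = fderiv ℝ (fderiv ℝ (hamVectorField h)) z v' v :=
    (H.contDiffOn_X.contDiffAt (H.isOpen.mem_nhds hz)).isSymmSndFDerivAt
      (by rw [minSmoothness_of_isRCLikeNormedField]; exact ENat.LEInfty.out)
  have hP : ∀ v c, fderiv ℝ (Pop h) z v c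
      = (fderiv ℝ (fderiv ℝ (hamVectorField h)) z v (0, c)).1 := by
    intro v c
    have h1 := (H.hasFDerivAt H.contDiffOn_P hz).clm_apply (hasFDerivAt_const c z)
    have h2 := (hD.clm_apply (hasFDerivAt_const ((0, c) : Phase n) z)).fst
    simpa using DFunLike.congr_fun (h1.unique h2) v
  have hQ : ∀ v c, fderiv ℝ (Qop h) z v c
      = (fderiv ℝ (fderiv ℝ (hamVectorField h)) z v (c, 0)).1 := by
    intro v c
    have h1 := (H.hasFDerivAt H.contDiffOn_Q hz).clm_apply (hasFDerivAt_const c z)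
    have h2 := (hD.clm_apply (hasFDerivAt_const ((c, 0) : Phase n) z)).fst
    simpa using DFunLike.congr_fun (h1.unique h2) v
  rw [hP, hQ, hP, hs, ← Prod.fst_add, ← map_add]
  simp

/-- The linearized Laplacian of `H(dw)`. The third derivatives of `w` enter only through
`tr (P U')`, with `U'` the derivative of the Hessian operator along the gradient. -/
theorem linLaplacian_eq (H : IsConvexHamiltonian Ω h) (hW : IsOpen W) (hw : ContDiffOn ℝ ∞ w W)
    (hG : ∀ y ∈ W, dPoint w y ∈ Ω) {q : Coord n} (hq : q ∈ W) :
    let z := dPoint w q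
    linLaplacian h ς w (fun y => h (dPoint w y)) q =
      tr (fderiv ℝ (Qop h) z (0, Fvec h w q)) + tr (fderiv ℝ (Pop h) z (0, Fvec h w q) * Uop w q)
        + tr (Pop h z * (fderiv ℝ (Uop w) q (hamVectorField h z).1 + Uop w q * Qop h z
          + Uop w q * Pop h z * Uop w q - Nop h z * Uop w q + Sop h z))
        - fderiv ℝ ς q (Pop h z (Fvec h w q)) := by
  intro z
  have hz : z ∈ Ω := hG q hq
  have hV : (fun y => (WithLp.toLp 2 fun i => ∑ j, partialAA h i j (dPoint w y)
      * partialBase (fun y => h (dPoint w y)) j y : Coord n)) =ᶠ[𝓝 q]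
      fun y => Pop h (dPoint w y) (Fvec h w y) := by
    filter_upwards [hW.mem_nhds hq] with y hy
    ext i
    conv_rhs => rw [coord_eq_sum (Fvec h w y)]
    simp only [map_sum, map_smul, WithLp.ofLp_sum, Finset.sum_apply, PiLp.smul_apply, smul_eq_mul]
    refine Finset.sum_congr rfl fun j _ => ?_
    rw [partialAA_eq_inner H.isOpen H.contDiffOn (hG y hy), partialBase_comp_dPoint H hW hw hG hy,
      mul_comm]
    rfl
  have hU := hasFDerivAt_of_contDiffOn hW (contDiffOn_Uop hW hw) hq
  have hP := hasFDerivAt_comp_dPoint H hW hw hG H.contDiffOn_P hq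
  have hX := hasFDerivAt_comp_dPoint H hW hw hG H.contDiffOn_X hq
  have hF : HasFDerivAt (Fvec h w) _ q := (hU.clm_apply hX.fst).fun_sub hX.snd
  have hPF := (hP.clm_apply hF).congr_of_eventuallyEq hV
  have hsymm : ∀ a b, fderiv ℝ (Uop w) q a b = fderiv ℝ (Uop w) q b a :=
    ((contDiffOn_dPoint_snd hW hw).contDiffAt (hW.mem_nhds hq)).isSymmSndFDerivAt
      (by rw [minSmoothness_of_isRCLikeNormedField]; exact ENat.LEInfty.out)
  rw [linLaplacian, divergence_eq hPF, hV.eq_of_nhds]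
  congr 1
  rw [← tr_add, ← tr_add]
  congr 1
  ext1 a
  simp only [add_apply, ContinuousLinearMap.comp_apply,
    ContinuousLinearMap.flip_apply, sub_apply, mul_apply_eq_comp,
    ContinuousLinearMap.prod_apply, ContinuousLinearMap.id_apply, ContinuousLinearMap.coe_fst',
    ContinuousLinearMap.coe_snd', fderiv_hamVectorField_apply, map_add,
    map_sub]
  rw [fderiv_P_apply H hz a, hsymm a]
  abel

/-- The left-hand side of the Bochner formula in terms of the linearized flow. The third derivatives
of `w`, and the derivatives of `P` and `Q` in the fibre direction `dH(dw)`, cancel. -/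
theorem bochner_eq (H : IsConvexHamiltonian Ω h) (hW : IsOpen W) (hw : ContDiffOn ℝ ∞ w W)
    (hς : ContDiffOn ℝ ∞ ς W) (hG : ∀ y ∈ W, dPoint w y ∈ Ω) {q : Coord n} (hq : q ∈ W) :
    let z := dPoint w q
    bochner h ς w q = tr (Sop h z * Pop h z) + tr (Uop w q * Pop h z * (Uop w q * Pop h z))
      + 2 * tr (Uop w q * Qop h z * Pop h z) - tr (Uop w q * dPop h z)
      + fderiv ℝ (fun z : Phase n => fderiv ℝ ς z.1 (hamVectorField h z).1) z (hamVectorField h z)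
      - tr (fderiv ℝ (Qop h) z (hamVectorField h z)) := by
  intro z
  have hz : z ∈ Ω := hG q hq
  have hzq : dPoint w q = z := rfl
  set X := hamVectorField h z with hX
  set f := Fvec h w q with hf
  have hσ : ContDiffOn ℝ ∞ (fun z : Phase n => fderiv ℝ ς z.1 (hamVectorField h z).1)
      (Ω ∩ {z | z.1 ∈ W}) := by
    have h1 : IsConvexHamiltonian (Ω ∩ {z | z.1 ∈ W}) h :=
      ⟨H.isOpen.inter (hW.preimage continuous_fst), H.contDiffOn.mono inter_subset_left,
        fun z hz => H.pos z hz.1⟩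
    exact contDiffOn_fderiv_weight h1 hW hς fun z hz => hz.2
  have hσz : HasFDerivAt (fun z : Phase n => fderiv ℝ ς z.1 (hamVectorField h z).1)
      (fderiv ℝ (fun z : Phase n => fderiv ℝ ς z.1 (hamVectorField h z).1) z) z :=
    hasFDerivAt_of_contDiffOn (H.isOpen.inter (hW.preimage continuous_fst)) hσ ⟨hz, hq⟩
  -- the derivative of `dς(H_α)` in the fibre directions
  have hσf : fderiv ℝ (fun z : Phase n => fderiv ℝ ς z.1 (hamVectorField h z).1) z (0, f)
      = fderiv ℝ ς q (Pop h z f) := by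
    have h1 : HasFDerivAt (fun z : Phase n => fderiv ℝ ς z.1) _ z :=
      (hasFDerivAt_of_contDiffOn hW (hς.fderiv_of_isOpen (m := ∞) hW (by simp)) hq).comp z
        (hasFDerivAt_fst (p := z))
    have h2 := h1.clm_apply (H.hasFDerivAt H.contDiffOn_X hz).fst
    have h3 := DFunLike.congr_fun (hσz.unique h2) (0, f)
    rw [h3]
    simp only [add_apply, ContinuousLinearMap.comp_apply, ContinuousLinearMap.flip_apply,
      ContinuousLinearMap.coe_fst', map_zero, zero_apply, add_zero, fderiv_hamVectorField_apply,
      zero_add]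
    rfl
  have hU := hasFDerivAt_of_contDiffOn hW (contDiffOn_Uop hW hw) hq
  have hP := hasFDerivAt_comp_dPoint H hW hw hG H.contDiffOn_P hq
  have hQ := hasFDerivAt_comp_dPoint H hW hw hG H.contDiffOn_Q hq
  have hσG := hσz.comp q (hasFDerivAt_dPoint hW hw hq)
  have hΛ : laplacian h ς w =ᶠ[𝓝 q] fun y => trL (Qop h (dPoint w y))
      + trL ((Pop h (dPoint w y)).comp (Uop w y))
      - fderiv ℝ ς y (hamVectorField h (dPoint w y)).1 := by
    filter_upwards [hW.mem_nhds hq] with y hy using laplacian_eq H hW hw hG hy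
  have hdΛ := (((trL.hasFDerivAt.comp q hQ).fun_add
    (trL.hasFDerivAt.comp q (hP.clm_comp hU))).fun_sub hσG).congr_of_eventuallyEq hΛ
  -- the velocity of the graph of `dw` along the gradient differs from `X` by a vertical vector
  have hvel : ((X.1, Uop w q X.1) : Phase n) = X + (0, f) := by
    refine Prod.ext ?_ ?_
    · simp
    · simp [hf, Fvec, hzq, ← hX]
  rw [bochner, linLaplacian_eq H hW hw hG hq, hdΛ.fderiv, gradient_eq]
  simp only [sub_apply, add_apply, ContinuousLinearMap.comp_apply, ContinuousLinearMap.prod_apply,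
    ContinuousLinearMap.id_apply, ContinuousLinearMap.flip_apply,
    ContinuousLinearMap.compL_apply, trL_apply]
  simp only [hzq, ← hX, ← hf, hvel, map_add, hσf, ← ContinuousLinearMap.mul_def,
    add_mul, mul_add, mul_sub, tr_add, tr_sub]
  have h1 : tr (Pop h z * (Nop h z * Uop w q)) = -tr (Uop w q * Qop h z * Pop h z) := by
    rw [tr_eq_sum_inner, tr_eq_sum_inner, ← Finset.sum_neg_distrib]
    refine Finset.sum_congr rfl fun i _ => ?_
    simp only [mul_apply_eq_comp]
    rw [H.P_symm hz, H.N_adjoint hz, Uop_symm (hw.contDiffAt (hW.mem_nhds hq)),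
      real_inner_comm]
  have h2 : tr (Pop h z * (Uop w q * Qop h z)) = tr (Uop w q * Qop h z * Pop h z) :=
    tr_mul_comm _ _
  have h3 : tr (Pop h z * (Uop w q * Pop h z * Uop w q))
      = tr (Uop w q * Pop h z * (Uop w q * Pop h z)) := by
    rw [tr_mul_comm]
    simp only [mul_assoc]
  have h4 : tr (fderiv ℝ (Pop h) z X * Uop w q) = tr (Uop w q * dPop h z) := tr_mul_comm _ _
  rw [h1, h2, h3, h4, tr_mul_comm (Pop h z) (Sop h z)]
  ring

end Bochner

/-! ### The Bochner–Weitzenböck formula in coordinates -/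

section Formula

variable {n : ℕ} {Ω : Set (Phase n)} {h : Phase n → ℝ} {w : Coord n → ℝ} {q : Coord n}

/-- `2 tr (U P C) = 2 tr (U Q P) - tr (U P')`, from the definition of `C` and `N = -Qᵀ`. -/
theorem two_mul_tr_UPC (H : IsConvexHamiltonian Ω h) (hw : ContDiffAt ℝ ∞ w q)
    (hz : dPoint w q ∈ Ω) :
    2 * tr (Uop w q * Pop h (dPoint w q) * Cop h (dPoint w q))
      = 2 * tr (Uop w q * Qop h (dPoint w q) * Pop h (dPoint w q))
        - tr (Uop w q * dPop h (dPoint w q)) := by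
  set z := dPoint w q
  have h1 : (2 : ℝ) • (Uop w q * Pop h z * Cop h z)
      = -(Uop w q * dPop h z) + Uop w q * Qop h z * Pop h z - Uop w q * (Pop h z * Nop h z) := by
    ext1 a
    have := congrArg (Uop w q) (H.two_smul_P_C hz a)
    rw [map_sub, map_add, map_neg, map_smul] at this
    exact this
  have h2 : tr (Uop w q * (Pop h z * Nop h z)) = -tr (Uop w q * Qop h z * Pop h z) := by
    rw [mul_assoc, tr_mul_comm (Uop w q) (Qop h z * Pop h z), tr_eq_sum_inner, tr_eq_sum_inner,
      ← Finset.sum_neg_distrib]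
    refine Finset.sum_congr rfl fun i _ => ?_
    simp only [mul_apply_eq_comp]
    rw [Uop_symm hw, H.P_symm hz, H.N_adjoint hz, real_inner_comm]
  rw [← tr_smul, h1, tr_sub, tr_add, tr_neg, h2]
  ring

/-- The traces of the curvature operator and of the squared Hessian, added up: `C` drops out. -/
theorem tr_Rop_add (H : IsConvexHamiltonian Ω h) (hw : ContDiffAt ℝ ∞ w q)
    (hz : dPoint w q ∈ Ω) :
    let z := dPoint w q
    tr (Rop h z) + tr (fderiv ℝ (Cop h) z (hamVectorField h z)) + tr (Kop h w q * Kop h w q)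
      = tr (Sop h z * Pop h z) + tr (Uop w q * Pop h z * (Uop w q * Pop h z))
        + 2 * tr (Uop w q * Qop h z * Pop h z) - tr (Uop w q * dPop h z) := by
  intro z
  have h1 := two_mul_tr_UPC H hw hz
  have hzq : dPoint w q = z := rfl
  rw [hzq] at h1
  rw [Rop, Kop]
  simp only [hzq, mul_add, add_mul, tr_add, tr_sub]
  rw [tr_mul_comm (Nop h z) (Cop h z), tr_mul_comm (Cop h z) (Uop w q * Pop h z)]
  linarith

/-- The Laplacian is the trace of the Hessian corrected by the derivative of `ψ`. -/
theorem laplacian_eq_tr_K (H : IsConvexHamiltonian Ω h) {W : Set (Coord n)} (hW : IsOpen W)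
    (hw : ContDiffOn ℝ ∞ w W) (hG : ∀ y ∈ W, dPoint w y ∈ Ω) (hq : q ∈ W) (ς : Coord n → ℝ) :
    laplacian h ς w q = tr (Kop h w q) - psiRate h ς (dPoint w q) := by
  rw [laplacian_eq H hW hw hG hq, Kop, psiRate, tr_add, tr_mul_comm (Uop w q)]
  change _ = _ - (_ + fderiv ℝ ς q _ - _)
  ring

/-- The Bochner–Weitzenböck formula and the resulting inequalities, for a convex Hamiltonian in
coordinates whose fibre Hessian is inverse to that of the Lagrangian `l`. -/
theorem bochner_formula (H : IsConvexHamiltonian Ω h) {D : Set (Phase n)} (hD : Ω ⊆ D)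
    {U : Set (Coord n)} (hU : IsOpen U) (hΩU : ∀ z ∈ Ω, z.1 ∈ U) {ς : Coord n → ℝ}
    (hς : ContDiffOn ℝ ∞ ς U) {l : Coord n × Coord n → ℝ}
    (hleg : ∀ z ∈ Ω, (lagHessian l z.1 (hamVectorField h z).1).det * (mat (Pop h z)).det = 1)
    (hw : ContDiffOn ℝ ∞ w U) (hα : dPoint w q ∈ Ω) (hα2 : (dPoint w q).2 ≠ 0) (hn : 0 < n) :
    bochner h ς w q = ricciInfty h l ς D (dPoint w q) + hessianHSNormSq h D w q ∧
      ∀ N : ℝ, (n : ℝ) ≤ N → ricciN h l ς D N (dPoint w q)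
        + (((laplacian h ς w q) ^ 2 / N : ℝ) : EReal) ≤ ((bochner h ς w q : ℝ) : EReal) := by
  have hqU : q ∈ U := hΩU _ hα
  have hWo : IsOpen (U ∩ dPoint w ⁻¹' Ω) :=
    (contDiffOn_dPoint hU hw).continuousOn.isOpen_inter_preimage hU H.isOpen
  have hwq := hw.contDiffAt (hU.mem_nhds hqU)
  have hG : ∀ y ∈ U ∩ dPoint w ⁻¹' Ω, dPoint w y ∈ Ω := fun y hy => hy.2
  have hqW : q ∈ U ∩ dPoint w ⁻¹' Ω := ⟨hqU, hα⟩
  have hwW := hw.mono (inter_subset_left (t := dPoint w ⁻¹' Ω))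
  obtain ⟨hψ1, hψ2⟩ := deriv_psiAlong H hD hα hU hς hΩU hleg
  obtain ⟨hHS, hCS⟩ := hessianHSNormSq_eq H hD hwq hα
  have hB := bochner_eq H hWo hwW (hς.mono inter_subset_left) hG hqW
  have hR := tr_Rop_add H hwq hα
  have hΔ := laplacian_eq_tr_K H hWo hwW hG hqW ς
  have hric := ricci_eq_tr H hD hα hα2
  have heq : bochner h ς w q = ricci h D (dPoint w q)
      + deriv (deriv (psiAlong h l ς D (dPoint w q))) 0 + hessianHSNormSq h D w q := by
    rw [hHS, hψ2, hric]
    linarith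
  refine ⟨by rw [ricciInfty, if_neg hα2, heq], fun N hN => ?_⟩
  have hn' : (0 : ℝ) < n := by exact_mod_cast hn
  rw [ricciN, if_neg hα2]
  set a := tr (Kop h w q)
  set b := psiRate h ς (dPoint w q)
  have ha : a ^ 2 / n ≤ hessianHSNormSq h D w q := by
    rw [div_le_iff₀ hn']
    linarith
  rw [hψ1, hΔ, heq]
  split_ifs with hNn hb
  · rw [← EReal.coe_add, EReal.coe_le_coe_iff, hNn, hb, sub_zero]
    linarith
  · rw [EReal.bot_add]
    exact bot_le
  · rw [← EReal.coe_add, EReal.coe_le_coe_iff]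
    have hNn' : 0 < N - n := sub_pos.mpr (lt_of_le_of_ne hN (Ne.symm hNn))
    -- `(a - b)² / N ≤ a² / n + b² / (N - n)`
    have h1 : (a - b) ^ 2 / N ≤ a ^ 2 / n + b ^ 2 / (N - n) := by
      have hN0 : 0 < N := hn'.trans_le hN
      have h2 : a ^ 2 / n + b ^ 2 / (N - n) - (a - b) ^ 2 / N
          = (a * (N - n) + b * n) ^ 2 / (n * N * (N - n)) := by
        field_simp
        ring
      have h3 : 0 ≤ (a * (N - n) + b * n) ^ 2 / (n * N * (N - n)) := by positivity
      linarith
    linarith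

end Formula

/-! ### The Bochner–Weitzenböck formula on the manifold -/

section Manifold

variable {n : ℕ} {U : Set (Coord n)} {l : Coord n × Coord n → ℝ} {h : Phase n → ℝ}

/-- Off the zero section, the Legendre transform of a Lagrangian is a convex Hamiltonian. -/
theorem IsCoordLagrangian.isConvexHamiltonian (hU : IsOpen U) (hl : IsCoordLagrangian U l)
    (hn : 0 < n) (hh : ∀ x ∈ U, ∀ p, h (x, p) = ⨆ v, (inner ℝ p v - l (x, v))) :
    IsConvexHamiltonian (U ×ˢ {p | p ≠ 0}) h :=
  ⟨hU.prod isOpen_ne, hl.contDiffOn_hamiltonian hU hn hh,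
    fun _ hz _ hζ => fibreHessian_pos hU hl hn hh hz.1 hz.2 hζ⟩

/-- The fibre Hessians of the Lagrangian and the Hamiltonian have reciprocal determinants. -/
theorem IsCoordLagrangian.det_lagHessian_mul (hU : IsOpen U) (hl : IsCoordLagrangian U l)
    (hn : 0 < n) (hh : ∀ x ∈ U, ∀ p, h (x, p) = ⨆ v, (inner ℝ p v - l (x, v))) {z : Phase n}
    (hz : z ∈ U ×ˢ {p : Coord n | p ≠ 0}) :
    (lagHessian l z.1 (hamVectorField h z).1).det * (mat (Pop h z)).det = 1 := by
  obtain ⟨-, h1⟩ := fderiv_fderiv_fibre_hamVectorField hU hl hn hh hz.1 hz.2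
  have h2 : (mat (Pop h z)).transpose * lagHessian l z.1 (hamVectorField h z).1 = 1 := by
    ext i j
    have h3 := h1 (baseDir i) (baseDir j)
    change fderiv ℝ (fderiv ℝ fun v => l (z.1, v)) (hamVectorField h z).1
      (Pop h z (baseDir i)) (baseDir j) = _ at h3
    rw [coord_eq_sum (Pop h z (baseDir i))] at h3
    simp only [map_sum, map_smul, sum_apply, smul_apply, smul_eq_mul] at h3
    rw [Matrix.mul_apply]
    refine h3.trans ?_
    rw [baseDir, baseDir, EuclideanSpace.inner_single_left]
    simp [Matrix.one_apply]
  rw [mul_comm, ← Matrix.det_transpose, ← Matrix.det_mul, h2, Matrix.det_one]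

end Manifold

end HamiltonianBW

theorem mainTheorem1 {n : ℕ} (hn : 2 ≤ n) {M : Type*} [TopologicalSpace M] [T2Space M]
    [SecondCountableTopology M] [ConnectedSpace M]
    [ChartedSpace (EuclideanSpace ℝ (Fin n)) M] [IsManifold (𝓡 n) ∞ M]
    [MeasurableSpace M] [BorelSpace M]
    (L : TangentBundle (𝓡 n) M → ℝ) (hL : HamiltonianBW.IsLagrangian L)
    (hH : HamiltonianBW.HasFiniteHamiltonian L)
    (m : Measure M) (hm : HamiltonianBW.IsSmoothPositiveMeasure (n := n) m)
    (u : M → ℝ) (hu : ContMDiff (𝓡 n) 𝓘(ℝ, ℝ) ∞ u)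
    (x : M) (hx : mfderiv (𝓡 n) 𝓘(ℝ, ℝ) u x ≠ 0)
    (φ : OpenPartialHomeomorph M (EuclideanSpace ℝ (Fin n)))
    (hφ : φ ∈ IsManifold.maximalAtlas (𝓡 n) ∞ M) (hxφ : x ∈ φ.source) :
    HamiltonianBW.chartBochner L m φ u x
        = HamiltonianBW.chartRicciInfty L m φ u x + HamiltonianBW.chartHessianHSNormSq L φ u x ∧
      ∀ N : ℝ, (n : ℝ) ≤ N →
        HamiltonianBW.chartRicciN L m φ N u x
            + (((HamiltonianBW.chartLaplacian L m φ u x) ^ 2 / N : ℝ) : EReal)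
          ≤ ((HamiltonianBW.chartBochner L m φ u x : ℝ) : EReal) := by
  -- off the zero section over the chart domain, the Hamiltonian is smooth and convex
  have hn0 : 0 < n := by omega
  have hl := HamiltonianBW.isCoordLagrangian_coordLagrangian hL hH hφ
  have hh := fun q hq => HamiltonianBW.coordHamiltonian_eq_iSup L hφ (x := q) hq
  have hdu := HamiltonianBW.chartDu_snd_ne_zero hu hφ hxφ hx
  exact HamiltonianBW.bochner_formula (hl.isConvexHamiltonian φ.open_target hn0 hh)
    (Set.prod_mono_right (Set.subset_univ _)) φ.open_target (fun z hz => hz.1)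
    (HamiltonianBW.contDiffOn_weight hm hφ)
    (fun z hz => hl.det_lagHessian_mul φ.open_target hn0 hh hz)
    (HamiltonianBW.contDiffOn_comp_symm hu hφ) ⟨φ.map_source hxφ, hdu⟩ hdu hn0
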